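/- Let $n\ge 0$, let $\theta$ be quaternionic conjugation, $(h,k)_{\mathbb H}=\sum_i\theta(h_i)k_i$ on $\mathbb H^{n+1}$, $\langle h,k\rangle=\operatorname{Re}(h,k)_{\mathbb H}$, $\|q\|=\sqrt{\langle q,q\rangle}$, and $S^{4n+3}=\{p\in\mathbb H^{n+1}:\langle p,p\rangle=1\}$ with its standard metric. For Hermitian $X,Y\in M(n+1,\mathbb H)$ let $X\circ Y=\frac12(XY+YX)$ and $\|X\|=\sqrt{\operatorname{tr}(X\circ X)}$. Let $P^n\mathbb H=\{(p_i\theta(p_j)):p\in S^{4n+3}\}\subset M(n+1,\mathbb H)$ with the metric $g(Q_1,Q_2)=\frac12\operatorname{tr}(Q_1\circ Q_2)$, for which the Hopf map $S^{4n+3}\to P^n\mathbb H$ is a Riemannian submersion. By the metrics, identify cotangent bundles with tangent bundles; let $\theta_S,\theta_{P^n\mathbb H}$ be the canonical one-forms and $\omega_S=d\theta_S$, $\omega_{\mathbb H}=d\theta_{P^n\mathbb H}$ the canonical symplectic forms. Let $\rho:\mathbb H\to M(2,\mathbb C)$, $$\rho(x_0+x_1e_1+x_2e_2+x_3e_3)=\begin{pmatrix}x_0+\sqrt{-1}x_1&x_2+\sqrt{-1}x_3\\-x_2+\sqrt{-1}x_3&x_0-\sqrt{-1}x_1\end{pmatrix},$$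 and for complex matrices let $\|A\|=\sqrt{\sum|a_{ij}|^2}$, and $\|B\|=\sqrt{\sum_i\|B_i\|^2}$ for $B=(B_0,\dots,B_n)\in M(2,\mathbb C)^{n+1}$. Put $$\begin{aligned} T^0S&=\{(p,q)\in \mathbb H^{n+1}\times\mathbb H^{n+1}:\langle p,p\rangle=1,\ \langle p,q\rangle=0,\ q\neq0\},\\ \mathbf E_S&=\{(p,q):\langle p,p\rangle=1,\ \langle p,q\rangle=0,\ q+p\,(q,p)_{\mathbb H}\ne0\},\\ \widetilde{\mathbf E_S}&=\{B\in M(2,\mathbb C)^{n+1}:z,w\text{ linearly independent},\ \textstyle\sum_i\det B_i=0\}, \end{aligned}$$ where $z,w\in\mathbb C^{2n+2}$ are the two columns of the $(2n+2)\times2$ matrix formed by $B_0,\dots,B_n$, and $$\begin{aligned} \mathbf E_{\mathbb H}&=\{(P,Q):P\in P^n\mathbb H,\ Q\in M(n+1,\mathbb H)\text{ Hermitian},\ P\circ Q=\tfrac12Q,\ Q\ne0\},\\ \widetilde{\mathbf E_{\mathbb H}}&=\{A\in M(2n+2,\mathbb C):\mathbb J A={}^tA\,\mathbb J,\ \operatorname{rank}A=2,\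 A^2=0\}, \end{aligned}$$ with $\mathbb J$ block diagonal with blocks $\begin{pmatrix}0&1\\-1&0\end{pmatrix}$. Let $$\tau_S(p,q)=\big(\|q\|\rho(p_i)+\sqrt{-1}\rho(q_i)\big)_i,\qquad \tau_{\mathbb H}(P,Q)=\|Q\|^2\rho(P)-\rho(Q)^2+\tfrac{\sqrt{-1}}{\sqrt2}\|Q\|\rho(Q),$$ where $\rho(X)=(\rho(X_{ij}))$. Then the following hold. 1. On $\mathbf E_S$, and indeed on the whole punctured (co)tangent bundle $T^0S$ of the sphere, $$\theta_S=\tau_S^*\Big(2^{-1}\sqrt{-1}\,(\partial-\bar\partial)\|B\|\Big),\qquad \omega_S=\tau_S^*\Big(\sqrt{-1}\,\bar\partial\partial\sqrt{\textstyle\sum_i\|B_i\|^2}\Big).$$ 2. $\mathbf E_{\mathbb H}$ is the punctured tangent bundle of $P^n\mathbb H$, and on it $$\theta_{P^n\mathbb H}=\tau_{\mathbb H}^*\Big(2^{-3/4}\sqrt{-1}\,(\partial-\bar\partial)\sqrt{\|A\|}\Big),\qquad \omega_{\mathbb H}=\tau_{\mathbb H}^*\Big(2^{1/4}\sqrt{-1}\,\bar\partial\partial\sqrt{\|A\|}\Big).$$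 3. These are Kähler structures: $\mathbf E_S\subset T^0S$; $T^0S$, $\mathbf E_S$, $\mathbf E_{\mathbb H}$ are submanifolds of real dimension $8n+6,8n+6,8n$, and $\tau_S$, $\tau_S$, $\tau_{\mathbb H}$ map them diffeomorphically onto the complex submanifolds $\{B\neq0:\sum_i\det B_i=0\}$, $\widetilde{\mathbf E_S}$, $\widetilde{\mathbf E_{\mathbb H}}$ of complex dimension $4n+3,4n+3,4n$. For the complex structure $\mathcal I$ carried over from these, the natural symplectic form $\omega=\omega_S$ (resp. $\omega_{\mathbb H}$) is closed and $\mathcal I$-invariant, and $(u,v)\mapsto\omega(\mathcal I u,v)$ is positive definite; that is, $\omega$ is the Kähler form. -/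

import Mathlib

open scoped Quaternion ContDiff Topology Matrix
open Set

namespace HopfKaehler

noncomputable section

/- Spaces of matrices get their standard topology and linear structure. The (sup) norm of these
instances is used only as a carrier of differential calculus; all norms in the statement are the
explicit functions defined below. -/
attribute [local instance] Matrix.normedAddCommGroup Matrix.normedSpace

/-! ### Embedded submanifolds of a vector space, differential forms on them -/

section Calculus

/-- `M` is an embedded submanifold of dimension `d` over `𝕜`: near each of its points there is a
slice chart, that is a diffeomorphism (a biholomorphism for `𝕜 = ℂ`) of an open set of the ambient
space onto an open set of `𝕜ᵈ × 𝕜ᶜ` which carries `M` to `𝕜ᵈ × {0}`. -/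
def IsSubmanifold (𝕜 : Type) [NontriviallyNormedField 𝕜] {V : Type} [NormedAddCommGroup V]
    [NormedSpace 𝕜 V] (d : ℕ) (M : Set V) : Prop :=
  ∀ x ∈ M, ∃ (c : ℕ) (Φ : OpenPartialHomeomorph V ((Fin d → 𝕜) × (Fin c → 𝕜))),
    x ∈ Φ.source ∧ ContDiffOn 𝕜 ∞ Φ Φ.source ∧ ContDiffOn 𝕜 ∞ Φ.symm Φ.target ∧
      ∀ y ∈ Φ.source, (y ∈ M ↔ (Φ y).2 = 0)

variable {V : Type} [NormedAddCommGroup V] [NormedSpace ℝ V]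
variable {W : Type} [NormedAddCommGroup W] [NormedSpace ℝ W]

/-- The tangent space of `M` at `x`: spanned by the velocities at `x` of smooth curves in `M`.
(For a submanifold these velocities already form a linear subspace.) -/
def tangentSpaceAt (M : Set V) (x : V) : Submodule ℝ V :=
  Submodule.span ℝ {v | ∃ γ : ℝ → V, ContDiffAt ℝ ∞ γ 0 ∧ (∀ᶠ t in 𝓝 (0 : ℝ), γ t ∈ M) ∧
    γ 0 = x ∧ deriv γ 0 = v}

/-- The punctured tangent bundle of `X`, as a subset of the square of the ambient space. -/
def puncturedTangentBundle (X : Set V) : Set (V × V) :=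
  {x | x.1 ∈ X ∧ x.2 ∈ tangentSpaceAt X x.1 ∧ x.2 ≠ 0}

/-- `τ` restricts to a diffeomorphism of `M` onto `N`. -/
def IsDiffeoOnto (τ : V → W) (M : Set V) (N : Set W) : Prop :=
  ContDiffOn ℝ ∞ τ M ∧ MapsTo τ M N ∧
    ∃ σ : W → V, ContDiffOn ℝ ∞ σ N ∧ MapsTo σ N M ∧ InvOn σ τ M N

/-- The pull-back `τ^* η` of a form. -/
def pullback {F : Type} [NormedAddCommGroup F] [NormedSpace ℝ F] {k : ℕ}
    (τ : V → W) (η : W → W [⋀^Fin k]→L[ℝ] F) (x : V) : V [⋀^Fin k]→L[ℝ] F :=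
  (η (τ x)).compContinuousLinearMap (fderiv ℝ τ x)

/-- A real form, seen as a complex valued form. -/
def complexify {k : ℕ} (η : V → V [⋀^Fin k]→L[ℝ] ℝ) (x : V) : V [⋀^Fin k]→L[ℝ] ℂ :=
  Complex.ofRealCLM.compContinuousAlternatingMap (η x)

/-- Two forms given on (a neighbourhood of `M` in) the ambient space have the same restriction to
the submanifold `M`. Restriction commutes with `d`, and for a complex submanifold with
`∂` and `∂̄`. -/
def EqOnSubmanifold {F : Type} [NormedAddCommGroup F] [NormedSpace ℝ F] {k : ℕ} (M : Set V)
    (η₁ η₂ : V → V [⋀^Fin k]→L[ℝ] F) : Prop :=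
  ∀ x ∈ M, ∀ v : Fin k → V, (∀ i, v i ∈ tangentSpaceAt M x) → η₁ x v = η₂ x v

/-- Let the cotangent bundle of a Riemannian submanifold `X` of `V` be identified with
`TX ⊆ V × V` by the metric, `flat p q = g_p(q, ·)`. The canonical one-form on it is
`(p, q) ↦ g_p(q, ·) ∘ dπ`, where `π (p, q) = p` is the projection to `X`. -/
def canonicalOneForm (flat : V → V → V →L[ℝ] ℝ) (x : V × V) : (V × V) [⋀^Fin 1]→L[ℝ] ℝ :=
  ContinuousAlternatingMap.ofSubsingleton ℝ (V × V) ℝ (0 : Fin 1)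
    ((flat x.1 x.2).comp (fderiv ℝ (Prod.fst : V × V → V) x))

/-- The canonical symplectic form, the exterior derivative of the canonical one-form. -/
def canonicalSymplecticForm (flat : V → V → V →L[ℝ] ℝ) (x : V × V) :
    (V × V) [⋀^Fin 2]→L[ℝ] ℝ :=
  extDeriv (canonicalOneForm flat) x

end Calculus

/-! ### The operators `∂` and `∂̄` on a complex vector space -/

section Dolbeault

variable {W : Type} [NormedAddCommGroup W] [NormedSpace ℝ W] [NormedSpace ℂ W]
  [IsScalarTower ℝ ℂ W]

/-- Multiplication by `√-1`, as a real linear map. -/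
def mulI : W →L[ℝ] W := (Complex.I • ContinuousLinearMap.id ℂ W).restrictScalars ℝ

/-- `∂f`, the complex linear part of `df`. -/
def del (f : W → ℂ) (x : W) : W [⋀^Fin 1]→L[ℝ] ℂ :=
  ContinuousAlternatingMap.ofSubsingleton ℝ W ℂ (0 : Fin 1)
    ((1 / 2 : ℂ) • (fderiv ℝ f x - Complex.I • (fderiv ℝ f x).comp mulI))

/-- `∂̄f`, the complex antilinear part of `df`. -/
def delbar (f : W → ℂ) (x : W) : W [⋀^Fin 1]→L[ℝ] ℂ :=
  ContinuousAlternatingMap.ofSubsingleton ℝ W ℂ (0 : Fin 1)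
    ((1 / 2 : ℂ) • (fderiv ℝ f x + Complex.I • (fderiv ℝ f x).comp mulI))

/-- `∂̄η` for a form `η` of type `(1,0)`: the part of type `(1,1)` of `dη`. The part of type
`(1,1)` of a two-form `Ω` is `(u, v) ↦ (Ω(u, v) + Ω(iu, iv)) / 2`, since `Ω(iu, iv)` is `Ω(u, v)`
on type `(1,1)` and `-Ω(u, v)` on types `(2,0)` and `(0,2)`. -/
def delbarOneZero (η : W → W [⋀^Fin 1]→L[ℝ] ℂ) (x : W) : W [⋀^Fin 2]→L[ℝ] ℂ :=
  (1 / 2 : ℂ) • (extDeriv η x + (extDeriv η x).compContinuousLinearMap mulI)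

/-- `∂̄∂f`. -/
def delbarDel (f : W → ℂ) : W → W [⋀^Fin 2]→L[ℝ] ℂ := delbarOneZero (del f)

end Dolbeault

/-- The diffeomorphism `τ` of the submanifold `M` onto the complex submanifold `N` (of complex
dimension `d`) makes `M` a Kähler manifold with Kähler form `Ω`: for the complex structure `J`
that `τ` transports from `N` to `M`, the form `Ω` is closed, `J`-invariant, and
`g(u, v) = Ω(Ju, v)` (symmetric by invariance) is positive definite. -/
structure IsKaehlerVia {V : Type} [NormedAddCommGroup V] [NormedSpace ℝ V]
    {W : Type} [NormedAddCommGroup W] [NormedSpace ℝ W] [NormedSpace ℂ W]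
    (d : ℕ) (M : Set V) (N : Set W) (τ : V → W) (Ω : V → V [⋀^Fin 2]→L[ℝ] ℝ) : Prop where
  submanifold : IsSubmanifold ℝ (2 * d) M
  complexSubmanifold : IsSubmanifold ℂ d N
  diffeo : IsDiffeoOnto τ M N
  closed : EqOnSubmanifold M (extDeriv Ω) 0
  kaehler : ∃ J : (x : V) → tangentSpaceAt M x →ₗ[ℝ] tangentSpaceAt M x, ∀ x ∈ M,
    (∀ v, fderiv ℝ τ x (J x v) = Complex.I • fderiv ℝ τ x v) ∧
    (∀ u v, Ω x ![(J x u : V), (J x v : V)] = Ω x ![(u : V), (v : V)]) ∧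
    (∀ v, v ≠ 0 → 0 < Ω x ![(J x v : V), (v : V)])

/-! ### Quaternions -/

/-- The right `ℍ`-vector space `ℍ^{n+1}`. -/
abbrev HVec (n : ℕ) : Type := Fin (n + 1) → ℍ[ℝ]

/-- `M(n+1, ℍ)`. -/
abbrev HMat (n : ℕ) : Type := Matrix (Fin (n + 1)) (Fin (n + 1)) ℍ[ℝ]

/-- `M(2, ℂ)^{n+1}`. -/
abbrev CTuple (n : ℕ) : Type := Fin (n + 1) → Matrix (Fin 2) (Fin 2) ℂ

/-- `M(2n+2, ℂ)`, in `2 × 2` blocks. -/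
abbrev CMat (n : ℕ) : Type := Matrix (Fin (n + 1) × Fin 2) (Fin (n + 1) × Fin 2) ℂ

/-- The `ℍ`-inner product `(h, k)_ℍ = ∑ θ(h_i) k_i`, where `θ` is the conjugation. -/
def hinner {n : ℕ} (h k : HVec n) : ℍ[ℝ] := ∑ i, star (h i) * k i

/-- The Euclidean inner product `((h, k)_ℍ + (k, h)_ℍ) / 2` (a real quaternion). -/
def einner {n : ℕ} (h k : HVec n) : ℝ := ((1 / 2 : ℝ) • (hinner h k + hinner k h)).re

/-- The Euclidean norm on `ℍ^{n+1}`. -/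
def vnorm {n : ℕ} (q : HVec n) : ℝ := √(einner q q)

/-- The unit sphere `S^{4n+3}`. -/
def hsphere (n : ℕ) : Set (HVec n) := {p | einner p p = 1}

/-- The standard metric of the sphere, `q ↦ ⟨q, ·⟩`. -/
def sphereFlat {n : ℕ} (_p q : HVec n) : HVec n →L[ℝ] ℝ :=
  LinearMap.toContinuousLinearMap
    { toFun := fun u => einner q u
      map_add' := by
        intro u v
        simp only [einner, hinner, Pi.add_apply, mul_add, star_add, add_mul,
          Finset.sum_add_distrib, smul_add, Quaternion.re_add]
        ring
      map_smul' := by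
        intro c u
        simp only [einner, hinner, Pi.smul_apply, mul_smul_comm, smul_mul_assoc, Quaternion.star_smul,
          ← Finset.smul_sum, ← smul_add, smul_comm _ c, Quaternion.re_smul,
          RingHom.id_apply, smul_eq_mul] }

/-- The Jordan product. -/
def jordan {n : ℕ} (X Y : HMat n) : HMat n := (1 / 2 : ℝ) • (X * Y + Y * X)

/-- The inner product `tr (X ∘ Y)` of Hermitian matrices (a real quaternion). -/
def minner {n : ℕ} (X Y : HMat n) : ℝ := (jordan X Y).trace.re

/-- The norm of a Hermitian matrix. -/
def mnorm {n : ℕ} (Q : HMat n) : ℝ := √(minner Q Q)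

/-- The Hopf map `p ↦ (p_i θ(p_j))`. -/
def hopf {n : ℕ} (p : HVec n) : HMat n := Matrix.of fun i j => p i * star (p j)

/-- The differential of the Hopf map, `(p, q) ↦ (p_i θ(q_j) + q_i θ(p_j))`. -/
def hopfDiff {n : ℕ} (p q : HVec n) : HMat n :=
  Matrix.of fun i j => p i * star (q j) + q i * star (p j)

/-- The quaternion projective space, as a set of matrices. -/
def quatProj (n : ℕ) : Set (HMat n) := {P | ∃ p : HVec n, einner p p = 1 ∧ P = hopf p}

/-- The metric `g(Q₁, Q₂) = tr (Q₁ ∘ Q₂) / 2` on the quaternion projective space, for which the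
Hopf map is a Riemannian submersion. -/
def projFlat {n : ℕ} (_P Q : HMat n) : HMat n →L[ℝ] ℝ :=
  LinearMap.toContinuousLinearMap
    { toFun := fun X => (1 / 2 : ℝ) * minner Q X
      map_add' := by
        intro X Y
        simp only [minner, jordan, mul_add, add_mul, smul_add, Matrix.trace_add,
          Quaternion.re_add]
        ring
      map_smul' := by
        intro c X
        simp only [minner, jordan, mul_smul_comm, smul_mul_assoc, ← smul_add, smul_comm _ c,
          Matrix.trace_smul, Quaternion.re_smul, RingHom.id_apply, smul_eq_mul]
        ring }

theorem hopf_add {n : ℕ} (p u : HVec n) : hopf (p + u) = hopf p + hopfDiff p u + hopf u := by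
  ext1 i j
  simp only [hopf, hopfDiff, Matrix.of_apply, Matrix.add_apply, Pi.add_apply, star_add]
  noncomm_ring

/-- The differential of the Hopf map is isometric on the orthogonal complement of the fibre. -/
theorem projFlat_hopfDiff {n : ℕ} (p u v : HVec n) (hp : einner p p = 1)
    (hu : hinner p u = 0) (hv : hinner p v = 0) :
    projFlat (hopf p) (hopfDiff p u) (hopfDiff p v) = einner u v := by
  have hre : ∀ a b : ℍ[ℝ], (a * b).re = (b * a).re := by
    intro a b; simp; ring
  have hs : ∀ a b : HVec n, star (hinner a b) = hinner b a := by
    intro a b; simp [hinner]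
  have hsre : ∀ a b : HVec n, (hinner a b).re = (hinner b a).re := by
    intro a b; rw [← hs a b, Quaternion.re_star]
  have hpp : hinner p p = 1 := by
    have h1 : (hinner p p).re = 1 := by
      have := hp
      simp only [einner, Quaternion.re_smul, Quaternion.re_add, smul_eq_mul] at this
      linarith
    have h2 := (Quaternion.star_eq_self (a := hinner p p)).1 (hs p p)
    rw [h2, h1]; rfl
  have hu' : hinner u p = 0 := by rw [← hs, hu, star_zero]
  have hv' : hinner v p = 0 := by rw [← hs, hv, star_zero]
  have tr : ∀ a b : HVec n, hinner p a = 0 → hinner a p = 0 → hinner p b = 0 → hinner b p = 0 →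
      (Matrix.trace (hopfDiff p a * hopfDiff p b)).re = 2 * (hinner a b).re := by
    intro a b ha ha' hb hb'
    have e : Matrix.trace (hopfDiff p a * hopfDiff p b)
        = ∑ i, (p i * hinner a p * star (b i) + p i * hinner a b * star (p i)
          + a i * hinner p p * star (b i) + a i * hinner p b * star (p i)) := by
      simp only [Matrix.trace, Matrix.diag, Matrix.mul_apply, hopfDiff, Matrix.of_apply, hinner,
        Finset.mul_sum, Finset.sum_mul, ← Finset.sum_add_distrib]
      refine Finset.sum_congr rfl fun i _ => Finset.sum_congr rfl fun j _ => ?_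
      noncomm_ring
    have resum : ∀ f : Fin (n + 1) → ℍ[ℝ], (∑ i, f i).re = ∑ i, (f i).re := fun f =>
      map_sum (AddMonoidHom.mk' (fun q : ℍ[ℝ] => q.re) fun _ _ => rfl) f _
    rw [e, ha', hb, hpp]
    simp only [mul_zero, zero_mul, zero_add, add_zero, mul_one, Finset.sum_add_distrib,
      Quaternion.re_add]
    have h1 : (∑ i, p i * hinner a b * star (p i)).re = (hinner a b).re := by
      have : (∑ i, p i * hinner a b * star (p i)).re = (hinner p p * hinner a b).re := by
        rw [show hinner p p = ∑ i, star (p i) * p i from rfl, Finset.sum_mul, resum, resum]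
        refine Finset.sum_congr rfl fun i _ => ?_
        rw [hre, mul_assoc]
      rw [this, hpp, one_mul]
    have h2 : (∑ i, a i * star (b i)).re = (hinner b a).re := by
      rw [hinner, resum, resum]
      exact Finset.sum_congr rfl fun i _ => hre _ _
    rw [h1, h2, hsre b a]; ring
  have h : projFlat (hopf p) (hopfDiff p u) (hopfDiff p v)
      = (1 / 2 : ℝ) * minner (hopfDiff p u) (hopfDiff p v) := rfl
  rw [h, minner, jordan, Matrix.trace_smul, Matrix.trace_add, Quaternion.re_smul,
    Quaternion.re_add, tr u v hu hu' hv hv', tr v u hv hv' hu hu', einner, Quaternion.re_smul,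
    Quaternion.re_add, smul_eq_mul, smul_eq_mul]
  ring

/-- The isomorphism `ρ` of `ℍ` onto its image in `M(2, ℂ)`; its complexification is
`ρ(a ⊗ 1 + b ⊗ √-1) = ρ(a) + √-1 ρ(b)`. -/
def rho (h : ℍ[ℝ]) : Matrix (Fin 2) (Fin 2) ℂ :=
  !![(h.re : ℂ) + Complex.I * h.imI, (h.imJ : ℂ) + Complex.I * h.imK;
    -(h.imJ : ℂ) + Complex.I * h.imK, (h.re : ℂ) - Complex.I * h.imI]

/-- `(ρ(X_{ij}))`. -/
def rhoMat {n : ℕ} (X : HMat n) : CMat n := Matrix.of fun a b => rho (X a.1 b.1) a.2 b.2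

/-! ### The spaces and the embeddings -/

/-- The space `E_S`: tangent vectors of the sphere that are not tangent to the Hopf fibre. -/
def spaceES (n : ℕ) : Set (HVec n × HVec n) :=
  {x | einner x.1 x.1 = 1 ∧ einner x.1 x.2 = 0 ∧
    (fun i => x.2 i + x.1 i * hinner x.2 x.1) ≠ 0}

/-- The cone `∑ det B_i = 0`, `B ≠ 0`. -/
def detCone (n : ℕ) : Set (CTuple n) := {B | B ≠ 0 ∧ ∑ i, (B i).det = 0}

/-- The image of `E_S`: here `z`, `w` are the columns of the `(2n+2) × 2` matrix `B`. -/
def spaceESTilde (n : ℕ) : Set (CTuple n) :=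
  {B | LinearIndependent ℂ ![fun a : Fin (n + 1) × Fin 2 => B a.1 a.2 0,
      fun a : Fin (n + 1) × Fin 2 => B a.1 a.2 1] ∧ ∑ i, (B i).det = 0}

/-- The space `E_ℍ`. -/
def spaceEH (n : ℕ) : Set (HMat n × HMat n) :=
  {x | x.1 ∈ quatProj n ∧ x.2.IsHermitian ∧ jordan x.1 x.2 = (1 / 2 : ℝ) • x.2 ∧ x.2 ≠ 0}

/-- The block diagonal matrix with blocks `J`. -/
def bigJ (n : ℕ) : CMat n :=
  Matrix.of fun a b => if a.1 = b.1 then (!![0, 1; -1, 0] : Matrix (Fin 2) (Fin 2) ℂ) a.2 b.2 else 0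

/-- The image of `E_ℍ`. -/
def spaceEHTilde (n : ℕ) : Set (CMat n) :=
  {A | bigJ n * A = Aᵀ * bigJ n ∧ A.rank = 2 ∧ A * A = 0}

/-- `τ_S`. -/
def tauS {n : ℕ} (x : HVec n × HVec n) : CTuple n :=
  fun i => (vnorm x.2 : ℂ) • rho (x.1 i) + Complex.I • rho (x.2 i)

/-- `τ_ℍ`. -/
def tauH {n : ℕ} (x : HMat n × HMat n) : CMat n :=
  ((mnorm x.2 ^ 2 : ℝ) : ℂ) • rhoMat x.1 - rhoMat x.2 * rhoMat x.2
    + ((Complex.I / (√2 : ℝ)) * (mnorm x.2 : ℂ)) • rhoMat x.2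

/-- The norm `‖A‖ = √(∑ |a_{ij}|²)` of a complex matrix. -/
def frob {m : Type} [Fintype m] (A : Matrix m m ℂ) : ℝ := √(∑ i, ∑ j, ‖A i j‖ ^ 2)

/-- The function `‖B‖ = √(∑ ‖B_i‖²)`. -/
def potentialS {n : ℕ} (B : CTuple n) : ℂ := (√(∑ i, frob (B i) ^ 2) : ℝ)

/-- The function `√‖A‖`. -/
def potentialH {n : ℕ} (A : CMat n) : ℂ := (√(frob A) : ℝ)

end

end HopfKaehler

open HopfKaehler
attribute [local instance] Matrix.normedAddCommGroup Matrix.normedSpace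

/-! All three cases follow one pattern, recorded in `PotentialData`. A diffeomorphism `τ` carries
`M` onto a complex submanifold `N` avoiding the origin, and on `M` the canonical one-form is the
pull-back of `c · df ∘ I`, where `f = b(x, x)^s` is a power of a Hermitian norm and `0 < s ≤ 1`. For
real `f` the form `c · df ∘ I` equals `c √-1 (∂ - ∂̄) f`, and its differential is `2c √-1 ∂̄∂ f`;
hence the second constant is always twice the first. Since `d` commutes with pull-back, the
symplectic form is the pull-back of that differential. It is of type (1,1), and it is positive
because such powers are strictly plurisubharmonic (`levi_pos`, a Cauchy–Schwarz estimate). This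
yields the Kähler statement in `PotentialData.isKaehlerVia`.

For the sphere, `τ_S(p, q)` is the point `‖q‖p + √-1 q` of the complexification of `ℍ^{n+1}`, and `∑
det B_i` is the complexified quadratic form `⟨a, a⟩ - ⟨b, b⟩ + 2√-1 ⟨a, b⟩`. So the image is the
punctured quadric cone, smooth away from the origin. The columns of `τ_S(p, q)` are independent
exactly when the horizontal part of `q` is nonzero, an open condition.

For the projective space, write `X^♯` for the twisted adjoint `tadj X`, the complex linear extension
of the quaternionic conjugate transpose. The complexified Hopf map is `T ↦ T T^♯` on `(2n+2) × 2`
matrices, and for horizontal `q` it takes `τ_S(p, q)` to `τ_ℍ` of the image tangent vector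
(`tauH_hopf_eq_tall`). Surjectivity of `τ_ℍ` rests on `exists_factorization`: a self-adjoint matrix
of rank two is `T T^♯` with `Tᴴ T` a positive scalar, and this scalar condition together with `T^♯ T
= 0` forces the imaginary part of `T` to be horizontal. The target is a complex submanifold by
`hasParam_nilpotentRankTwo`, which uses a slice for the ambiguity of `T`.

Submanifolds are handled through local parametrisations with a left inverse (`HasParam`): these can
be carried along `τ`, and forms pulled back to parameter space can be differentiated on an open set.
-/

namespace HopfKaehler

noncomputable section

/-! ### Smooth parametrisations and slice charts -/

section Param

variable {𝕜 : Type} [RCLike 𝕜]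
variable {V : Type} [NormedAddCommGroup V] [NormedSpace 𝕜 V]
variable {W : Type} [NormedAddCommGroup W] [NormedSpace 𝕜 W]
variable {U : Type} [NormedAddCommGroup U] [NormedSpace 𝕜 U]

/-- `f` is smooth in a neighbourhood of `x`. -/
def SmoothNear (𝕜 : Type) [RCLike 𝕜] {V W : Type} [NormedAddCommGroup V] [NormedSpace 𝕜 V]
    [NormedAddCommGroup W] [NormedSpace 𝕜 W] (f : V → W) (x : V) : Prop :=
  ∀ᶠ y in 𝓝 x, ContDiffAt 𝕜 ∞ f y

theorem SmoothNear.contDiffAt {f : V → W} {x : V} (h : SmoothNear 𝕜 f x) : ContDiffAt 𝕜 ∞ f x :=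
  h.self_of_nhds

theorem SmoothNear.differentiableAt {f : V → W} {x : V} (h : SmoothNear 𝕜 f x) :
    DifferentiableAt 𝕜 f x :=
  h.contDiffAt.differentiableAt (by simp)

theorem SmoothNear.continuousAt {f : V → W} {x : V} (h : SmoothNear 𝕜 f x) : ContinuousAt f x :=
  h.contDiffAt.continuousAt

theorem SmoothNear.comp {g : W → U} {f : V → W} {x : V} (hg : SmoothNear 𝕜 g (f x))
    (hf : SmoothNear 𝕜 f x) : SmoothNear 𝕜 (fun y => g (f y)) x := by
  filter_upwards [hf, hf.continuousAt.eventually hg] with y h1 h2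
  exact ContDiffAt.comp y h2 h1

theorem SmoothNear.prodMk {g : V → U} {f : V → W} {x : V} (hf : SmoothNear 𝕜 f x)
    (hg : SmoothNear 𝕜 g x) : SmoothNear 𝕜 (fun y => (f y, g y)) x := by
  filter_upwards [hf, hg] with y h1 h2
  exact h1.prodMk h2

theorem SmoothNear.sub {g f : V → W} {x : V} (hf : SmoothNear 𝕜 f x)
    (hg : SmoothNear 𝕜 g x) : SmoothNear 𝕜 (fun y => f y - g y) x := by
  filter_upwards [hf, hg] with y h1 h2
  exact h1.sub h2

theorem _root_.ContDiff.smoothNear {f : V → W} (h : ContDiff 𝕜 ∞ f) (x : V) : SmoothNear 𝕜 f x :=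
  Filter.Eventually.of_forall fun _ => h.contDiffAt

theorem smoothNear_id (x : V) : SmoothNear 𝕜 (fun y : V => y) x := contDiff_id.smoothNear x

theorem _root_.ContDiffOn.smoothNear {f : V → W} {s : Set V} {x : V} (h : ContDiffOn 𝕜 ∞ f s)
    (hs : s ∈ 𝓝 x) : SmoothNear 𝕜 f x := by
  filter_upwards [eventually_mem_nhds_iff.2 hs] with y hy
  exact h.contDiffAt hy

/-- Near `x`, the set `M` is the image of a smooth map `φ` from `𝕜ᵈ` with smooth left
inverse `ψ`. -/
def HasParam (𝕜 : Type) [RCLike 𝕜] {V : Type} [NormedAddCommGroup V] [NormedSpace 𝕜 V] (d : ℕ)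
    (M : Set V) (x : V) : Prop :=
  ∃ (φ : (Fin d → 𝕜) → V) (ψ : V → (Fin d → 𝕜)), SmoothNear 𝕜 φ (ψ x) ∧ SmoothNear 𝕜 ψ x ∧
    φ (ψ x) = x ∧ (∀ᶠ a in 𝓝 (ψ x), φ a ∈ M ∧ ψ (φ a) = a) ∧ ∀ᶠ y in 𝓝 x, y ∈ M → φ (ψ y) = y

/-- Take `φ` to be the inverse slice chart on the slice `𝕜ᵈ × {0}`, and `ψ` the first component of
the chart. -/
theorem IsSubmanifold.hasParam {d : ℕ} {M : Set V} (h : IsSubmanifold 𝕜 d M) {x : V} (hx : x ∈ M) :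
    HasParam 𝕜 d M x := by
  obtain ⟨c, Φ, hxs, h1, h2, hM⟩ := h x hx
  have hx2 : Φ x = ((Φ x).1, 0) := Prod.ext rfl ((hM x hxs).1 hx)
  have hpt : ((Φ x).1, (0 : Fin c → 𝕜)) ∈ Φ.target := hx2 ▸ Φ.map_source hxs
  have hφ : SmoothNear 𝕜 (fun a : Fin d → 𝕜 => Φ.symm (a, (0 : Fin c → 𝕜))) (Φ x).1 :=
    SmoothNear.comp (g := Φ.symm) (f := fun a : Fin d → 𝕜 => (a, (0 : Fin c → 𝕜)))
      (h2.smoothNear (Φ.open_target.mem_nhds hpt))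
      ((contDiff_id.prodMk contDiff_const).smoothNear _)
  have hS := h1.smoothNear (Φ.open_source.mem_nhds hxs)
  refine ⟨fun a => Φ.symm (a, 0), fun y => (Φ y).1, hφ, ?_, ?_, ?_, ?_⟩
  · exact SmoothNear.comp (contDiff_fst.smoothNear _) hS
  · change Φ.symm ((Φ x).1, 0) = x
    rw [← hx2, Φ.left_inv hxs]
  · have hc : ContinuousAt (fun a : Fin d → 𝕜 => (a, (0 : Fin c → 𝕜))) (Φ x).1 := by fun_prop
    filter_upwards [hc.eventually (Φ.open_target.mem_nhds hpt)] with a ha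
    refine ⟨(hM _ (Φ.map_target ha)).2 ?_, ?_⟩
    · rw [Φ.right_inv ha]
    · rw [Φ.right_inv ha]
  · filter_upwards [Φ.open_source.mem_nhds hxs] with y hy hyM
    have : Φ y = ((Φ y).1, 0) := Prod.ext rfl ((hM y hy).1 hyM)
    rw [← this, Φ.left_inv hy]

/-- By rank–nullity the kernel of `L` has dimension `d`; linear coordinates on it extend to `V`, and
they detect whatever `L` kills. -/
theorem exists_complementary_coordinates [FiniteDimensional 𝕜 V] [FiniteDimensional 𝕜 W] {d : ℕ}
    (L : V →L[𝕜] W) (hL : Function.Surjective L)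
    (hd : Module.finrank 𝕜 V = d + Module.finrank 𝕜 W) :
    ∃ κ : V →L[𝕜] (Fin d → 𝕜), ∀ v, L v = 0 → κ v = 0 → v = 0 := by
  have h1 := LinearMap.finrank_range_add_finrank_ker (L : V →ₗ[𝕜] W)
  rw [LinearMap.range_eq_top.2 hL, finrank_top] at h1
  have h2 : Module.finrank 𝕜 (LinearMap.ker (L : V →ₗ[𝕜] W)) = Module.finrank 𝕜 (Fin d → 𝕜) := by
    rw [Module.finrank_fin_fun]; omega
  let e := LinearEquiv.ofFinrankEq _ _ h2
  obtain ⟨g, hg⟩ := LinearMap.exists_extend (e : LinearMap.ker (L : V →ₗ[𝕜] W) →ₗ[𝕜] (Fin d → 𝕜))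
  refine ⟨LinearMap.toContinuousLinearMap g, fun v hv hκ => ?_⟩
  have h3 : e ⟨v, hv⟩ = 0 := by
    rw [← hκ]
    exact (LinearMap.congr_fun hg ⟨v, hv⟩).symm
  exact congrArg Subtype.val (e.map_eq_zero_iff.1 h3)

/-- The inverse function theorem applied to `Θ`, whose differential is bijective at `x` because the
dimensions agree. -/
theorem exists_slice_chart [FiniteDimensional 𝕜 V] {d c : ℕ} {M : Set V} {x : V}
    (Θ : V → (Fin d → 𝕜) × (Fin c → 𝕜)) (hΘ : SmoothNear 𝕜 Θ x)
    (hinj : ∀ v, fderiv 𝕜 Θ x v = 0 → v = 0) (hd : Module.finrank 𝕜 V = d + c)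
    (hM : ∀ᶠ y in 𝓝 x, (y ∈ M ↔ (Θ y).2 = 0)) :
    ∃ Φ : OpenPartialHomeomorph V ((Fin d → 𝕜) × (Fin c → 𝕜)),
      x ∈ Φ.source ∧ ContDiffOn 𝕜 ∞ Φ Φ.source ∧ ContDiffOn 𝕜 ∞ Φ.symm Φ.target ∧
        ∀ y ∈ Φ.source, (y ∈ M ↔ (Φ y).2 = 0) := by
  have : CompleteSpace V := FiniteDimensional.complete 𝕜 V
  have hfr : Module.finrank 𝕜 V = Module.finrank 𝕜 ((Fin d → 𝕜) × (Fin c → 𝕜)) := by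
    rw [Module.finrank_prod, Module.finrank_fin_fun, Module.finrank_fin_fun, hd]
  let e : V ≃L[𝕜] ((Fin d → 𝕜) × (Fin c → 𝕜)) :=
    (LinearMap.linearEquivOfInjective (fderiv 𝕜 Θ x : V →ₗ[𝕜] _)
      ((injective_iff_map_eq_zero _).2 hinj) hfr).toContinuousLinearEquiv
  have he : (e : V →L[𝕜] _) = fderiv 𝕜 Θ x := by ext1 v; rfl
  have hder : HasFDerivAt Θ (e : V →L[𝕜] _) x := he ▸ hΘ.differentiableAt.hasFDerivAt
  let Φ₀ := hΘ.contDiffAt.toOpenPartialHomeomorph Θ hder (by simp)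
  have hc : ContinuousAt (fderiv 𝕜 Θ) x :=
    (hΘ.contDiffAt.fderiv_right (m := 0) (by simp)).continuousAt
  have hinv : ∀ᶠ y in 𝓝 x, fderiv 𝕜 Θ y ∈ Set.range
      (ContinuousLinearEquiv.toContinuousLinearMap : (V ≃L[𝕜] ((Fin d → 𝕜) × (Fin c → 𝕜))) → _) :=
    hc.eventually (he ▸ e.nhds)
  -- The source is shrunk to where `Θ` stays smooth with invertible differential: the inverse has to
  -- be smooth on the whole target, not only at `Θ x`.
  obtain ⟨S, hS, hSo, hxS⟩ := eventually_nhds_iff.1 (hM.and (hinv.and hΘ))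
  refine ⟨Φ₀.restrOpen S hSo, ⟨hΘ.contDiffAt.mem_toOpenPartialHomeomorph_source hder (by simp),
    hxS⟩,
    ?_, ?_, ?_⟩
  · rintro y ⟨_, hy⟩
    exact (hS y hy).2.2.contDiffWithinAt
  · intro a ha
    refine ContDiffAt.contDiffWithinAt ?_
    have hy := (Φ₀.restrOpen S hSo).map_target ha
    obtain ⟨e', he'⟩ := (hS _ hy.2).2.1
    refine (Φ₀.restrOpen S hSo).contDiffAt_symm (f₀' := e') ha ?_ (hS _ hy.2).2.2
    rw [he']
    exact ((hS _ hy.2).2.2.differentiableAt (by simp)).hasFDerivAt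
  · rintro y ⟨_, hy⟩
    exact (hS y hy).1

theorem HasParam.fderiv_comp {d : ℕ} {x : V} {φ : (Fin d → 𝕜) → V} {ψ : V → (Fin d → 𝕜)}
    (hφ : SmoothNear 𝕜 φ (ψ x)) (hψ : SmoothNear 𝕜 ψ x) (hx : φ (ψ x) = x)
    (h : ∀ᶠ a in 𝓝 (ψ x), ψ (φ a) = a) (w : Fin d → 𝕜) :
    fderiv 𝕜 ψ x (fderiv 𝕜 φ (ψ x) w) = w := by
  have h1 : HasFDerivAt (fun a => ψ (φ a)) ((fderiv 𝕜 ψ x).comp (fderiv 𝕜 φ (ψ x))) (ψ x) := by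
    refine HasFDerivAt.comp _ ?_ hφ.differentiableAt.hasFDerivAt
    rw [hx]; exact hψ.differentiableAt.hasFDerivAt
  have h2 : HasFDerivAt (fun a => ψ (φ a)) (ContinuousLinearMap.id 𝕜 _) (ψ x) :=
    (hasFDerivAt_id (𝕜 := 𝕜) (ψ x)).congr_of_eventuallyEq h
  exact congrArg (fun l => l w) (h1.unique h2)

/-- The retraction `φ ∘ ψ` splits a neighbourhood of `x`: use `ψ` along `M`, and for the transversal
coordinates measure `y - φ (ψ y)` by linear coordinates `κ` on the kernel of `dψ`. -/
theorem isSubmanifold_of_hasParam [FiniteDimensional 𝕜 V] {d : ℕ} {M : Set V}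
    (h : ∀ x ∈ M, HasParam 𝕜 d M x) : IsSubmanifold 𝕜 d M := by
  intro x hxM
  obtain ⟨φ, ψ, hφ, hψ, hx, h1, h2⟩ := h x hxM
  have hcomp := HasParam.fderiv_comp hφ hψ hx (h1.mono fun _ h => h.2)
  have hsurj : Function.Surjective (fderiv 𝕜 ψ x) := fun w => ⟨_, hcomp w⟩
  have hle : d ≤ Module.finrank 𝕜 V := by
    have := LinearMap.finrank_le_finrank_of_surjective
      (f := (fderiv 𝕜 ψ x : V →ₗ[𝕜] (Fin d → 𝕜))) hsurj
    simpa using this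
  obtain ⟨c, hc⟩ := Nat.exists_eq_add_of_le hle
  obtain ⟨κ, hκ⟩ := exists_complementary_coordinates (d := c) (fderiv 𝕜 ψ x) hsurj
    (by rw [Module.finrank_fin_fun, hc, add_comm])
  have hφψ : SmoothNear 𝕜 (fun y => φ (ψ y)) x := hφ.comp hψ
  let Θ : V → (Fin d → 𝕜) × (Fin c → 𝕜) := fun y => (ψ y, κ (y - φ (ψ y)))
  have hΘ : SmoothNear 𝕜 Θ x := hψ.prodMk
    (SmoothNear.comp (κ.contDiff.smoothNear _) ((smoothNear_id x).sub hφψ))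
  have hder : HasFDerivAt Θ ((fderiv 𝕜 ψ x).prod (κ.comp (ContinuousLinearMap.id 𝕜 V -
      (fderiv 𝕜 φ (ψ x)).comp (fderiv 𝕜 ψ x)))) x :=
    hψ.differentiableAt.hasFDerivAt.prodMk (κ.hasFDerivAt.comp x ((hasFDerivAt_id x).sub
      (hφ.differentiableAt.hasFDerivAt.comp x hψ.differentiableAt.hasFDerivAt)))
  have hinj : ∀ v, fderiv 𝕜 Θ x v = 0 → v = 0 := by
    intro v hv
    rw [hder.fderiv] at hv
    have e1 : fderiv 𝕜 ψ x v = 0 := congrArg Prod.fst hv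
    have e2 := congrArg Prod.snd hv
    simp [e1] at e2
    exact hκ v e1 e2
  refine ⟨c, ?_⟩
  refine exists_slice_chart Θ hΘ hinj hc ?_
  have hder' := hΘ.contDiffAt.hasStrictFDerivAt (by simp)
  -- `κ` is injective only on the kernel of `dψ`, so `κ (y - φ (ψ y)) = 0` does not give `y = φ (ψ
  -- y)` by itself. These two points do have the same image under `Θ`, and local injectivity of `Θ`
  -- finishes.
  have hloc : ∀ᶠ p in 𝓝 (x, x), Θ p.1 = Θ p.2 → p.1 = p.2 := by
    have hfr : Module.finrank 𝕜 V = Module.finrank 𝕜 ((Fin d → 𝕜) × (Fin c → 𝕜)) := by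
      rw [Module.finrank_prod, Module.finrank_fin_fun, Module.finrank_fin_fun, hc]
    have : CompleteSpace V := FiniteDimensional.complete 𝕜 V
    let e : V ≃L[𝕜] ((Fin d → 𝕜) × (Fin c → 𝕜)) :=
      (LinearMap.linearEquivOfInjective (fderiv 𝕜 Θ x : V →ₗ[𝕜] _)
        ((injective_iff_map_eq_zero _).2 hinj) hfr).toContinuousLinearEquiv
    have he : (e : V →L[𝕜] _) = fderiv 𝕜 Θ x := by ext1 v; rfl
    rw [← he] at hder'
    let Φ₀ := hder'.toOpenPartialHomeomorph Θ
    have hs := Φ₀.open_source.mem_nhds hder'.mem_toOpenPartialHomeomorph_source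
    rw [nhds_prod_eq]
    filter_upwards [Filter.prod_mem_prod hs hs] with p hp heq
    exact Φ₀.injOn hp.1 hp.2 heq
  have hpair : Filter.Tendsto (fun y => (y, φ (ψ y))) (𝓝 x) (𝓝 (x, x)) := by
    have : ContinuousAt (fun y => (y, φ (ψ y))) x := continuousAt_id.prodMk hφψ.continuousAt
    simpa [ContinuousAt, hx] using this
  filter_upwards [h2, hpair.eventually hloc, hψ.continuousAt.eventually h1] with y hy1 hy2 hy3
  constructor
  · intro hy
    simp [Θ, hy1 hy]
  · intro hy
    have e : Θ y = Θ (φ (ψ y)) := by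
      refine Prod.ext hy3.2.symm ?_
      rw [hy]
      simp [Θ, hy3.2]
    rw [hy2 e]
    exact hy3.1

/-- Parametrisations are transported by smooth maps that are mutually inverse between `M` and `N`
near the given points. -/
theorem HasParam.transport {d : ℕ} {M : Set V} {N : Set W} {x : V} (r : V → W) (g : W → V)
    (hN : HasParam 𝕜 d N (r x)) (hr : SmoothNear 𝕜 r x) (hg : SmoothNear 𝕜 g (r x))
    (hx : g (r x) = x) (h1 : ∀ᶠ y in 𝓝 x, y ∈ M → r y ∈ N ∧ g (r y) = y)
    (h2 : ∀ᶠ w in 𝓝 (r x), w ∈ N → g w ∈ M ∧ r (g w) = w) : HasParam 𝕜 d M x := by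
  obtain ⟨φ, ψ, hφ, hψ, hw, h3, h4⟩ := hN
  refine ⟨fun a => g (φ a), fun y => ψ (r y), ?_, hψ.comp hr, ?_, ?_, ?_⟩
  · exact SmoothNear.comp (by rw [hw]; exact hg) hφ
  · simp only [hw, hx]
  · have ht := hφ.continuousAt
    rw [ContinuousAt, hw] at ht
    filter_upwards [h3, ht.eventually h2] with a ha ha'
    exact ⟨(ha' ha.1).1, by rw [(ha' ha.1).2, ha.2]⟩
  · filter_upwards [h1, hr.continuousAt.eventually h4] with y hy hy' hyM
    rw [hy' (hy hyM).1, (hy hyM).2]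

theorem HasParam.inter_open {d : ℕ} {M : Set V} {x : V} (h : HasParam 𝕜 d M x) {O : Set V}
    (hO : IsOpen O) (hx : x ∈ O) : HasParam 𝕜 d (M ∩ O) x := by
  obtain ⟨φ, ψ, hφ, hψ, hw, h3, h4⟩ := h
  refine ⟨φ, ψ, hφ, hψ, hw, ?_, h4.mono fun y hy hyM => hy hyM.1⟩
  have hc := hφ.continuousAt
  rw [ContinuousAt, hw] at hc
  filter_upwards [h3, hc.eventually (hO.mem_nhds hx)] with a ha ha'
  exact ⟨⟨ha.1, ha'⟩, ha.2⟩

/-- A regular zero set is a submanifold. -/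
theorem hasParam_of_regular [FiniteDimensional 𝕜 V] [FiniteDimensional 𝕜 W] {d : ℕ} {M : Set V}
    {x : V} (hx : x ∈ M) (F : V → W) (hF : SmoothNear 𝕜 F x)
    (hsurj : Function.Surjective (fderiv 𝕜 F x))
    (hd : Module.finrank 𝕜 V = d + Module.finrank 𝕜 W)
    (hM : ∀ᶠ y in 𝓝 x, (y ∈ M ↔ F y = 0)) : HasParam 𝕜 d M x := by
  obtain ⟨κ, hκ⟩ := exists_complementary_coordinates (d := d) _ hsurj hd
  let e : W ≃L[𝕜] (Fin (Module.finrank 𝕜 W) → 𝕜) :=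
    ContinuousLinearEquiv.ofFinrankEq (by rw [Module.finrank_fin_fun])
  have hder : HasFDerivAt (fun y => (κ y, e (F y)))
      (κ.prod ((e : W →L[𝕜] (Fin (Module.finrank 𝕜 W) → 𝕜)).comp (fderiv 𝕜 F x))) x :=
    κ.hasFDerivAt.prodMk (e.hasFDerivAt.comp x hF.differentiableAt.hasFDerivAt)
  obtain ⟨Φ, h1, h2, h3, h4⟩ := exists_slice_chart (M := M) (x := x) (fun y => (κ y, e (F y)))
    ((κ.contDiff.smoothNear x).prodMk (SmoothNear.comp (e.contDiff.smoothNear _) hF))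
    (by
      intro v hv
      rw [hder.fderiv] at hv
      have e1 : κ v = 0 := congrArg Prod.fst hv
      have e2 : e (fderiv 𝕜 F x v) = 0 := congrArg Prod.snd hv
      exact hκ v (by simpa using e2) e1)
    hd (by filter_upwards [hM] with y hy; simpa using hy)
  -- One slice chart serves all points of `M ∩ Φ.source`, so this piece is a submanifold; its
  -- parametrisation at `x` is also one of `M`.
  have := IsSubmanifold.hasParam (𝕜 := 𝕜) (d := d) (M := M ∩ Φ.source) (fun y hy =>
    ⟨_, Φ, hy.2, h2, h3, fun z hz => by simpa [hz] using h4 z hz⟩) ⟨hx, h1⟩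
  obtain ⟨φ, ψ, hφ, hψ, hw, h5, h6⟩ := this
  refine ⟨φ, ψ, hφ, hψ, hw, h5.mono fun a ha => ⟨ha.1.1, ha.2⟩, ?_⟩
  filter_upwards [h6, Φ.open_source.mem_nhds h1] with y hy hy' hyM
  exact hy ⟨hyM, hy'⟩

end Param

/-! ### Underlying real structures and tangent spaces -/

section Real

variable {V : Type} [NormedAddCommGroup V] [NormedSpace ℝ V]
variable {W : Type} [NormedAddCommGroup W] [NormedSpace ℝ W]

theorem SmoothNear.restrictScalars {V W : Type} [NormedAddCommGroup V] [NormedSpace ℝ V]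
    [NormedSpace ℂ V] [IsScalarTower ℝ ℂ V] [NormedAddCommGroup W] [NormedSpace ℝ W]
    [NormedSpace ℂ W] [IsScalarTower ℝ ℂ W] {f : V → W} {x : V} (h : SmoothNear ℂ f x) :
    SmoothNear ℝ f x :=
  h.mono fun _ hy => hy.restrict_scalars ℝ

/-- A complex submanifold is a real submanifold of twice the dimension. -/
theorem HasParam.restrictScalars [NormedSpace ℂ V] [IsScalarTower ℝ ℂ V] {d : ℕ} {M : Set V}
    {x : V} (h : HasParam ℂ d M x) : HasParam ℝ (2 * d) M x := by
  obtain ⟨φ, ψ, hφ, hψ, hw, h3, h4⟩ := h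
  let e : (Fin d → ℂ) ≃L[ℝ] (Fin (2 * d) → ℝ) := ContinuousLinearEquiv.ofFinrankEq (by
    rw [Module.finrank_fin_fun, Module.finrank_pi_fintype]
    simp [Complex.finrank_real_complex, mul_comm])
  have hsymm : ∀ a, e.symm (e a) = a := e.symm_apply_apply
  refine ⟨fun a => φ (e.symm a), fun y => e (ψ y), ?_, ?_, ?_, ?_, ?_⟩
  · exact SmoothNear.comp (by rw [hsymm]; exact hφ.restrictScalars) (e.symm.contDiff.smoothNear _)
  · exact SmoothNear.comp (e.contDiff.smoothNear _) hψ.restrictScalars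
  · simpa using hw
  · have hc : ContinuousAt e.symm (e (ψ x)) := e.symm.continuous.continuousAt
    rw [ContinuousAt, hsymm] at hc
    filter_upwards [hc.eventually h3] with a ha
    exact ⟨ha.1, by simp [ha.2]⟩
  · filter_upwards [h4] with y hy hyM
    simpa using hy hyM

theorem tangentSpaceAt_mono {M N : Set V} (h : M ⊆ N) (x : V) :
    tangentSpaceAt M x ≤ tangentSpaceAt N x :=
  Submodule.span_mono fun _ ⟨γ, h1, h2, h3⟩ => ⟨γ, h1, h2.mono fun _ ht => h ht, h3⟩

theorem tangentSpaceAt_map {M : Set V} {N : Set W} {τ : V → W} {x : V} (hτ : ContDiffAt ℝ ∞ τ x)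
    (h : MapsTo τ M N) {v : V} (hv : v ∈ tangentSpaceAt M x) :
    fderiv ℝ τ x v ∈ tangentSpaceAt N (τ x) := by
  refine Submodule.span_induction (p := fun v _ => fderiv ℝ τ x v ∈ tangentSpaceAt N (τ x))
    ?_ (by simp) (fun a b _ _ ha hb => by simpa using add_mem ha hb)
    (fun c a _ ha => by simpa using Submodule.smul_mem _ c ha) hv
  rintro _ ⟨γ, h1, h2, rfl, rfl⟩
  refine Submodule.subset_span ⟨fun t => τ (γ t), ContDiffAt.comp 0 hτ h1,
    h2.mono fun t ht => h ht, rfl, ?_⟩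
  exact ((hτ.differentiableAt (by simp)).hasFDerivAt.comp_hasDerivAt 0
    (h1.differentiableAt (by simp)).hasDerivAt).deriv

/-- A linear condition satisfied by the velocities of curves is satisfied by tangent vectors. -/
theorem tangentSpaceAt_le {M : Set V} {x : V} {T : Submodule ℝ V}
    (h : ∀ γ : ℝ → V, ContDiffAt ℝ ∞ γ 0 → (∀ᶠ t in 𝓝 (0 : ℝ), γ t ∈ M) → γ 0 = x →
      deriv γ 0 ∈ T) : tangentSpaceAt M x ≤ T :=
  Submodule.span_le.2 fun _ ⟨γ, h1, h2, h3, h4⟩ => h4 ▸ h γ h1 h2 h3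

/-- A curve in `M` satisfies `γ = φ ∘ ψ ∘ γ`, so its velocity lies in the image of `dφ`; conversely
the `φ`-images of straight lines are curves in `M`. In particular the velocities already form a
linear space. -/
theorem range_fderiv_eq_tangentSpaceAt {d : ℕ} {M : Set V} {x : V} {φ : (Fin d → ℝ) → V}
    {ψ : V → (Fin d → ℝ)} (hφ : SmoothNear ℝ φ (ψ x)) (hψ : SmoothNear ℝ ψ x) (hx : φ (ψ x) = x)
    (h1 : ∀ᶠ a in 𝓝 (ψ x), φ a ∈ M) (h2 : ∀ᶠ y in 𝓝 x, y ∈ M → φ (ψ y) = y) (v : V) :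
    v ∈ tangentSpaceAt M x ↔ ∃ w, fderiv ℝ φ (ψ x) w = v := by
  constructor
  · intro hv
    refine tangentSpaceAt_le (M := M) (x := x)
      (T := LinearMap.range (fderiv ℝ φ (ψ x) : (Fin d → ℝ) →ₗ[ℝ] V)) ?_ hv
    rintro γ hγ hM rfl
    refine ⟨fderiv ℝ ψ (γ 0) (deriv γ 0), ?_⟩
    have e1 := (hφ.differentiableAt.hasFDerivAt.comp (γ 0)
      hψ.differentiableAt.hasFDerivAt).comp_hasDerivAt 0
        (hγ.differentiableAt (by simp)).hasDerivAt
    have e2 : (fun t => φ (ψ (γ t))) =ᶠ[𝓝 0] γ := by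
      filter_upwards [hM, hγ.continuousAt.eventually h2] with t ht ht'
      exact ht' ht
    exact (e1.congr_of_eventuallyEq e2.symm).deriv.symm
  · rintro ⟨w, rfl⟩
    have hl : HasDerivAt (fun t : ℝ => ψ x + t • w) w 0 := by
      simpa using ((hasDerivAt_id (0 : ℝ)).smul_const w).const_add (ψ x)
    have h0 : ψ x + (0 : ℝ) • w = ψ x := by simp
    have hc : ContinuousAt (fun t : ℝ => ψ x + t • w) 0 := hl.continuousAt
    rw [ContinuousAt, h0] at hc
    refine Submodule.subset_span ⟨fun t => φ (ψ x + t • w), ?_, hc.eventually h1, ?_, ?_⟩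
    · refine ContDiffAt.comp (0 : ℝ) (g := φ) (f := fun t : ℝ => ψ x + t • w) ?_ ?_
      · rw [h0]; exact hφ.contDiffAt
      · exact (contDiff_const.add (contDiff_id.smul contDiff_const)).contDiffAt
    · simp [hx]
    · refine HasDerivAt.deriv ?_
      refine HasFDerivAt.comp_hasDerivAt (l := φ) (f := fun t : ℝ => ψ x + t • w) 0 ?_ hl
      rw [h0]; exact hφ.differentiableAt.hasFDerivAt

end Real

/-! ### One-forms on submanifolds -/

section OneForms

theorem two_le_smooth : (2 : WithTop ℕ∞) ≤ ∞ :=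
  WithTop.coe_le_coe.2 (le_top : (2 : ℕ∞) ≤ ⊤)

variable {V : Type} [NormedAddCommGroup V] [NormedSpace ℝ V]
variable {W : Type} [NormedAddCommGroup W] [NormedSpace ℝ W]
variable {F : Type} [NormedAddCommGroup F] [NormedSpace ℝ F]

/-- A field of linear forms as a differential one-form. -/
def oneForm (a : V → V →L[ℝ] F) (x : V) : V [⋀^Fin 1]→L[ℝ] F :=
  ContinuousAlternatingMap.ofSubsingleton ℝ V F (0 : Fin 1) (a x)

theorem oneForm_apply (a : V → V →L[ℝ] F) (x : V) (v : Fin 1 → V) : oneForm a x v = a x (v 0) :=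
  rfl

theorem _root_.ContDiffAt.oneForm {n : WithTop ℕ∞} {a : V → V →L[ℝ] F} {x : V}
    (h : ContDiffAt ℝ n a x) :
    ContDiffAt ℝ n (oneForm a) x :=
  (ContinuousAlternatingMap.ofSubsingletonLIE (𝕜 := ℝ) (E := V) (F := F)
    (0 : Fin 1)).contDiff.contDiffAt.comp x h

/-- The alternating sum defining `d` has two terms in degree one, each a derivative of `a` evaluated
on a fixed vector. -/
theorem extDeriv_oneForm {a : V → V →L[ℝ] F} {x : V} (h : ContDiffAt ℝ 1 a x) (v : Fin 2 → V) :
    extDeriv (oneForm a) x v = fderiv ℝ a x (v 0) (v 1) - fderiv ℝ a x (v 1) (v 0) := by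
  have hd := h.differentiableAt (by simp)
  have key : ∀ w u : V, fderiv ℝ (fun y => a y w) x u = fderiv ℝ a x u w := by
    intro w u
    have := hd.hasFDerivAt.clm_apply (hasFDerivAt_const w x)
    rw [this.fderiv]
    simp
  rw [extDeriv_apply (h.oneForm.differentiableAt (by simp)), Fin.sum_univ_two]
  simp only [oneForm_apply, Fin.val_zero, pow_zero, one_smul, Fin.val_one, pow_one, neg_smul]
  rw [key, key, sub_eq_add_neg]
  rfl

theorem fderiv_mem_tangentSpaceAt {E : Type} [NormedAddCommGroup E] [NormedSpace ℝ E] {M : Set V}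
    {φ : E → V} {a : E} (hφ : ContDiffAt ℝ ∞ φ a) (hM : ∀ᶠ b in 𝓝 a, φ b ∈ M) (w : E) :
    fderiv ℝ φ a w ∈ tangentSpaceAt M (φ a) := by
  have hl : HasDerivAt (fun t : ℝ => a + t • w) w 0 := by
    simpa using ((hasDerivAt_id (0 : ℝ)).smul_const w).const_add a
  have h0 : a + (0 : ℝ) • w = a := by simp
  have hc : ContinuousAt (fun t : ℝ => a + t • w) 0 := hl.continuousAt
  rw [ContinuousAt, h0] at hc
  refine Submodule.subset_span ⟨fun t => φ (a + t • w), ?_, hc.eventually hM, by simp, ?_⟩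
  · refine ContDiffAt.comp (0 : ℝ) (g := φ) (f := fun t : ℝ => a + t • w) ?_ ?_
    · rwa [h0]
    · exact (contDiff_const.add (contDiff_id.smul contDiff_const)).contDiffAt
  · refine HasDerivAt.deriv ?_
    refine HasFDerivAt.comp_hasDerivAt (l := φ) (f := fun t : ℝ => a + t • w) 0 ?_ hl
    rw [h0]; exact (hφ.differentiableAt (by simp)).hasFDerivAt

/-- If `θ = τ^* α` on a submanifold, then `dθ = τ^* dα` on it. -/
theorem extDeriv_eq_pullback {d : ℕ} {M : Set V} {x : V} (hM : HasParam ℝ d M x) {τ : V → W}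
    (hτ : SmoothNear ℝ τ x) {θ : V → V →L[ℝ] ℝ} (hθ : ContDiffAt ℝ 1 θ x) {α : W → W →L[ℝ] ℝ}
    (hα : ContDiffAt ℝ 1 α (τ x))
    (h : ∀ y ∈ M, ∀ v ∈ tangentSpaceAt M y, θ y v = α (τ y) (fderiv ℝ τ y v))
    (v : Fin 2 → V) (hv : ∀ i, v i ∈ tangentSpaceAt M x) :
    extDeriv (oneForm θ) x v = extDeriv (oneForm α) (τ x) (fun i => fderiv ℝ τ x (v i)) := by
  obtain ⟨φ, ψ, hφ, hψ, hx, h1, h2⟩ := hM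
  have hr := range_fderiv_eq_tangentSpaceAt hφ hψ hx (h1.mono fun _ h => h.1) h2
  choose w hw using fun i => (hr (v i)).1 (hv i)
  have hτφ : SmoothNear ℝ (fun a => τ (φ a)) (ψ x) :=
    SmoothNear.comp (by rw [hx]; exact hτ) hφ
  have hcφ := hφ.continuousAt
  rw [ContinuousAt, hx] at hcφ
  -- The two forms agree only on vectors tangent to `M`. After pull-back to parameter space every
  -- vector is tangent, so they agree on an open set and can be differentiated; `d` then commutes
  -- with both pull-backs.
  have hev : (fun a => (oneForm θ (φ a)).compContinuousLinearMap (fderiv ℝ φ a)) =ᶠ[𝓝 (ψ x)]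
      fun a => (oneForm α (τ (φ a))).compContinuousLinearMap (fderiv ℝ (fun a => τ (φ a)) a) := by
    filter_upwards [hφ, h1.eventually_nhds, hcφ.eventually hτ] with a ha hMa hτa
    ext u
    have e : fderiv ℝ (fun a => τ (φ a)) a = (fderiv ℝ τ (φ a)).comp (fderiv ℝ φ a) :=
      ((hτa.differentiableAt (by simp)).hasFDerivAt.comp a
        (ha.differentiableAt (by simp)).hasFDerivAt).fderiv
    rw [e]
    exact h _ hMa.self_of_nhds.1 _ (fderiv_mem_tangentSpaceAt ha (hMa.mono fun _ h => h.1) _)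
  have e1 : extDeriv (fun a => (oneForm θ (φ a)).compContinuousLinearMap (fderiv ℝ φ a)) (ψ x) =
      (extDeriv (oneForm θ) (φ (ψ x))).compContinuousLinearMap (fderiv ℝ φ (ψ x)) :=
    extDeriv_pullback (by rw [hx]; exact hθ.oneForm.differentiableAt (by simp))
      (hφ.contDiffAt.of_le two_le_smooth) (by simp)
  have e2 : extDeriv (fun a => (oneForm α (τ (φ a))).compContinuousLinearMap
        (fderiv ℝ (fun a => τ (φ a)) a)) (ψ x) =
      (extDeriv (oneForm α) (τ (φ (ψ x)))).compContinuousLinearMap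
        (fderiv ℝ (fun a => τ (φ a)) (ψ x)) :=
    extDeriv_pullback (f := fun a => τ (φ a))
      (by simp only [hx]; exact hα.oneForm.differentiableAt (by simp))
      (hτφ.contDiffAt.of_le two_le_smooth) (by simp)
  have e3 := congrArg (fun η => η w) (e1.symm.trans (hev.extDeriv_eq.trans e2))
  have e : fderiv ℝ (fun a => τ (φ a)) (ψ x) = (fderiv ℝ τ x).comp (fderiv ℝ φ (ψ x)) :=
    (HasFDerivAt.comp (ψ x) (by rw [hx]; exact hτ.differentiableAt.hasFDerivAt)
        hφ.differentiableAt.hasFDerivAt).fderiv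
  rw [e] at e3
  simp only [ContinuousAlternatingMap.compContinuousLinearMap_apply, hx] at e3
  have hvw : (fun i => fderiv ℝ φ (ψ x) (w i)) = v := funext hw
  have e4 : (⇑(fderiv ℝ φ (ψ x)) ∘ w) = v := hvw
  have e5 : (⇑((fderiv ℝ τ x).comp (fderiv ℝ φ (ψ x))) ∘ w) = fun i => fderiv ℝ τ x (v i) := by
    funext i; simp [← hw i]
  rw [e4, e5] at e3
  exact e3

/-- `ρ` is the identity on `M` only, not on a neighbourhood, so its derivative is controlled on
velocities of curves in `M` and nowhere else. -/
theorem fderiv_eq_self_of_fixed {M : Set V} {ρ : V → V} {x : V} (hρ : DifferentiableAt ℝ ρ x)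
    (h : ∀ y ∈ M, ρ y = y) {v : V} (hv : v ∈ tangentSpaceAt M x) : fderiv ℝ ρ x v = v := by
  have : tangentSpaceAt M x ≤ LinearMap.eqLocus (fderiv ℝ ρ x : V →ₗ[ℝ] V) LinearMap.id := by
    refine tangentSpaceAt_le ?_
    rintro γ hγ hM rfl
    have e1 := hρ.hasFDerivAt.comp_hasDerivAt 0 (hγ.differentiableAt (by simp)).hasDerivAt
    have e2 : (fun t => ρ (γ t)) =ᶠ[𝓝 0] γ := hM.mono fun t ht => h _ ht
    exact (e1.congr_of_eventuallyEq e2.symm).deriv.symm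
  exact this hv

theorem fderiv_comp_eq_self {M : Set V} {τ : V → W} {σ : W → V} {x : V}
    (hτ : DifferentiableAt ℝ τ x) (hσ : DifferentiableAt ℝ σ (τ x)) (h : ∀ y ∈ M, σ (τ y) = y)
    {v : V} (hv : v ∈ tangentSpaceAt M x) : fderiv ℝ σ (τ x) (fderiv ℝ τ x v) = v := by
  have e := (hσ.hasFDerivAt.comp x hτ.hasFDerivAt)
  have := fderiv_eq_self_of_fixed (ρ := fun y => σ (τ y)) e.differentiableAt h hv
  rw [show fderiv ℝ (fun y => σ (τ y)) x = _ from e.fderiv] at this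
  exact this

end OneForms

/-! ### Powers of a Hermitian norm as Kähler potentials -/

section Potential

variable {W : Type} [NormedAddCommGroup W] [NormedSpace ℝ W] [NormedSpace ℂ W]
  [IsScalarTower ℝ ℂ W]

theorem mulI_apply (w : W) : mulI w = Complex.I • w := rfl

theorem I_smul_I_smul {W : Type} [NormedAddCommGroup W] [NormedSpace ℂ W] (w : W) :
    Complex.I • Complex.I • w = -w := by
  rw [smul_smul, Complex.I_mul_I, neg_one_smul]

/-- The power `b(x, x)^s` of a quadratic form. -/
def quadPow (b : W →L[ℝ] W →L[ℝ] ℝ) (s : ℝ) (x : W) : ℝ := (b x x) ^ s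

/-- The real part of a Hermitian inner product. -/
structure IsHermitianMetric (b : W →L[ℝ] W →L[ℝ] ℝ) : Prop where
  symm : ∀ u v, b u v = b v u
  pos : ∀ u, u ≠ 0 → 0 < b u u
  inv : ∀ u v, b (Complex.I • u) (Complex.I • v) = b u v

/-- The one-form `c · df ∘ I`, that is `c √-1 (∂ - ∂̄) f`. -/
def twistedDifferential (c : ℝ) (f : W → ℝ) (x : W) : W →L[ℝ] ℝ :=
  c • (fderiv ℝ f x).comp mulI

variable {b : W →L[ℝ] W →L[ℝ] ℝ} {s : ℝ} {x : W}

theorem hasFDerivAt_quad (hb : IsHermitianMetric b) (x : W) :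
    HasFDerivAt (fun x => b x x) ((2 : ℝ) • b x) x := by
  have := b.hasFDerivAt.clm_apply (hasFDerivAt_id x)
  refine this.congr_fderiv ?_
  ext v
  simp [hb.symm v x, two_mul]

theorem hasFDerivAt_quadPow (hb : IsHermitianMetric b) (s : ℝ) (hx : x ≠ 0) :
    HasFDerivAt (quadPow b s) ((2 * s * (b x x) ^ (s - 1)) • b x) x := by
  have := (hasFDerivAt_quad hb x).rpow_const (p := s) (Or.inl (hb.pos x hx).ne')
  refine this.congr_fderiv ?_
  ext v
  simp
  ring

theorem contDiffAt_quadPow (hb : IsHermitianMetric b) (s : ℝ) (hx : x ≠ 0) :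
    ContDiffAt ℝ ∞ (quadPow b s) x :=
  ContDiffAt.rpow_const_of_ne (b.contDiff.clm_apply contDiff_id).contDiffAt (hb.pos x hx).ne'

/-- Differentiate the gradient formula, valid on the open set of nonzero vectors, by the product
rule. -/
theorem fderiv_fderiv_quadPow (hb : IsHermitianMetric b) (s : ℝ) (hx : x ≠ 0) (u v : W) :
    fderiv ℝ (fderiv ℝ (quadPow b s)) x u v =
      2 * s * (b x x) ^ (s - 1) * b u v +
        4 * s * (s - 1) * (b x x) ^ (s - 1 - 1) * (b x u * b x v) := by
  have hev : fderiv ℝ (quadPow b s) =ᶠ[𝓝 x] fun y => (2 * s * quadPow b (s - 1) y) • b y := by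
    filter_upwards [isOpen_ne.mem_nhds hx] with y hy
    exact (hasFDerivAt_quadPow hb s hy).fderiv
  rw [hev.fderiv_eq]
  have h1 := ((hasFDerivAt_quadPow hb (s - 1) hx).const_mul (2 * s)).smul b.hasFDerivAt
  rw [show fderiv ℝ (fun y => (2 * s * quadPow b (s - 1) y) • b y) x = _ from h1.fderiv]
  simp [quadPow]
  ring

/-- Cauchy–Schwarz for the Hermitian product with real part `b`: up to sign, `b x u` and `b x
(Complex.I • u)` are the real and imaginary parts of the product of `x` and `u`. -/
theorem sq_add_sq_le (hb : IsHermitianMetric b) (x u : W) :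
    b x u ^ 2 + b x (Complex.I • u) ^ 2 ≤ b x x * b u u := by
  rcases eq_or_ne x 0 with rfl | hx
  · simp
  have hN := hb.pos x hx
  have hs : b (Complex.I • x) u = - b x (Complex.I • u) := by
    rw [← hb.inv (Complex.I • x) u, I_smul_I_smul]; simp
  have hxx : b x (Complex.I • x) = 0 := by
    have := hb.inv x (Complex.I • x)
    rw [I_smul_I_smul, hb.symm] at this
    simp only [map_neg, neg_apply] at this
    linarith
  -- The vector is `b x x` times the component of `u` orthogonal to the complex line through `x`.
  have h0 : 0 ≤ b (b x x • u - b x u • x + b x (Complex.I • u) • (Complex.I • x))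
      (b x x • u - b x u • x + b x (Complex.I • u) • (Complex.I • x)) := by
    rcases eq_or_ne (b x x • u - b x u • x + b x (Complex.I • u) • (Complex.I • x)) 0 with h | h
    · rw [h]; simp
    · exact (hb.pos _ h).le
  have hix : b (Complex.I • x) x = 0 := by rw [hb.symm, hxx]
  have hux : b u (Complex.I • x) = -b x (Complex.I • u) := by rw [hb.symm, hs]
  simp only [map_add, map_sub, map_smul, add_apply,
    sub_apply, smul_apply, smul_eq_mul, hb.inv, hxx, hs,
    hix, hux, hb.symm u x] at h0
  have h1 : 0 ≤ b x x * (b x x * b u u - (b x u ^ 2 + b x (Complex.I • u) ^ 2)) := by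
    linarith
  linarith [nonneg_of_mul_nonneg_right h1 hN]

/-- Strict plurisubharmonicity. -/
theorem levi_pos (hb : IsHermitianMetric b) (hs : 0 < s) (hs1 : s ≤ 1) (hx : x ≠ 0) {u : W}
    (hu : u ≠ 0) :
    0 < fderiv ℝ (fderiv ℝ (quadPow b s)) x u u +
      fderiv ℝ (fderiv ℝ (quadPow b s)) x (Complex.I • u) (Complex.I • u) := by
  have hN := hb.pos x hx
  rw [fderiv_fderiv_quadPow hb s hx, fderiv_fderiv_quadPow hb s hx, hb.inv]
  have hp : 0 < (b x x) ^ (s - 1 - 1) := Real.rpow_pos_of_pos hN _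
  have e : (b x x) ^ (s - 1) = (b x x) ^ (s - 1 - 1) * b x x := by
    rw [← Real.rpow_add_one hN.ne']; congr 1; ring
  have hcs := sq_add_sq_le hb x u
  have hk : 0 < b x x * b u u := mul_pos hN (hb.pos u hu)
  -- With `K = b x x * b u u` and `S` the sum of the two squares, the Levi form is `4 s b(x,
  -- x)^(s-2) (K + (s - 1) S)`. The bracket equals `s K + (s - 1)(S - K)`, where `S ≤ K` and `s ≤
  -- 1`.
  have h1 : 0 < s * (b x x * b u u) + (s - 1) * (b x u ^ 2 + b x (Complex.I • u) ^ 2 -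
      b x x * b u u) := by
    have := mul_nonneg (sub_nonneg.2 hs1) (sub_nonneg.2 hcs)
    nlinarith [mul_pos hs hk]
  have h2 := mul_pos (mul_pos hs hp) h1
  rw [e]
  nlinarith [h2]

theorem contDiffAt_twistedDifferential (c : ℝ) {f : W → ℝ} (hf : ContDiffAt ℝ ∞ f x) :
    ContDiffAt ℝ ∞ (twistedDifferential c f) x := by
  have h1 : ContDiffAt ℝ ∞ (fderiv ℝ f) x := hf.fderiv_right (by simp)
  exact (h1.clm_comp (g := fderiv ℝ f) (f := fun _ => (mulI : W →L[ℝ] W))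
    contDiffAt_const).const_smul c

theorem fderiv_twistedDifferential (c : ℝ) {f : W → ℝ} (hf : ContDiffAt ℝ ∞ f x) (u v : W) :
    fderiv ℝ (twistedDifferential c f) x u v =
      c * fderiv ℝ (fderiv ℝ f) x u (Complex.I • v) := by
  have h1 : ContDiffAt ℝ ∞ (fderiv ℝ f) x := hf.fderiv_right (by simp)
  have h2 := ((h1.differentiableAt (by simp)).hasFDerivAt.clm_comp
    (hasFDerivAt_const (mulI : W →L[ℝ] W) x)).const_smul c
  rw [show fderiv ℝ (twistedDifferential c f) x = _ from h2.fderiv]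
  simp [mulI_apply]

theorem extDeriv_twistedDifferential (c : ℝ) {f : W → ℝ} (hf : ContDiffAt ℝ ∞ f x)
    (v : Fin 2 → W) :
    extDeriv (oneForm (twistedDifferential c f)) x v =
      c * (fderiv ℝ (fderiv ℝ f) x (v 0) (Complex.I • v 1) -
        fderiv ℝ (fderiv ℝ f) x (v 1) (Complex.I • v 0)) := by
  rw [extDeriv_oneForm ((contDiffAt_twistedDifferential c hf).of_le (by simp)),
    fderiv_twistedDifferential c hf, fderiv_twistedDifferential c hf]
  ring

theorem fderiv_ofReal {f : W → ℝ} (hf : DifferentiableAt ℝ f x) :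
    fderiv ℝ (fun y => (f y : ℂ)) x = Complex.ofRealCLM.comp (fderiv ℝ f x) :=
  (Complex.ofRealCLM.hasFDerivAt.comp x hf.hasFDerivAt).fderiv

/-- Half the difference of `df - i df ∘ I` and `df + i df ∘ I` is `-i df ∘ I`, and the factor `i`
turns this into the real form `df ∘ I`. -/
theorem del_sub_delbar {f : W → ℝ} (hf : DifferentiableAt ℝ f x) (c : ℝ) (v : Fin 1 → W) :
    (((c : ℂ) * Complex.I) • (del (fun y => (f y : ℂ)) x - delbar (fun y => (f y : ℂ)) x)) v =
      (twistedDifferential c f x (v 0) : ℂ) := by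
  simp only [del, delbar, fderiv_ofReal hf, twistedDifferential,
    ContinuousAlternatingMap.smul_apply, ContinuousAlternatingMap.sub_apply,
    ContinuousAlternatingMap.ofSubsingleton_apply_apply, smul_apply,
    sub_apply, add_apply, ContinuousLinearMap.comp_apply,
    smul_eq_mul, Complex.ofRealCLM_apply, Complex.ofReal_mul]
  linear_combination (-(c : ℂ) * ((fderiv ℝ f x) (mulI (v 0)) : ℂ)) * Complex.I_mul_I

/-- As `∂f` is `df / 2 - (i / 2) df ∘ I` and `d(df) = 0`, its differential is `-(i / 2) d(df ∘ I)`.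
By symmetry of the Hessian this is already `I`-invariant, so projecting to type (1,1) changes
nothing. -/
theorem delbarDel_apply {f : W → ℝ} (hf : ContDiffAt ℝ ∞ f x) (c : ℝ) (v : Fin 2 → W) :
    ((((2 * c : ℝ) : ℂ) * Complex.I) • delbarDel (fun y => (f y : ℂ)) x) v =
      (extDeriv (oneForm (twistedDifferential c f)) x v : ℂ) := by
  have h1 : ContDiffAt ℝ ∞ (fderiv ℝ f) x := hf.fderiv_right (by simp)
  let a : W → W →L[ℝ] ℂ := fun y => (1 / 2 : ℂ) • (Complex.ofRealCLM.comp (fderiv ℝ f y) -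
    Complex.I • (Complex.ofRealCLM.comp (fderiv ℝ f y)).comp mulI)
  have hco : ContDiffAt ℝ ∞ (fun y => Complex.ofRealCLM.comp (fderiv ℝ f y)) x :=
    contDiffAt_const.clm_comp h1
  have ha : ContDiffAt ℝ ∞ a x :=
    (hco.sub ((hco.clm_comp contDiffAt_const).const_smul _)).const_smul _
  have hev : del (fun y => (f y : ℂ)) =ᶠ[𝓝 x] oneForm a := by
    have h2 : ∀ᶠ y in 𝓝 x, DifferentiableAt ℝ f y :=
      ((hf.of_le (m := 1) (by simp)).eventually (by simp)).mono
        fun y hy => hy.differentiableAt (by simp)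
    filter_upwards [h2] with y hy
    rw [del, fderiv_ofReal hy]
    rfl
  have hda : ∀ u w, fderiv ℝ a x u w = (1 / 2 : ℂ) * ((fderiv ℝ (fderiv ℝ f) x u w : ℝ) -
      Complex.I * (fderiv ℝ (fderiv ℝ f) x u (Complex.I • w) : ℝ)) := by
    intro u w
    have e1 := (h1.differentiableAt (by simp)).hasFDerivAt
    have e2 := (hasFDerivAt_const (Complex.ofRealCLM) x).clm_comp e1
    have e3 := (e2.sub ((e2.clm_comp (hasFDerivAt_const (mulI : W →L[ℝ] W) x)).const_smul
      Complex.I)).const_smul (1 / 2 : ℂ)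
    rw [show fderiv ℝ a x = _ from e3.fderiv]
    simp [mulI_apply]
  have hsymm : ∀ u w, fderiv ℝ (fderiv ℝ f) x u w = fderiv ℝ (fderiv ℝ f) x w u :=
    fun u w => (hf.isSymmSndFDerivAt (by simpa using two_le_smooth)) u w
  have key : ∀ v : Fin 2 → W, extDeriv (oneForm a) x v = -(1 / 2 : ℂ) * Complex.I *
      ((fderiv ℝ (fderiv ℝ f) x (v 0) (Complex.I • v 1) : ℝ) -
        (fderiv ℝ (fderiv ℝ f) x (v 1) (Complex.I • v 0) : ℝ)) := by
    intro v
    rw [extDeriv_oneForm (ha.of_le (by simp)), hda, hda, hsymm (v 0) (v 1)]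
    ring
  rw [extDeriv_twistedDifferential c hf, delbarDel, delbarOneZero, hev.extDeriv_eq]
  simp only [ContinuousAlternatingMap.smul_apply, ContinuousAlternatingMap.add_apply,
    ContinuousAlternatingMap.compContinuousLinearMap_apply, key, Function.comp_apply, mulI_apply,
    I_smul_I_smul, map_neg, smul_eq_mul]
  rw [hsymm (Complex.I • v 0) (v 1), hsymm (Complex.I • v 1) (v 0)]
  push_cast
  linear_combination (-(c : ℂ) * ((fderiv ℝ (fderiv ℝ f) x (v 0) (Complex.I • v 1) : ℝ) -
        (fderiv ℝ (fderiv ℝ f) x (v 1) (Complex.I • v 0) : ℝ))) * Complex.I_mul_I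

end Potential

/-! ### Kähler structures transported from complex submanifolds -/

section Kaehler

variable {V : Type} [NormedAddCommGroup V] [NormedSpace ℝ V]
variable {W : Type} [NormedAddCommGroup W] [NormedSpace ℝ W] [NormedSpace ℂ W]
  [IsScalarTower ℝ ℂ W]

/-- Tangent vectors are the fixed vectors `w = dφ (dψ w)` of a composite of complex linear maps;
hence `i w` is in the image of `dφ` as well. -/
theorem I_smul_mem_tangentSpaceAt {d : ℕ} {N : Set W} {y : W} (h : HasParam ℂ d N y) {w : W}
    (hw : w ∈ tangentSpaceAt N y) : Complex.I • w ∈ tangentSpaceAt N y := by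
  obtain ⟨φ, ψ, hφ, hψ, hy, h1, h2⟩ := h
  have hφ1 := hφ.differentiableAt.hasFDerivAt.restrictScalars ℝ
  have hψ1 := hψ.differentiableAt.hasFDerivAt.restrictScalars ℝ
  have key : w = fderiv ℝ φ (ψ y) (fderiv ℝ ψ y w) := by
    have hle : tangentSpaceAt N y ≤ LinearMap.eqLocus LinearMap.id
        ((fderiv ℝ φ (ψ y)).comp (fderiv ℝ ψ y) : W →ₗ[ℝ] W) := by
      refine tangentSpaceAt_le ?_
      rintro γ hγ hM rfl
      have e1 := (hφ.restrictScalars.differentiableAt.hasFDerivAt.comp (γ 0)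
        hψ.restrictScalars.differentiableAt.hasFDerivAt).comp_hasDerivAt 0
          (hγ.differentiableAt (by simp)).hasDerivAt
      have e2 : (fun t => φ (ψ (γ t))) =ᶠ[𝓝 0] γ := by
        filter_upwards [hM, hγ.continuousAt.eventually h2] with t ht ht'
        exact ht' ht
      exact (e1.congr_of_eventuallyEq e2.symm).deriv
    exact hle hw
  rw [hφ1.fderiv, hψ1.fderiv] at key
  have : Complex.I • w = fderiv ℝ φ (ψ y) (Complex.I • (fderiv ℂ ψ y w)) := by
    rw [hφ1.fderiv]
    conv_lhs => rw [key]
    simp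
  rw [this]
  have hm := fderiv_mem_tangentSpaceAt hφ.restrictScalars.contDiffAt (h1.mono fun _ h => h.1)
    (Complex.I • (fderiv ℂ ψ y w))
  rwa [hy] at hm

/-- The data of a diffeomorphism `τ` with inverse `σ` of `M` onto a complex submanifold `N` for
which a one-form `θ` on `M` is the pull-back of `c √-1 (∂ - ∂̄)` of a power of a Hermitian
norm. -/
structure PotentialData (d : ℕ) (M : Set V) (N : Set W) (τ : V → W) (σ : W → V)
    (θ : V → V →L[ℝ] ℝ) (b : W →L[ℝ] W →L[ℝ] ℝ) (s c : ℝ) : Prop where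
  param : ∀ y ∈ N, HasParam ℂ d N y
  ne_zero : ∀ y ∈ N, y ≠ 0
  smooth : ∀ x ∈ M, SmoothNear ℝ τ x
  smooth_inv : ∀ y ∈ N, SmoothNear ℝ σ y
  mapsTo : MapsTo τ M N
  mapsTo_inv : MapsTo σ N M
  invOn : InvOn σ τ M N
  metric : IsHermitianMetric b
  exponent_pos : 0 < s
  exponent_le : s ≤ 1
  const_pos : 0 < c
  smooth_form : ContDiff ℝ ∞ θ
  form_eq : ∀ x ∈ M, ∀ v ∈ tangentSpaceAt M x,
    θ x v = twistedDifferential c (quadPow b s) (τ x) (fderiv ℝ τ x v)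

namespace PotentialData

variable {d : ℕ} {M : Set V} {N : Set W} {τ : V → W} {σ : W → V} {θ : V → V →L[ℝ] ℝ}
  {b : W →L[ℝ] W →L[ℝ] ℝ} {s c : ℝ}

/-- The source acquires its manifold structure from the target: `τ` and `σ` transport the complex
parametrisations, read as real ones of twice the dimension. -/
theorem param_source (h : PotentialData d M N τ σ θ b s c) {x : V} (hx : x ∈ M) :
    HasParam ℝ (2 * d) M x := by
  have hσx : σ (τ x) = x := h.invOn.1 hx
  refine HasParam.transport (N := N) τ σ (h.param _ (h.mapsTo hx)).restrictScalars (h.smooth x hx)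
    (h.smooth_inv _ (h.mapsTo hx)) hσx ?_ ?_
  · exact Filter.Eventually.of_forall fun y hy => ⟨h.mapsTo hy, h.invOn.1 hy⟩
  · exact Filter.Eventually.of_forall fun y hy => ⟨h.mapsTo_inv hy, h.invOn.2 hy⟩

theorem eqOn_oneForm (h : PotentialData d M N τ σ θ b s c) :
    EqOnSubmanifold M (complexify (oneForm θ)) (pullback τ fun B =>
      ((c : ℂ) * Complex.I) • (del (fun y => (quadPow b s y : ℂ)) B -
        delbar (fun y => (quadPow b s y : ℂ)) B)) := by
  intro x hx v hv
  have hd := contDiffAt_quadPow h.metric s (h.ne_zero _ (h.mapsTo hx))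
  rw [pullback, ContinuousAlternatingMap.compContinuousLinearMap_apply,
    del_sub_delbar (hd.differentiableAt (by simp))]
  exact congrArg (fun t : ℝ => (t : ℂ)) (h.form_eq x hx _ (hv 0))

theorem extDeriv_eq (h : PotentialData d M N τ σ θ b s c) {x : V} (hx : x ∈ M)
    (v : Fin 2 → V) (hv : ∀ i, v i ∈ tangentSpaceAt M x) :
    extDeriv (oneForm θ) x v = extDeriv (oneForm (twistedDifferential c (quadPow b s))) (τ x)
      (fun i => fderiv ℝ τ x (v i)) := by
  have hd := contDiffAt_quadPow h.metric s (h.ne_zero _ (h.mapsTo hx))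
  exact extDeriv_eq_pullback (h.param_source hx) (h.smooth x hx)
    (h.smooth_form.contDiffAt.of_le (by simp))
    ((contDiffAt_twistedDifferential c hd).of_le (by simp)) h.form_eq v hv

theorem eqOn_twoForm (h : PotentialData d M N τ σ θ b s c) :
    EqOnSubmanifold M (complexify (extDeriv (oneForm θ))) (pullback τ fun B =>
      (((2 * c : ℝ) : ℂ) * Complex.I) • delbarDel (fun y => (quadPow b s y : ℂ)) B) := by
  intro x hx v hv
  have hd := contDiffAt_quadPow h.metric s (h.ne_zero _ (h.mapsTo hx))
  rw [pullback, ContinuousAlternatingMap.compContinuousLinearMap_apply, delbarDel_apply hd]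
  exact congrArg (fun t : ℝ => (t : ℂ)) (h.extDeriv_eq hx v hv)

theorem isKaehlerVia [FiniteDimensional ℝ V] [FiniteDimensional ℂ W]
    (h : PotentialData d M N τ σ θ b s c) :
    IsKaehlerVia d M N τ (extDeriv (oneForm θ)) where
  submanifold := isSubmanifold_of_hasParam fun _ hx => h.param_source hx
  complexSubmanifold := isSubmanifold_of_hasParam h.param
  diffeo := ⟨fun x hx => (h.smooth x hx).contDiffAt.contDiffWithinAt, h.mapsTo, σ,
    fun y hy => (h.smooth_inv y hy).contDiffAt.contDiffWithinAt, h.mapsTo_inv, h.invOn⟩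
  closed := by
    intro x _ v _
    -- `θ` is smooth on the whole ambient space, so `d² = 0` holds there, before any restriction to
    -- `M`.
    rw [extDeriv_extDeriv_apply (h.smooth_form.contDiffAt (x := x)).oneForm
      (by simpa using two_le_smooth)]
    rfl
  kaehler := by
    classical
    have hmem : ∀ x ∈ M, ∀ v ∈ tangentSpaceAt M x,
        fderiv ℝ σ (τ x) (mulI (fderiv ℝ τ x v)) ∈ tangentSpaceAt M x := by
      intro x hx v hv
      have h1 := I_smul_mem_tangentSpaceAt (h.param _ (h.mapsTo hx))
        (tangentSpaceAt_map (h.smooth x hx).contDiffAt h.mapsTo hv)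
      have h2 := tangentSpaceAt_map (h.smooth_inv _ (h.mapsTo hx)).contDiffAt h.mapsTo_inv h1
      rwa [h.invOn.1 hx] at h2
    -- `J = dσ ∘ i ∘ dτ`. It preserves tangent spaces because `i` preserves those of the complex
    -- submanifold `N`; outside `M` the value is irrelevant and set to zero.
    let J : (x : V) → tangentSpaceAt M x →ₗ[ℝ] tangentSpaceAt M x := fun x =>
      if hx : x ∈ M then LinearMap.restrict
        (((fderiv ℝ σ (τ x)).comp (mulI.comp (fderiv ℝ τ x)) : V →L[ℝ] V) : V →ₗ[ℝ] V) (hmem x hx)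
      else 0
    have hJ : ∀ x ∈ M, ∀ v, fderiv ℝ τ x (J x v) = Complex.I • fderiv ℝ τ x v := by
      intro x hx v
      have e : (J x v : V) = fderiv ℝ σ (τ x) (mulI (fderiv ℝ τ x v)) := by
        simp only [J, hx, dif_pos]; rfl
      rw [e]
      have h1 := I_smul_mem_tangentSpaceAt (h.param _ (h.mapsTo hx))
        (tangentSpaceAt_map (h.smooth x hx).contDiffAt h.mapsTo v.2)
      have hσx : σ (τ x) = x := h.invOn.1 hx
      have h2 := fderiv_comp_eq_self (M := N) (τ := σ) (σ := τ)
        (h.smooth_inv _ (h.mapsTo hx)).differentiableAt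
        (by rw [hσx]; exact (h.smooth x hx).differentiableAt) (fun y hy => h.invOn.2 hy) h1
      rwa [hσx] at h2
    refine ⟨J, fun x hx => ⟨hJ x hx, fun u v => ?_, fun v hv => ?_⟩⟩
    · have hd := contDiffAt_quadPow h.metric s (h.ne_zero _ (h.mapsTo hx))
      rw [h.extDeriv_eq hx _ (by intro i; fin_cases i <;> simp),
        h.extDeriv_eq hx _ (by intro i; fin_cases i <;> simp),
        extDeriv_twistedDifferential c hd, extDeriv_twistedDifferential c hd]
      have hsymm : ∀ u w, fderiv ℝ (fderiv ℝ (quadPow b s)) (τ x) u w =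
          fderiv ℝ (fderiv ℝ (quadPow b s)) (τ x) w u :=
        fun u w => (hd.isSymmSndFDerivAt (by simpa using two_le_smooth)) u w
      simp only [Matrix.cons_val_zero, Matrix.cons_val_one, hJ x hx, I_smul_I_smul, map_neg]
      rw [hsymm (Complex.I • _) (fderiv ℝ τ x v), hsymm (Complex.I • _) (fderiv ℝ τ x u)]
      ring
    · have hd := contDiffAt_quadPow h.metric s (h.ne_zero _ (h.mapsTo hx))
      have hne : fderiv ℝ τ x v ≠ 0 := by
        intro h0
        have := fderiv_comp_eq_self (M := M) (h.smooth x hx).differentiableAt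
          (h.smooth_inv _ (h.mapsTo hx)).differentiableAt (fun y hy => h.invOn.1 hy) v.2
        rw [h0, map_zero] at this
        exact hv (Subtype.ext this.symm)
      rw [h.extDeriv_eq hx _ (by intro i; fin_cases i <;> simp),
        extDeriv_twistedDifferential c hd]
      simp only [Matrix.cons_val_zero, Matrix.cons_val_one, hJ x hx, I_smul_I_smul, map_neg]
      -- With `w = dτ v`, `Ω(Jv, v)` is `c` times the sum of the Hessian values at `(w, w)` and
      -- `(iw, iw)`, that is, the Levi form; `w ≠ 0` since `dσ` recovers `v` from it.
      have := levi_pos h.metric h.exponent_pos h.exponent_le (h.ne_zero _ (h.mapsTo hx)) hne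
      exact mul_pos h.const_pos (by linarith)

end PotentialData

end Kaehler

/-! ### Quaternions and complex matrices -/

section Quaternions

variable {n : ℕ}

theorem rho_add (a b : ℍ[ℝ]) : rho (a + b) = rho a + rho b := by
  ext i j
  fin_cases i <;> fin_cases j <;> simp [rho] <;> ring

theorem rho_smul (c : ℝ) (a : ℍ[ℝ]) : rho (c • a) = (c : ℂ) • rho a := by
  ext i j
  fin_cases i <;> fin_cases j <;> simp [rho] <;> ring

theorem rho_one : rho 1 = 1 := by
  ext i j
  fin_cases i <;> fin_cases j <;> simp [rho]

theorem rho_mul (a b : ℍ[ℝ]) : rho (a * b) = rho a * rho b := by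
  ext i j
  fin_cases i <;> fin_cases j <;>
    simp [rho, Matrix.mul_apply, Fin.sum_univ_two, Complex.ext_iff] <;>
    constructor <;> ring

/-- On the image of `ρ` the adjugate and the conjugate transpose agree. The adjugate of a `2 × 2`
matrix is complex linear, so it is the version of conjugation that survives complexification. -/
theorem rho_star_eq_adjugate (a : ℍ[ℝ]) : rho (star a) = (rho a).adjugate := by
  rw [Matrix.adjugate_fin_two]
  ext i j
  fin_cases i <;> fin_cases j <;> simp [rho] <;> ring

theorem rho_star (a : ℍ[ℝ]) : rho (star a) = (rho a)ᴴ := by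
  ext i j
  fin_cases i <;> fin_cases j <;> simp [rho]

theorem adjugate_add_fin_two (X Y : Matrix (Fin 2) (Fin 2) ℂ) :
    (X + Y).adjugate = X.adjugate + Y.adjugate := by
  simp only [Matrix.adjugate_fin_two]
  ext i j
  fin_cases i <;> fin_cases j <;> simp <;> ring

theorem adjugate_smul_fin_two (c : ℂ) (X : Matrix (Fin 2) (Fin 2) ℂ) :
    (c • X).adjugate = c • X.adjugate := by
  simp only [Matrix.adjugate_fin_two]
  ext i j
  fin_cases i <;> fin_cases j <;> simp

/-- The quaternion `a` in `ρ(a) + √-1 ρ(b)`. -/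
def quatRe (X : Matrix (Fin 2) (Fin 2) ℂ) : ℍ[ℝ] :=
  ⟨((X 0 0 + X 1 1) / 2).re, ((X 0 0 - X 1 1) / 2).im, ((X 0 1 - X 1 0) / 2).re,
    ((X 0 1 + X 1 0) / 2).im⟩

/-- The quaternion `b` in `ρ(a) + √-1 ρ(b)`. -/
def quatIm (X : Matrix (Fin 2) (Fin 2) ℂ) : ℍ[ℝ] :=
  ⟨((X 0 0 + X 1 1) / 2).im, -((X 0 0 - X 1 1) / 2).re, ((X 0 1 - X 1 0) / 2).im,
    -((X 0 1 + X 1 0) / 2).re⟩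

theorem rho_quatRe_add (X : Matrix (Fin 2) (Fin 2) ℂ) :
    rho (quatRe X) + Complex.I • rho (quatIm X) = X := by
  ext i j
  fin_cases i <;> fin_cases j <;> simp [rho, quatRe, quatIm, Complex.ext_iff] <;>
    constructor <;> ring

theorem quatRe_rho_add (a b : ℍ[ℝ]) : quatRe (rho a + Complex.I • rho b) = a := by
  ext <;> simp [rho, quatRe] <;> ring

theorem quatIm_rho_add (a b : ℍ[ℝ]) : quatIm (rho a + Complex.I • rho b) = b := by
  ext <;> simp [rho, quatIm] <;> ring

theorem quatRe_add (X Y : Matrix (Fin 2) (Fin 2) ℂ) : quatRe (X + Y) = quatRe X + quatRe Y := by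
  ext <;> simp <;> simp [quatRe] <;> ring

theorem quatIm_add (X Y : Matrix (Fin 2) (Fin 2) ℂ) : quatIm (X + Y) = quatIm X + quatIm Y := by
  ext <;> simp <;> simp [quatIm] <;> ring

theorem quatRe_smul (c : ℝ) (X : Matrix (Fin 2) (Fin 2) ℂ) : quatRe (c • X) = c • quatRe X := by
  ext <;> simp <;> simp [quatRe] <;> ring

theorem quatIm_smul (c : ℝ) (X : Matrix (Fin 2) (Fin 2) ℂ) : quatIm (c • X) = c • quatIm X := by
  ext <;> simp <;> simp [quatIm] <;> ring

/-- The determinant is the complex quadratic extension of the quaternion norm `star a * a`. -/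
theorem det_rho_add (a b : ℍ[ℝ]) : (rho a + Complex.I • rho b).det =
    (((star a * a).re - (star b * b).re : ℝ) : ℂ) + 2 * Complex.I * ((star a * b).re : ℝ) := by
  rw [Matrix.det_fin_two]
  simp [rho, Complex.ext_iff]
  constructor <;> ring

theorem hermitian_rho_add (a b a' b' : ℍ[ℝ]) :
    ∑ j, ∑ k, ((starRingEnd ℂ) ((rho a + Complex.I • rho b) j k) *
      (rho a' + Complex.I • rho b') j k).re = 2 * ((star a * a').re + (star b * b').re) := by
  simp [rho, Fin.sum_univ_two]
  ring

theorem re_star_mul_comm (a b : ℍ[ℝ]) : (star a * b).re = (star b * a).re := by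
  simp; ring

theorem re_sum {ι : Type*} (s : Finset ι) (f : ι → ℍ[ℝ]) : (∑ i ∈ s, f i).re = ∑ i ∈ s, (f i).re :=
  map_sum (AddMonoidHom.mk' (fun q : ℍ[ℝ] => q.re) fun _ _ => rfl) f s

theorem einner_eq (h k : HVec n) : einner h k = ∑ i, (star (h i) * k i).re := by
  simp only [einner, hinner, Quaternion.re_smul, Quaternion.re_add, re_sum, smul_eq_mul]
  rw [Finset.sum_congr rfl fun i _ => re_star_mul_comm (k i) (h i)]
  ring

theorem einner_eq_re (h k : HVec n) : einner h k = (hinner h k).re := by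
  rw [einner_eq, hinner, re_sum]

theorem einner_comm (h k : HVec n) : einner h k = einner k h := by
  rw [einner_eq, einner_eq]
  exact Finset.sum_congr rfl fun i _ => re_star_mul_comm _ _

theorem re_star_mul_self (a : ℍ[ℝ]) : (star a * a).re = Quaternion.normSq a := by
  rw [Quaternion.star_mul_self]; rfl

theorem einner_self_pos {q : HVec n} (hq : q ≠ 0) : 0 < einner q q := by
  obtain ⟨i, hi⟩ := Function.ne_iff.1 hq
  rw [einner_eq]
  refine Finset.sum_pos' (fun j _ => ?_) ⟨i, Finset.mem_univ i, ?_⟩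
  · rw [re_star_mul_self]; exact Quaternion.normSq_nonneg
  · rw [re_star_mul_self]
    exact lt_of_le_of_ne Quaternion.normSq_nonneg (Quaternion.normSq_ne_zero.2 hi).symm

theorem einner_self_nonneg (q : HVec n) : 0 ≤ einner q q := by
  rcases eq_or_ne q 0 with rfl | h
  · simp [einner_eq]
  · exact (einner_self_pos h).le

theorem einner_self_eq_zero {q : HVec n} : einner q q = 0 ↔ q = 0 :=
  ⟨fun h => by_contra fun hq => (einner_self_pos hq).ne' h, fun h => by simp [h, einner_eq]⟩

/-- The Euclidean inner product as a continuous bilinear map. -/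
def einnerL (n : ℕ) : HVec n →L[ℝ] HVec n →L[ℝ] ℝ :=
  (LinearMap.mk₂ ℝ einner
    (fun a b c => by
      simp only [einner_eq, Pi.add_apply, star_add, add_mul, Quaternion.re_add,
        Finset.sum_add_distrib])
    (fun r a b => by
      simp only [einner_eq, Pi.smul_apply, Quaternion.star_smul, smul_mul_assoc,
        Quaternion.re_smul, Finset.mul_sum, smul_eq_mul])
    (fun a b c => by
      simp only [einner_eq, Pi.add_apply, mul_add, Quaternion.re_add, Finset.sum_add_distrib])
    (fun r a b => by
      simp only [einner_eq, Pi.smul_apply, mul_smul_comm,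
        Quaternion.re_smul, Finset.mul_sum, smul_eq_mul])).toContinuousBilinearMap

theorem einnerL_apply (h k : HVec n) : einnerL n h k = einner h k := rfl

theorem einner_smul_left (c : ℝ) (h k : HVec n) : einner (c • h) k = c * einner h k := by
  simp [← einnerL_apply]

theorem einner_smul_right (c : ℝ) (h k : HVec n) : einner h (c • k) = c * einner h k := by
  simp [← einnerL_apply]

theorem einner_add_left (a b k : HVec n) : einner (a + b) k = einner a k + einner b k := by
  simp [← einnerL_apply]

theorem einner_add_right (h a b : HVec n) : einner h (a + b) = einner h a + einner h b := by
  simp [← einnerL_apply]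

theorem vnorm_pos {q : HVec n} (hq : q ≠ 0) : 0 < vnorm q := Real.sqrt_pos.2 (einner_self_pos hq)

theorem vnorm_sq (q : HVec n) : vnorm q ^ 2 = einner q q := Real.sq_sqrt (einner_self_nonneg q)

theorem hinner_star (h k : HVec n) : star (hinner h k) = hinner k h := by
  simp [hinner]

theorem hinner_self (p : HVec n) : hinner p p = ((einner p p : ℝ) : ℍ[ℝ]) := by
  rw [einner_eq_re]
  exact (Quaternion.star_eq_self (a := hinner p p)).1 (hinner_star p p)

/-- The complexification of `ℍ^{n+1}` as `M(2, ℂ)^{n+1}`. -/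
def complexifyVec (n : ℕ) : HVec n × HVec n →L[ℝ] CTuple n :=
  LinearMap.toContinuousLinearMap
    { toFun := fun x i => rho (x.1 i) + Complex.I • rho (x.2 i)
      map_add' := fun x y => by
        funext i
        simp only [Prod.fst_add, Prod.snd_add, Pi.add_apply, rho_add, smul_add]
        abel
      map_smul' := fun c x => by
        funext i
        simp only [Prod.smul_fst, Prod.smul_snd, Pi.smul_apply, rho_smul, RingHom.id_apply,
          smul_comm Complex.I (c : ℂ), ← smul_add]
        rfl }

theorem complexifyVec_apply (x : HVec n × HVec n) (i : Fin (n + 1)) :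
    complexifyVec n x i = rho (x.1 i) + Complex.I • rho (x.2 i) := rfl

/-- Real and imaginary part of an element of the complexification of `ℍ^{n+1}`. -/
def realPartsVec (n : ℕ) : CTuple n →L[ℝ] HVec n × HVec n :=
  LinearMap.toContinuousLinearMap
    { toFun := fun B => (fun i => quatRe (B i), fun i => quatIm (B i))
      map_add' := fun x y => by
        refine Prod.ext (funext fun i => ?_) (funext fun i => ?_)
        · exact quatRe_add _ _
        · exact quatIm_add _ _
      map_smul' := fun c x => by
        refine Prod.ext (funext fun i => ?_) (funext fun i => ?_)
        · exact quatRe_smul _ _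
        · exact quatIm_smul _ _ }

theorem complexifyVec_realPartsVec (B : CTuple n) : complexifyVec n (realPartsVec n B) = B :=
  funext fun i => rho_quatRe_add (B i)

theorem realPartsVec_complexifyVec (x : HVec n × HVec n) :
    realPartsVec n (complexifyVec n x) = x :=
  Prod.ext (funext fun _ => quatRe_rho_add _ _) (funext fun _ => quatIm_rho_add _ _)

theorem I_smul_rho_add (a b : ℍ[ℝ]) : Complex.I • (rho a + Complex.I • rho b) =
    rho (-b) + Complex.I • rho a := by
  have : rho (-b) = -rho b := by simpa using rho_smul (-1) b
  rw [smul_add, smul_smul, Complex.I_mul_I, neg_one_smul, this, add_comm]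

theorem I_smul_complexifyVec (x : HVec n × HVec n) :
    Complex.I • complexifyVec n x = complexifyVec n (-x.2, x.1) :=
  funext fun _ => I_smul_rho_add _ _

theorem sum_det_complexifyVec (a b : HVec n) : ∑ i, (complexifyVec n (a, b) i).det =
    ((einner a a - einner b b : ℝ) : ℂ) + 2 * Complex.I * (einner a b : ℝ) := by
  simp only [complexifyVec_apply, det_rho_add, einner_eq]
  push_cast
  rw [Finset.sum_add_distrib, Finset.sum_sub_distrib, Finset.mul_sum]

/-- Separate real and imaginary parts of the complexified quadratic form. -/
theorem sum_det_complexifyVec_eq_zero {a b : HVec n} :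
    ∑ i, (complexifyVec n (a, b) i).det = 0 ↔ einner a a = einner b b ∧ einner a b = 0 := by
  rw [sum_det_complexifyVec]
  constructor
  · intro h
    have h1 := congrArg Complex.re h
    have h2 := congrArg Complex.im h
    simp at h1 h2
    exact ⟨by linarith, h2⟩
  · rintro ⟨h1, h2⟩
    simp [h1, h2]

end Quaternions

/-! ### Hermitian metrics in coordinates -/

section Coordinates

variable {W : Type} [NormedAddCommGroup W] [NormedSpace ℝ W] [NormedSpace ℂ W]
  [IsScalarTower ℝ ℂ W] [FiniteDimensional ℝ W] {κ : Type} [Fintype κ]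

/-- The real part of the standard Hermitian product in complex coordinates `T`. -/
def coordMetric (T : W →ₗ[ℂ] (κ → ℂ)) : W →L[ℝ] W →L[ℝ] ℝ :=
  (LinearMap.mk₂ ℝ (fun u v => ∑ k, ((starRingEnd ℂ) (T u k) * T v k).re)
    (fun a b c => by simp [add_mul, Finset.sum_add_distrib])
    (fun r a b => by
      have : T (r • a) = r • T a := (T.restrictScalars ℝ).map_smul r a
      simp only [this, Finset.smul_sum]
      refine Finset.sum_congr rfl fun k _ => ?_
      simp; ring)
    (fun a b c => by simp [mul_add, Finset.sum_add_distrib])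
    (fun r a b => by
      have : T (r • b) = r • T b := (T.restrictScalars ℝ).map_smul r b
      simp only [this, Finset.smul_sum]
      refine Finset.sum_congr rfl fun k _ => ?_
      simp; ring)).toContinuousBilinearMap

theorem coordMetric_apply (T : W →ₗ[ℂ] (κ → ℂ)) (u v : W) :
    coordMetric T u v = ∑ k, ((starRingEnd ℂ) (T u k) * T v k).re := rfl

theorem coordMetric_self (T : W →ₗ[ℂ] (κ → ℂ)) (u : W) :
    coordMetric T u u = ∑ k, ‖T u k‖ ^ 2 := by
  rw [coordMetric_apply]
  refine Finset.sum_congr rfl fun k _ => ?_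
  rw [← Complex.normSq_eq_norm_sq, ← Complex.normSq_eq_conj_mul_self, Complex.ofReal_re]

theorem isHermitianMetric_coordMetric {T : W →ₗ[ℂ] (κ → ℂ)} (hT : Function.Injective T) :
    IsHermitianMetric (coordMetric T) where
  symm u v := by
    simp only [coordMetric_apply]
    refine Finset.sum_congr rfl fun k _ => ?_
    simp
    ring
  pos u hu := by
    have : T u ≠ 0 := fun h => hu (hT (by rw [h, map_zero]))
    obtain ⟨k, hk⟩ := Function.ne_iff.1 this
    rw [coordMetric_self]
    exact Finset.sum_pos' (fun j _ => by positivity)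
      ⟨k, Finset.mem_univ k, pow_pos (norm_pos_iff.2 hk) 2⟩
  inv u v := by
    simp only [coordMetric_apply]
    refine Finset.sum_congr rfl fun k _ => ?_
    simp

end Coordinates

/-! ### Equations for tangent vectors, and regular quadrics -/

theorem fderiv_eq_zero_of_constant {V F : Type} [NormedAddCommGroup V] [NormedSpace ℝ V]
    [NormedAddCommGroup F] [NormedSpace ℝ F] {M : Set V} {g : V → F} {x : V} {g' : V →L[ℝ] F}
    {c : F} (hg : HasFDerivAt g g' x) (h : ∀ y ∈ M, g y = c) {v : V} (hv : v ∈ tangentSpaceAt M x) :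
    g' v = 0 := by
  have : tangentSpaceAt M x ≤ LinearMap.ker (g' : V →ₗ[ℝ] F) := by
    refine tangentSpaceAt_le ?_
    rintro γ hγ hM rfl
    have e1 := hg.comp_hasDerivAt 0 (hγ.differentiableAt (by simp)).hasDerivAt
    have e2 : (fun t => g (γ t)) =ᶠ[𝓝 0] fun _ => c := hM.mono fun t ht => h _ ht
    exact (e1.congr_of_eventuallyEq e2.symm).unique (hasDerivAt_const 0 c)
  exact this hv

theorem hasFDerivAt_bilinear_self {𝕜 V F : Type} [RCLike 𝕜] [NormedAddCommGroup V]
    [NormedSpace 𝕜 V] [NormedAddCommGroup F] [NormedSpace 𝕜 F] (b : V →L[𝕜] V →L[𝕜] F)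
    (x : V) : HasFDerivAt (fun x => b x x) (b x + b.flip x) x := by
  refine (b.hasFDerivAt.clm_apply (hasFDerivAt_id x)).congr_fderiv ?_
  ext v
  simp

theorem fderiv_bilinear_self {𝕜 V F : Type} [RCLike 𝕜] [NormedAddCommGroup V]
    [NormedSpace 𝕜 V] [NormedAddCommGroup F] [NormedSpace 𝕜 F] (b : V →L[𝕜] V →L[𝕜] F)
    (x v : V) : fderiv 𝕜 (fun x => b x x) x v = b x v + b v x := by
  rw [(hasFDerivAt_bilinear_self b x).fderiv]
  rfl

theorem contDiff_bilinear_self {𝕜 V F : Type} [RCLike 𝕜] [NormedAddCommGroup V]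
    [NormedSpace 𝕜 V] [NormedAddCommGroup F] [NormedSpace 𝕜 F] (b : V →L[𝕜] V →L[𝕜] F) :
    ContDiff 𝕜 ∞ (fun x => b x x) :=
  b.contDiff.clm_apply contDiff_id

theorem surjective_of_ne_zero {𝕜 V : Type} [RCLike 𝕜] [NormedAddCommGroup V] [NormedSpace 𝕜 V]
    {L : V →L[𝕜] 𝕜} {v : V} (hv : L v ≠ 0) : Function.Surjective L := fun c =>
  ⟨(c / L v) • v, by rw [map_smul, smul_eq_mul, div_mul_cancel₀ _ hv]⟩

/-- A quadric is a submanifold at its regular points. -/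
theorem hasParam_of_quadric {𝕜 V : Type} [RCLike 𝕜] [NormedAddCommGroup V] [NormedSpace 𝕜 V]
    [FiniteDimensional 𝕜 V] {d : ℕ} {M : Set V} {x : V} (hx : x ∈ M) (b : V →L[𝕜] V →L[𝕜] 𝕜)
    (hb : ∃ v, b x v + b v x ≠ 0) (hd : Module.finrank 𝕜 V = d + 1)
    (hM : ∀ᶠ y in 𝓝 x, (y ∈ M ↔ b y y = 0)) : HasParam 𝕜 d M x := by
  obtain ⟨v, hv⟩ := hb
  rw [← fderiv_bilinear_self] at hv
  exact hasParam_of_regular hx (fun x => b x x) ((contDiff_bilinear_self b).smoothNear x)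
    (surjective_of_ne_zero hv) (by rw [hd, Module.finrank_self]) hM

/-! ### The punctured cotangent bundle of the sphere -/

section Sphere

variable {n : ℕ}

/-- The normalising factor is stationary at `t = 0`, so projecting the line `p + t q` radially to
the sphere does not alter its initial velocity. -/
theorem hasDerivAt_inv_sqrt_one_add_sq (N : ℝ) :
    HasDerivAt (fun t : ℝ => (√(1 + t ^ 2 * N))⁻¹) 0 0 := by
  have h1 : HasDerivAt (fun t : ℝ => 1 + t ^ 2 * N) 0 0 := by
    simpa using (((hasDerivAt_id (0 : ℝ)).pow 2).mul_const N).const_add 1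
  exact ((h1.sqrt (by simp)).inv (by simp)).congr_deriv (by simp)

theorem contDiff_inv_sqrt_one_add_sq {N : ℝ} (hN : 0 ≤ N) :
    ContDiff ℝ ∞ (fun t : ℝ => (√(1 + t ^ 2 * N))⁻¹) := by
  have hpos : ∀ t : ℝ, 0 < 1 + t ^ 2 * N := fun t => by positivity
  refine ContDiff.inv (ContDiff.sqrt (by fun_prop) fun t => (hpos t).ne') fun t => ?_
  exact (Real.sqrt_pos.2 (hpos t)).ne'

/-- The arc of a great circle with velocity `q`, up to parametrisation. -/
def sphereArc (p q : HVec n) (t : ℝ) : HVec n := (√(1 + t ^ 2 * einner q q))⁻¹ • (p + t • q)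

theorem contDiff_sphereArc (p q : HVec n) : ContDiff ℝ ∞ (sphereArc p q) :=
  (contDiff_inv_sqrt_one_add_sq (einner_self_nonneg q)).smul
    (contDiff_const.add (contDiff_id.smul contDiff_const))

theorem sphereArc_zero (p q : HVec n) : sphereArc p q 0 = p := by simp [sphereArc]

theorem hasDerivAt_sphereArc (p q : HVec n) : HasDerivAt (sphereArc p q) q 0 := by
  have h1 : HasDerivAt (fun t : ℝ => p + t • q) q 0 := by
    simpa using ((hasDerivAt_id (0 : ℝ)).smul_const q).const_add p
  exact ((hasDerivAt_inv_sqrt_one_add_sq (einner q q)).smul h1).congr_deriv (by simp)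

theorem einner_sphereArc {p q : HVec n} (hp : einner p p = 1) (hq : einner p q = 0) (t : ℝ) :
    einner (sphereArc p q t) (sphereArc p q t) = 1 := by
  have hpos : 0 < 1 + t ^ 2 * einner q q := by
    have := einner_self_nonneg q
    positivity
  simp only [sphereArc, einner_smul_left, einner_smul_right, einner_add_left, einner_add_right,
    hp, hq, einner_comm q p]
  have hc : (√(1 + t ^ 2 * einner q q))⁻¹ * (√(1 + t ^ 2 * einner q q))⁻¹ *
      (1 + t ^ 2 * einner q q) = 1 := by
    rw [← mul_inv, Real.mul_self_sqrt hpos.le, inv_mul_cancel₀ hpos.ne']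
  linear_combination hc

theorem mem_tangentSpaceAt_hsphere {p q : HVec n} (hp : p ∈ hsphere n) :
    q ∈ tangentSpaceAt (hsphere n) p ↔ einner p q = 0 := by
  constructor
  · intro h
    have := fderiv_eq_zero_of_constant (hasFDerivAt_bilinear_self (einnerL n) p)
      (M := hsphere n) (c := 1) (fun y hy => hy) h
    simp [einnerL_apply, einner_comm q p] at this
    linarith
  · intro h
    exact Submodule.subset_span ⟨sphereArc p q, (contDiff_sphereArc p q).contDiffAt,
      Filter.Eventually.of_forall fun t => einner_sphereArc hp h t, sphereArc_zero p q,
      (hasDerivAt_sphereArc p q).deriv⟩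

theorem mem_puncturedTangentBundle_hsphere {x : HVec n × HVec n} :
    x ∈ puncturedTangentBundle (hsphere n) ↔
      einner x.1 x.1 = 1 ∧ einner x.1 x.2 = 0 ∧ x.2 ≠ 0 := by
  constructor
  · rintro ⟨h1, h2, h3⟩
    exact ⟨h1, (mem_tangentSpaceAt_hsphere h1).1 h2, h3⟩
  · rintro ⟨h1, h2, h3⟩
    exact ⟨h1, (mem_tangentSpaceAt_hsphere h1).2 h2, h3⟩

theorem hasFDerivAt_vnorm {q : HVec n} (hq : q ≠ 0) :
    HasFDerivAt vnorm ((vnorm q)⁻¹ • einnerL n q) q := by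
  have h := (hasFDerivAt_bilinear_self (einnerL n) q).sqrt (einner_self_pos hq).ne'
  refine h.congr_fderiv ?_
  ext v
  simp [einnerL_apply, einner_comm v q, vnorm]
  ring

theorem contDiffAt_vnorm {q : HVec n} (hq : q ≠ 0) : ContDiffAt ℝ ∞ vnorm q :=
  (contDiff_bilinear_self (einnerL n)).contDiffAt.sqrt (einner_self_pos hq).ne'

theorem tauS_eq (x : HVec n × HVec n) : tauS x = complexifyVec n (vnorm x.2 • x.1, x.2) := by
  funext i
  simp [tauS, complexifyVec_apply, rho_smul]

theorem contDiffAt_tauS {x : HVec n × HVec n} (hx : x.2 ≠ 0) : ContDiffAt ℝ ∞ tauS x := by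
  have h1 : ContDiffAt ℝ ∞ (fun y : HVec n × HVec n => vnorm y.2) x :=
    ContDiffAt.comp (g := vnorm) (f := Prod.snd) x (contDiffAt_vnorm hx) contDiffAt_snd
  have h2 := (complexifyVec n).contDiff.contDiffAt.comp x
    ((h1.smul contDiffAt_fst).prodMk contDiffAt_snd)
  exact h2.congr_of_eventuallyEq (Filter.Eventually.of_forall tauS_eq)

theorem smoothNear_tauS {x : HVec n × HVec n} (hx : x.2 ≠ 0) : SmoothNear ℝ tauS x := by
  filter_upwards [continuousAt_snd.eventually (isOpen_ne.mem_nhds hx)] with y hy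
  exact contDiffAt_tauS hy

theorem fderiv_tauS {x : HVec n × HVec n} (hx : x.2 ≠ 0) (v : HVec n × HVec n) :
    fderiv ℝ tauS x v = complexifyVec n
      (vnorm x.2 • v.1 + ((vnorm x.2)⁻¹ * einner x.2 v.2) • x.1, v.2) := by
  have h1 : HasFDerivAt (fun y : HVec n × HVec n => vnorm y.2) _ x :=
    (hasFDerivAt_vnorm hx).comp x hasFDerivAt_snd
  have h2 := (complexifyVec n).hasFDerivAt.comp x
    ((h1.smul hasFDerivAt_fst).prodMk hasFDerivAt_snd)
  have h3 : HasFDerivAt tauS _ x :=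
    h2.congr_of_eventuallyEq (Filter.Eventually.of_forall tauS_eq)
  rw [h3.fderiv]
  rfl

theorem tauS_mem_detCone {x : HVec n × HVec n} (h1 : einner x.1 x.1 = 1)
    (h2 : einner x.1 x.2 = 0) (h3 : x.2 ≠ 0) : tauS x ∈ detCone n := by
  rw [tauS_eq]
  refine ⟨fun h => h3 ?_, ?_⟩
  · have := congrArg (realPartsVec n) h
    rw [realPartsVec_complexifyVec, map_zero] at this
    exact congrArg Prod.snd this
  · rw [sum_det_complexifyVec_eq_zero]
    simp only [einner_smul_left, einner_smul_right, h1, h2, ← vnorm_sq x.2]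
    constructor <;> ring

/-- The inverse of `τ_S`. -/
def sigmaS (B : CTuple n) : HVec n × HVec n :=
  ((vnorm (realPartsVec n B).2)⁻¹ • (realPartsVec n B).1, (realPartsVec n B).2)

/-- On the cone the two real parts have equal length, so if the imaginary one vanished, all of `B`
would. -/
theorem realPartsVec_of_mem_detCone {B : CTuple n} (hB : B ∈ detCone n) :
    einner (realPartsVec n B).1 (realPartsVec n B).1 =
      einner (realPartsVec n B).2 (realPartsVec n B).2 ∧
    einner (realPartsVec n B).1 (realPartsVec n B).2 = 0 ∧ (realPartsVec n B).2 ≠ 0 := by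
  have h := hB.2
  rw [← complexifyVec_realPartsVec B] at h
  obtain ⟨h1, h2⟩ := (sum_det_complexifyVec_eq_zero (a := (realPartsVec n B).1)
    (b := (realPartsVec n B).2)).1 h
  refine ⟨h1, h2, fun h3 => hB.1 ?_⟩
  rw [h3] at h1
  have h4 : (realPartsVec n B).1 = 0 := by
    rw [← einner_self_eq_zero, h1]; simp [einner_eq]
  rw [← complexifyVec_realPartsVec B, show realPartsVec n B = 0 from Prod.ext h4 h3, map_zero]

theorem sigmaS_mem {B : CTuple n} (hB : B ∈ detCone n) :
    sigmaS B ∈ puncturedTangentBundle (hsphere n) := by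
  obtain ⟨h1, h2, h3⟩ := realPartsVec_of_mem_detCone hB
  have hpos := vnorm_pos h3
  refine mem_puncturedTangentBundle_hsphere.2 ⟨?_, ?_, h3⟩
  · simp only [sigmaS, einner_smul_left, einner_smul_right, h1]
    rw [← vnorm_sq]
    field_simp
  · simp only [sigmaS, einner_smul_left, h2, mul_zero]

theorem tauS_sigmaS {B : CTuple n} (hB : B ∈ detCone n) : tauS (sigmaS B) = B := by
  obtain ⟨h1, h2, h3⟩ := realPartsVec_of_mem_detCone hB
  rw [tauS_eq]
  simp only [sigmaS]
  rw [smul_smul, mul_inv_cancel₀ (vnorm_pos h3).ne', one_smul]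
  exact complexifyVec_realPartsVec B

theorem sigmaS_tauS {x : HVec n × HVec n} (hx : x.2 ≠ 0) : sigmaS (tauS x) = x := by
  rw [tauS_eq, sigmaS, realPartsVec_complexifyVec]
  simp only [smul_smul, inv_mul_cancel₀ (vnorm_pos hx).ne', one_smul]

theorem smoothNear_sigmaS {B : CTuple n} (hB : B ∈ detCone n) : SmoothNear ℝ sigmaS B := by
  obtain ⟨_, _, h3⟩ := realPartsVec_of_mem_detCone hB
  have hc : Continuous fun B : CTuple n => (realPartsVec n B).2 :=
    continuous_snd.comp (realPartsVec n).continuous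
  filter_upwards [hc.continuousAt.eventually (isOpen_ne.mem_nhds h3)] with y hy
  have hre : ContDiffAt ℝ ∞ (fun B : CTuple n => (realPartsVec n B).1) y :=
    contDiffAt_fst.comp y (realPartsVec n).contDiff.contDiffAt
  have him : ContDiffAt ℝ ∞ (fun B : CTuple n => (realPartsVec n B).2) y :=
    contDiffAt_snd.comp y (realPartsVec n).contDiff.contDiffAt
  have hn : ContDiffAt ℝ ∞ (fun B : CTuple n => vnorm (realPartsVec n B).2) y :=
    ContDiffAt.comp (g := vnorm) y (contDiffAt_vnorm hy) him
  exact ((hn.inv (vnorm_pos hy).ne').smul hre).prodMk him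

/-- The polarisation of `2 ∑ det B_i`. -/
def detForm (n : ℕ) : CTuple n →L[ℂ] CTuple n →L[ℂ] ℂ :=
  (LinearMap.mk₂ ℂ (fun A B : CTuple n => ∑ i, (A i 0 0 * B i 1 1 - A i 0 1 * B i 1 0))
    (fun a b c => by
      simp only [Pi.add_apply, Matrix.add_apply, ← Finset.sum_add_distrib]
      exact Finset.sum_congr rfl fun i _ => by ring)
    (fun r a b => by
      simp only [Pi.smul_apply, Matrix.smul_apply, Finset.mul_sum, smul_eq_mul]
      exact Finset.sum_congr rfl fun i _ => by ring)
    (fun a b c => by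
      simp only [Pi.add_apply, Matrix.add_apply, ← Finset.sum_add_distrib]
      exact Finset.sum_congr rfl fun i _ => by ring)
    (fun r a b => by
      simp only [Pi.smul_apply, Matrix.smul_apply, Finset.mul_sum, smul_eq_mul]
      exact Finset.sum_congr rfl fun i _ => by ring)).toContinuousBilinearMap

theorem detForm_apply (A B : CTuple n) :
    detForm n A B = ∑ i, (A i 0 0 * B i 1 1 - A i 0 1 * B i 1 0) := rfl

theorem detForm_self (B : CTuple n) : detForm n B B = ∑ i, (B i).det := by
  rw [detForm_apply]
  exact Finset.sum_congr rfl fun i _ => by rw [Matrix.det_fin_two]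

/-- The symmetrised form is nondegenerate: the four matrix units placed in slot `i` read off the
four entries of `B i` up to sign. Hence the origin is the only singular point of the cone. -/
theorem detForm_ne_zero {B : CTuple n} (hB : B ≠ 0) :
    ∃ V, detForm n B V + detForm n V B ≠ 0 := by
  by_contra! h
  refine hB (funext fun i => ?_)
  have key : ∀ X : Matrix (Fin 2) (Fin 2) ℂ,
      B i 0 0 * X 1 1 - B i 0 1 * X 1 0 + (X 0 0 * B i 1 1 - X 0 1 * B i 1 0) = 0 := by
    intro X
    have := h (Pi.single i X)
    rw [detForm_apply, detForm_apply, ← Finset.sum_add_distrib, Finset.sum_eq_single i] at this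
    · simpa using this
    · intro j _ hj
      simp [Pi.single_eq_of_ne hj]
    · simp
  have e00 := key !![0, 0; 0, 1]
  have e01 := key !![0, 0; 1, 0]
  have e10 := key !![0, 1; 0, 0]
  have e11 := key !![1, 0; 0, 0]
  simp at e00 e01 e10 e11
  ext a b
  fin_cases a <;> fin_cases b <;> simp [e00, e01, e10, e11]

theorem finrank_CTuple : Module.finrank ℂ (CTuple n) = 4 * n + 3 + 1 := by
  simp [Module.finrank_pi_fintype, Module.finrank_matrix]
  ring

theorem hasParam_detCone {B : CTuple n} (hB : B ∈ detCone n) :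
    HasParam ℂ (4 * n + 3) (detCone n) B := by
  refine hasParam_of_quadric hB (detForm n) (detForm_ne_zero hB.1) finrank_CTuple ?_
  filter_upwards [isOpen_ne.mem_nhds hB.1] with y hy
  exact ⟨fun h => (detForm_self y).trans h.2, fun h => ⟨hy, (detForm_self y).symm.trans h⟩⟩

/-- All matrix entries, as complex coordinates. -/
def coordS (n : ℕ) : CTuple n →ₗ[ℂ] (Fin (n + 1) × Fin 2 × Fin 2 → ℂ) where
  toFun B k := B k.1 k.2.1 k.2.2
  map_add' _ _ := rfl
  map_smul' _ _ := rfl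

theorem coordS_injective : Function.Injective (coordS n) := fun A B h => by
  funext i
  ext a b
  exact congrFun h (i, a, b)

/-- The factor 2 arises because each real coordinate of a quaternion occurs in two entries of its
`ρ`-image. -/
theorem coordMetric_complexifyVec (x y : HVec n × HVec n) :
    coordMetric (coordS n) (complexifyVec n x) (complexifyVec n y) =
      2 * (einner x.1 y.1 + einner x.2 y.2) := by
  rw [coordMetric_apply, Fintype.sum_prod_type, einner_eq, einner_eq, ← Finset.sum_add_distrib,
    Finset.mul_sum]
  refine Finset.sum_congr rfl fun i _ => ?_
  rw [Fintype.sum_prod_type, ← hermitian_rho_add]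
  rfl

theorem frob_sq {m : Type} [Fintype m] (A : Matrix m m ℂ) :
    frob A ^ 2 = ∑ i, ∑ j, ‖A i j‖ ^ 2 :=
  Real.sq_sqrt (Finset.sum_nonneg fun _ _ => Finset.sum_nonneg fun _ _ => by positivity)

theorem potentialS_eq :
    (potentialS : CTuple n → ℂ) = fun B => (quadPow (coordMetric (coordS n)) (1 / 2) B : ℂ) := by
  funext B
  rw [potentialS, quadPow, coordMetric_self, Real.sqrt_eq_rpow, Fintype.sum_prod_type]
  simp only [frob_sq, Fintype.sum_prod_type]
  rfl

/-- The canonical one-form of the sphere as a field of linear forms. -/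
def sphereForm (n : ℕ) (x : HVec n × HVec n) : (HVec n × HVec n) →L[ℝ] ℝ :=
  (einnerL n x.2).comp (ContinuousLinearMap.fst ℝ (HVec n) (HVec n))

theorem contDiff_sphereForm : ContDiff ℝ ∞ (sphereForm n) :=
  ((einnerL n).contDiff.comp contDiff_snd).clm_comp contDiff_const

theorem canonicalOneForm_sphereFlat :
    (canonicalOneForm sphereFlat : HVec n × HVec n → _) = oneForm (sphereForm n) := by
  funext x
  rw [canonicalOneForm, fderiv_fst]
  rfl

/-- Here `b(τ, τ) = 4‖q‖²`, and `b(τ, i dτ v)` reduces to `4‖q‖⟨q, v.1⟩` by orthogonality of `p` and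
`q` and its derivative along `v`. The scalar factor `c · 2s · b(τ, τ)^(s-1)` is `(4‖q‖)⁻¹`. -/
theorem sphereForm_eq {x : HVec n × HVec n} (hx : x ∈ puncturedTangentBundle (hsphere n))
    {v : HVec n × HVec n} (hv : v ∈ tangentSpaceAt (puncturedTangentBundle (hsphere n)) x) :
    sphereForm n x v = twistedDifferential (1 / 2) (quadPow (coordMetric (coordS n)) (1 / 2))
      (tauS x) (fderiv ℝ tauS x v) := by
  obtain ⟨h1, h2, h3⟩ := mem_puncturedTangentBundle_hsphere.1 hx
  have hpos := vnorm_pos h3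
  -- The derivative of the constraint `⟨p, q⟩ = 0` in the direction `v`.
  have hort : einner x.1 v.2 + einner v.1 x.2 = 0 := by
    have hg : HasFDerivAt (fun y : HVec n × HVec n => einnerL n y.1 y.2) _ x :=
      ((einnerL n).hasFDerivAt.comp x hasFDerivAt_fst).clm_apply hasFDerivAt_snd
    have := fderiv_eq_zero_of_constant hg (c := 0)
      (fun y hy => (mem_puncturedTangentBundle_hsphere.1 hy).2.1) hv
    simpa [einnerL_apply, add_comm] using this
  have hne := (tauS_mem_detCone h1 h2 h3).1
  have hself : coordMetric (coordS n) (tauS x) (tauS x) = (2 * vnorm x.2) ^ 2 := by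
    rw [tauS_eq, coordMetric_complexifyVec]
    simp only [einner_smul_left, einner_smul_right, h1]
    rw [← vnorm_sq]
    ring
  rw [twistedDifferential,
    (hasFDerivAt_quadPow (isHermitianMetric_coordMetric coordS_injective) _ hne).fderiv]
  simp only [smul_apply, ContinuousLinearMap.comp_apply, mulI_apply, hself, smul_eq_mul]
  rw [fderiv_tauS h3, I_smul_complexifyVec, tauS_eq, coordMetric_complexifyVec]
  have hpow : ((2 * vnorm x.2) ^ 2) ^ ((1 : ℝ) / 2 - 1) = (2 * vnorm x.2)⁻¹ := by
    rw [← Real.rpow_natCast, ← Real.rpow_mul (by positivity), ← Real.rpow_neg_one]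
    norm_num
  have hneg : einner x.1 (-v.2) = -einner x.1 v.2 := by
    rw [← einnerL_apply, map_neg, einnerL_apply]
  simp only [hpow, einner_smul_left, einner_smul_right, einner_add_right, hneg,
    einner_comm x.2 x.1, h2]
  have e : sphereForm n x v = einner x.2 v.1 := rfl
  rw [e, show einner x.1 v.2 = -einner x.2 v.1 by rw [einner_comm x.2 v.1]; linarith]
  field_simp
  ring

theorem potentialData_sphere :
    PotentialData (4 * n + 3) (puncturedTangentBundle (hsphere n)) (detCone n) tauS sigmaS
      (sphereForm n) (coordMetric (coordS n)) (1 / 2) (1 / 2) where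
  param _ hy := hasParam_detCone hy
  ne_zero _ hy := hy.1
  smooth _ hx := smoothNear_tauS hx.2.2
  smooth_inv _ hy := smoothNear_sigmaS hy
  mapsTo x hx := by
    obtain ⟨h1, h2, h3⟩ := mem_puncturedTangentBundle_hsphere.1 hx
    exact tauS_mem_detCone h1 h2 h3
  mapsTo_inv _ hy := sigmaS_mem hy
  invOn := ⟨fun _ hx => sigmaS_tauS hx.2.2, fun _ hy => tauS_sigmaS hy⟩
  metric := isHermitianMetric_coordMetric coordS_injective
  exponent_pos := by norm_num
  exponent_le := by norm_num
  const_pos := by norm_num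
  smooth_form := contDiff_sphereForm
  form_eq _ hx _ hv := sphereForm_eq hx hv

/-! ### Tangent vectors that are not vertical, as an open part of the cone -/

/-- The two columns of the `(2n+2) × 2` matrix formed by a tuple. -/
def columns (B : CTuple n) : Fin 2 → Fin (n + 1) × Fin 2 → ℂ :=
  ![fun a => B a.1 a.2 0, fun a => B a.1 a.2 1]

theorem linearIndependent_columns {B : CTuple n} :
    LinearIndependent ℂ (columns B) ↔ ∀ v, (∀ i, B i *ᵥ v = 0) → v = 0 := by
  rw [columns, LinearIndependent.pair_iff]
  have key : ∀ v : Fin 2 → ℂ, (∀ i, B i *ᵥ v = 0) ↔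
      (v 0 • (fun a : Fin (n + 1) × Fin 2 => B a.1 a.2 0) +
        v 1 • fun a : Fin (n + 1) × Fin 2 => B a.1 a.2 1) = 0 := by
    intro v
    constructor
    · intro h
      funext a
      have := congrFun (h a.1) a.2
      simpa [Matrix.mulVec, dotProduct, Fin.sum_univ_two, mul_comm] using this
    · intro h i
      funext a
      have := congrFun h (i, a)
      simpa [Matrix.mulVec, dotProduct, Fin.sum_univ_two, mul_comm] using this
  constructor
  · intro h v hv
    obtain ⟨h0, h1⟩ := h (v 0) (v 1) ((key v).1 hv)
    funext a
    fin_cases a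
    · exact h0
    · exact h1
  · intro h s t hst
    have := h ![s, t] ((key ![s, t]).2 (by simpa using hst))
    exact ⟨by simpa using congrFun this 0, by simpa using congrFun this 1⟩

theorem isOpen_linearIndependent_columns :
    IsOpen {B : CTuple n | LinearIndependent ℂ (columns B)} := by
  have hc : Continuous (columns : CTuple n → _) := by
    refine continuous_pi fun k => ?_
    fin_cases k
    · exact continuous_pi fun a => ((continuous_apply a.1).matrix_elem a.2 0)
    · exact continuous_pi fun a => ((continuous_apply a.1).matrix_elem a.2 1)
  exact isOpen_setOfPred_linearIndependent.preimage hc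

theorem spaceESTilde_eq :
    spaceESTilde n = detCone n ∩ {B : CTuple n | LinearIndependent ℂ (columns B)} := by
  ext B
  constructor
  · rintro ⟨h1, h2⟩
    refine ⟨⟨fun h => ?_, h2⟩, h1⟩
    have := h1.ne_zero 0
    exact this (by funext a; simp [h])
  · rintro ⟨⟨_, h2⟩, h1⟩
    exact ⟨h1, h2⟩

/-- Pythagoras: `p (p, q)_ℍ` is the vertical part of `q`. As `⟨p, q⟩ = 0`, the quaternion `(p, q)_ℍ`
is imaginary, so `(q, p)_ℍ` is its negative. -/
theorem einner_horizontal {p q : HVec n} (h1 : einner p p = 1) (h2 : einner p q = 0) :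
    einner (fun i => q i + p i * hinner q p) (fun i => q i + p i * hinner q p) =
      vnorm q ^ 2 - Quaternion.normSq (hinner p q) := by
  have hu : hinner q p = -hinner p q := by
    rw [← hinner_star, Quaternion.star_eq_neg, ← einner_eq_re, h2]
  have hpp : hinner p p = 1 := by rw [hinner_self, h1]; rfl
  have key : ∀ u, hinner (fun i => q i + p i * u) (fun i => q i + p i * u) =
      hinner q q + hinner q p * u + star u * hinner p q + star u * hinner p p * u := by
    intro u
    simp only [star_add, star_mul, add_mul, mul_add, Finset.sum_add_distrib, hinner,
      Finset.sum_mul, Finset.mul_sum, ← mul_assoc]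
    abel
  rw [einner_eq_re, key, hpp, hinner_star, mul_one, hu, vnorm_sq, einner_eq_re]
  have hs : hinner p q * hinner p q = -((Quaternion.normSq (hinner p q) : ℝ) : ℍ[ℝ]) := by
    rw [← Quaternion.star_mul_self, hinner_star, hu]; simp
  simp [hs]
  ring

/-- The matrix `R = ‖q‖ + √-1 ρ((p, q)_ℍ)` is `∑ ρ(θ(p_i)) B_i`, and its determinant is the squared
length of the horizontal part of `q`. If it is invertible, the `B_i` have no common kernel. If it is
singular, `q` is vertical, each `B_i` equals `ρ(p_i) R`, and the kernel of `R` is killed by all of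
them. -/
theorem linearIndependent_columns_tauS {x : HVec n × HVec n} (h1 : einner x.1 x.1 = 1)
    (h2 : einner x.1 x.2 = 0) : LinearIndependent ℂ (columns (tauS x)) ↔
      (fun i => x.2 i + x.1 i * hinner x.2 x.1) ≠ 0 := by
  have hpp : hinner x.1 x.1 = 1 := by rw [hinner_self, h1]; rfl
  set R : Matrix (Fin 2) (Fin 2) ℂ :=
    rho ((vnorm x.2 : ℝ) : ℍ[ℝ]) + Complex.I • rho (hinner x.1 x.2) with hR
  have hre : (hinner x.1 x.2).re = 0 := by rw [← einner_eq_re, h2]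
  have hdet : R.det = ((vnorm x.2 ^ 2 - Quaternion.normSq (hinner x.1 x.2) : ℝ) : ℂ) := by
    rw [hR, det_rho_add, re_star_mul_self, re_star_mul_self, Quaternion.normSq_coe]
    simp [hre]
  rw [linearIndependent_columns, Ne, ← einner_self_eq_zero, einner_horizontal h1 h2]
  have hcoe : rho ((vnorm x.2 : ℝ) : ℍ[ℝ]) = (vnorm x.2 : ℂ) • (1 : Matrix (Fin 2) (Fin 2) ℂ) := by
    rw [← rho_one, ← rho_smul, ← Quaternion.coe_mul_eq_smul, mul_one]
  have hsum : ∑ i, rho (star (x.1 i)) * tauS x i = R := by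
    have rho_sum : ∀ f : Fin (n + 1) → ℍ[ℝ], rho (∑ i, f i) = ∑ i, rho (f i) :=
      fun f => map_sum (AddMonoidHom.mk' rho rho_add) f _
    simp only [tauS, mul_add, Matrix.mul_smul, ← rho_mul, Finset.sum_add_distrib,
      ← Finset.smul_sum, ← rho_sum]
    rw [hR, show ∑ i, star (x.1 i) * x.1 i = hinner x.1 x.1 from rfl, hpp, hcoe, rho_one]
    rfl
  constructor
  · intro h h0
    have hdet0 : R.det = 0 := by rw [hdet, h0, Complex.ofReal_zero]
    obtain ⟨v, hv, hRv⟩ := Matrix.exists_mulVec_eq_zero_iff.2 hdet0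
    refine hv (h v fun i => ?_)
    have hq : x.2 i = x.1 i * hinner x.1 x.2 := by
      have e : (fun i => x.2 i + x.1 i * hinner x.2 x.1) = 0 := by
        rw [← einner_self_eq_zero, einner_horizontal h1 h2, h0]
      have := congrFun e i
      rw [← hinner_star, Quaternion.star_eq_neg.2 hre] at this
      simpa [add_neg_eq_zero] using this
    have : tauS x i = rho (x.1 i) * R := by
      rw [hR, hcoe, mul_add, Matrix.mul_smul, Matrix.mul_smul, ← rho_mul, ← hq, mul_one]
      rfl
    rw [this, ← Matrix.mulVec_mulVec, hRv, Matrix.mulVec_zero]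
  · intro h v hv
    refine Matrix.eq_zero_of_mulVec_eq_zero (M := R) ?_ ?_
    · rw [hdet]
      exact_mod_cast h
    · rw [← hsum, Matrix.sum_mulVec]
      refine Finset.sum_eq_zero fun i _ => ?_
      rw [← Matrix.mulVec_mulVec, hv i, Matrix.mulVec_zero]

theorem spaceES_subset : spaceES n ⊆ puncturedTangentBundle (hsphere n) := by
  rintro x ⟨h1, h2, h3⟩
  refine mem_puncturedTangentBundle_hsphere.2 ⟨h1, h2, fun h0 => h3 ?_⟩
  funext i
  simp [h0, hinner]

theorem potentialData_spaceES :
    PotentialData (4 * n + 3) (spaceES n) (spaceESTilde n) tauS sigmaS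
      (sphereForm n) (coordMetric (coordS n)) (1 / 2) (1 / 2) where
  param y hy := by
    rw [spaceESTilde_eq] at hy ⊢
    exact (hasParam_detCone hy.1).inter_open isOpen_linearIndependent_columns hy.2
  ne_zero y hy := by
    rw [spaceESTilde_eq] at hy
    exact hy.1.1
  smooth x hx := smoothNear_tauS (spaceES_subset hx).2.2
  smooth_inv y hy := by
    rw [spaceESTilde_eq] at hy
    exact smoothNear_sigmaS hy.1
  mapsTo x hx := by
    rw [spaceESTilde_eq]
    exact ⟨potentialData_sphere.mapsTo (spaceES_subset hx),
      (linearIndependent_columns_tauS hx.1 hx.2.1).2 hx.2.2⟩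
  mapsTo_inv y hy := by
    rw [spaceESTilde_eq] at hy
    obtain ⟨h1, h2, _⟩ := mem_puncturedTangentBundle_hsphere.1 (sigmaS_mem hy.1)
    refine ⟨h1, h2, (linearIndependent_columns_tauS h1 h2).1 ?_⟩
    rw [tauS_sigmaS hy.1]
    exact hy.2
  invOn := by
    refine ⟨fun _ hx => sigmaS_tauS (spaceES_subset hx).2.2, fun _ hy => ?_⟩
    rw [spaceESTilde_eq] at hy
    exact tauS_sigmaS hy.1
  metric := isHermitianMetric_coordMetric coordS_injective
  exponent_pos := by norm_num
  exponent_le := by norm_num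
  const_pos := by norm_num
  smooth_form := contDiff_sphereForm
  form_eq _ hx _ hv := sphereForm_eq (spaceES_subset hx) (tangentSpaceAt_mono spaceES_subset _ hv)

end Sphere

/-! ### The twisted adjoint -/

section TwistedAdjoint

/-- An index set carrying a symplectic matrix. -/
class SymplecticIndex (α : Type) [Fintype α] [DecidableEq α] where
  form : Matrix α α ℂ
  form_mul_form : form * form = -1
  form_transpose : formᵀ = -form

instance : SymplecticIndex (Fin 2) where
  form := !![0, 1; -1, 0]
  form_mul_form := by
    ext i j
    fin_cases i <;> fin_cases j <;> simp
  form_transpose := by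
    ext i j
    fin_cases i <;> fin_cases j <;> simp

instance (n : ℕ) : SymplecticIndex (Fin (n + 1) × Fin 2) where
  form := bigJ n
  form_mul_form := by
    ext ⟨i, a⟩ ⟨j, b⟩
    rw [Matrix.mul_apply, Fintype.sum_prod_type, Finset.sum_eq_single i]
    · by_cases h : i = j
      · subst h
        fin_cases a <;> fin_cases b <;> simp [bigJ]
      · have : ((i, a) : Fin (n + 1) × Fin 2) ≠ (j, b) := fun e => h (congrArg Prod.fst e)
        simp [bigJ, h, this]
    · intro k _ hk
      simp [bigJ, hk.symm]
    · simp
  form_transpose := by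
    ext ⟨i, a⟩ ⟨j, b⟩
    by_cases h : i = j
    · subst h
      fin_cases a <;> fin_cases b <;> simp [bigJ]
    · simp [bigJ, h, Ne.symm h]

variable {α β γ : Type} [Fintype α] [DecidableEq α] [SymplecticIndex α] [Fintype β]
  [DecidableEq β] [SymplecticIndex β] [Fintype γ] [DecidableEq γ] [SymplecticIndex γ]

/-- The symplectic matrix of an index set. -/
abbrev symp (α : Type) [Fintype α] [DecidableEq α] [SymplecticIndex α] : Matrix α α ℂ :=
  SymplecticIndex.form

theorem symp_mul_symp : symp α * symp α = -1 := SymplecticIndex.form_mul_form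

theorem symp_transpose : (symp α)ᵀ = -symp α := SymplecticIndex.form_transpose

theorem symp_fin_two : symp (Fin 2) = !![0, 1; -1, 0] := rfl

/-- The adjoint for the symplectic forms, which extends the quaternionic conjugate transpose
complex linearly. -/
def tadj (M : Matrix α β ℂ) : Matrix β α ℂ := -(symp β * Mᵀ * symp α)

theorem tadj_mul (M : Matrix α β ℂ) (N : Matrix β γ ℂ) : tadj (M * N) = tadj N * tadj M := by
  have : (symp γ * Nᵀ * symp β) * (symp β * Mᵀ * symp α) =
      symp γ * Nᵀ * (symp β * symp β) * Mᵀ * symp α := by simp only [Matrix.mul_assoc]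
  rw [tadj, tadj, tadj, Matrix.neg_mul, Matrix.mul_neg, neg_neg, this, symp_mul_symp,
    Matrix.transpose_mul]
  simp [Matrix.mul_assoc]

theorem tadj_tadj (M : Matrix α β ℂ) : tadj (tadj M) = M := by
  rw [tadj, tadj]
  simp only [Matrix.transpose_neg, Matrix.transpose_mul, Matrix.transpose_transpose,
    symp_transpose]
  have : -(symp α * -(-symp α * (M * -symp β)) * symp β) =
      (symp α * symp α) * M * (symp β * symp β) := by
    simp [Matrix.mul_assoc]
  rw [this, symp_mul_symp, symp_mul_symp]
  simp

theorem tadj_add (M N : Matrix α β ℂ) : tadj (M + N) = tadj M + tadj N := by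
  simp only [tadj, Matrix.transpose_add, Matrix.mul_add, Matrix.add_mul, neg_add]

theorem tadj_smul (c : ℂ) (M : Matrix α β ℂ) : tadj (c • M) = c • tadj M := by
  simp only [tadj, Matrix.transpose_smul, Matrix.mul_smul, Matrix.smul_mul, smul_neg]

theorem tadj_one : tadj (1 : Matrix α α ℂ) = 1 := by
  rw [tadj, Matrix.transpose_one, Matrix.mul_one, symp_mul_symp, neg_neg]

theorem tadj_eq_self_iff (A : Matrix α α ℂ) : tadj A = A ↔ symp α * A = Aᵀ * symp α := by
  constructor
  · intro h
    conv_lhs => rw [← h, tadj]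
    rw [Matrix.mul_neg, Matrix.mul_assoc, ← Matrix.mul_assoc, symp_mul_symp]
    simp
  · intro h
    rw [tadj, Matrix.mul_assoc, ← h, ← Matrix.mul_assoc, symp_mul_symp]
    simp

/-- Ties the symplectic adjoint to quaternionic conjugation, which `ρ` turns into the adjugate. -/
theorem tadj_fin_two (S : Matrix (Fin 2) (Fin 2) ℂ) : tadj S = S.adjugate := by
  rw [Matrix.adjugate_fin_two, tadj, symp_fin_two, Matrix.mul_assoc]
  conv_lhs => rw [Matrix.eta_fin_two S]
  ext i j
  fin_cases i <;> fin_cases j <;>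
    simp [Matrix.mul_apply, Matrix.vecMul, dotProduct, Fin.sum_univ_two]

/-- The adjugate swaps the diagonal entries and changes the sign of the others, so only scalars are
fixed. -/
theorem eq_smul_one_of_tadj_eq_self {S : Matrix (Fin 2) (Fin 2) ℂ} (h : tadj S = S) :
    S = S 0 0 • (1 : Matrix (Fin 2) (Fin 2) ℂ) := by
  rw [tadj_fin_two, Matrix.adjugate_fin_two] at h
  have h11 := congrFun (congrFun h 0) 0
  have h01 := congrFun (congrFun h 0) 1
  have h10 := congrFun (congrFun h 1) 0
  simp at h11 h01 h10
  ext i j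
  fin_cases i <;> fin_cases j <;> simp [h11]
  · exact (neg_eq_self.1 h01)
  · exact (neg_eq_self.1 h10)

theorem tadj_mul_self (T : Matrix α (Fin 2) ℂ) :
    tadj T * T = (tadj T * T) 0 0 • (1 : Matrix (Fin 2) (Fin 2) ℂ) :=
  eq_smul_one_of_tadj_eq_self (by rw [tadj_mul, tadj_tadj])

/-- Multiplying by `L` and `tadj L` from the two sides gives the identity of size two, so the rank
cannot drop. -/
theorem rank_mul_tadj {T : Matrix α (Fin 2) ℂ} {L : Matrix (Fin 2) α ℂ} (h : L * T = 1) :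
    (T * tadj T).rank = 2 := by
  refine le_antisymm ?_ ?_
  · refine (Matrix.rank_mul_le_left T (tadj T)).trans ((Matrix.rank_le_card_width T).trans_eq ?_)
    simp
  · have h1 : L * (T * tadj T) * tadj L = 1 := by
      rw [← Matrix.mul_assoc, Matrix.mul_assoc, ← tadj_mul, h, tadj_one, Matrix.mul_one]
    have h2 : (L * (T * tadj T) * tadj L).rank = 2 := by
      rw [h1, Matrix.rank_one]
      simp
    exact h2.symm.le.trans ((Matrix.rank_mul_le_left _ _).trans (Matrix.rank_mul_le_right _ _))

/-- The columns of `U` are an orthonormal basis of the column space of `A`, and `U Uᴴ` is the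
projection onto it. -/
theorem exists_isometry_of_rank_eq_two {α : Type} [Fintype α] [DecidableEq α] {A : Matrix α α ℂ}
    (hA : A.rank = 2) :
    ∃ U : Matrix α (Fin 2) ℂ, Uᴴ * U = 1 ∧ U * (Uᴴ * A) = A := by
  let e : EuclideanSpace ℂ α ≃ₗ[ℂ] (α → ℂ) := WithLp.linearEquiv 2 ℂ (α → ℂ)
  let R : Submodule ℂ (EuclideanSpace ℂ α) :=
    (LinearMap.range A.mulVecLin).map (e.symm : (α → ℂ) →ₗ[ℂ] EuclideanSpace ℂ α)
  have hR : Module.finrank ℂ R = 2 := by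
    rw [← hA, Matrix.rank]
    exact LinearEquiv.finrank_map_eq e.symm _
  let b : OrthonormalBasis (Fin 2) ℂ R := (stdOrthonormalBasis ℂ R).reindex (finCongr hR)
  let U : Matrix α (Fin 2) ℂ := Matrix.of fun a k => (b k : EuclideanSpace ℂ α) a
  refine ⟨U, ?_, ?_⟩
  · ext k l
    have h := orthonormal_iff_ite.1 b.orthonormal k l
    rw [Submodule.coe_inner, PiLp.inner_apply] at h
    rw [Matrix.mul_apply, Matrix.one_apply, ← h]
    refine Finset.sum_congr rfl fun a _ => ?_
    simp [U, mul_comm]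
  · ext a j
    let y : R := ⟨e.symm (A.mulVecLin (Pi.single j 1)), Submodule.mem_map_of_mem ⟨_, rfl⟩⟩
    have hy : ∀ a, (y : EuclideanSpace ℂ α) a = A a j := fun a => by
      change (A.mulVecLin (Pi.single j 1)) a = A a j
      simp
    have h := congrArg (fun z : R => (z : EuclideanSpace ℂ α) a) (b.sum_repr y)
    simp only [hy] at h
    rw [← h, Matrix.mul_apply]
    rw [Submodule.coe_sum, Fin.sum_univ_two, Fin.sum_univ_two]
    have hk : ∀ k, (Uᴴ * A) k j = (b.repr y) k := by
      intro k
      rw [b.repr_apply_apply, Submodule.coe_inner, PiLp.inner_apply, Matrix.mul_apply]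
      refine Finset.sum_congr rfl fun c _ => ?_
      rw [hy]
      simp [U, mul_comm]
    rw [hk, hk]
    simp [U, mul_comm]

/-- Self-adjoint matrices of rank two factor through the twisted adjoint. -/
theorem exists_factorization {A : Matrix α α ℂ} (hA : A.rank = 2) (h : tadj A = A) :
    ∃ (T : Matrix α (Fin 2) ℂ) (c : ℝ), 0 < c ∧ A = T * tadj T ∧
      Tᴴ * T = (c : ℂ) • (1 : Matrix (Fin 2) (Fin 2) ℂ) := by
  obtain ⟨U, hU, hUA⟩ := exists_isometry_of_rank_eq_two hA
  have hU' : tadj U * tadj Uᴴ = 1 := by rw [← tadj_mul, hU, tadj_one]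
  set V := Uᴴ * A with hV
  set S := Uᴴ * tadj V with hS
  -- Self-adjointness identifies the row space of `A` with that of `U^♯`. Thus `A = U S U^♯` with
  -- `S` self-adjoint of size two, hence scalar.
  have hVS : V = S * tadj U := by
    have h1 : U * V = tadj V * tadj U := by rw [← tadj_mul, hUA, h]
    calc V = Uᴴ * U * V := by rw [hU, Matrix.one_mul]
      _ = S * tadj U := by rw [Matrix.mul_assoc, h1, hS, Matrix.mul_assoc]
  have hAS : A = U * S * tadj U := by rw [Matrix.mul_assoc, ← hVS, hUA]
  have hSS : ∀ X : Matrix (Fin 2) (Fin 2) ℂ, Uᴴ * (U * X * tadj U) * tadj Uᴴ = X := by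
    intro X
    have : Uᴴ * (U * X * tadj U) * tadj Uᴴ = (Uᴴ * U) * X * (tadj U * tadj Uᴴ) := by
      simp only [Matrix.mul_assoc]
    rw [this, hU, hU', Matrix.one_mul, Matrix.mul_one]
  have hSt : tadj S = S := by
    have h1 : A = U * tadj S * tadj U := by
      conv_lhs => rw [← h, hAS]
      rw [tadj_mul, tadj_mul, tadj_tadj, Matrix.mul_assoc]
    rw [← hSS (tadj S), ← h1, hAS, hSS]
  obtain ⟨s, hs⟩ : ∃ s : ℂ, S = s • (1 : Matrix (Fin 2) (Fin 2) ℂ) :=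
    ⟨_, eq_smul_one_of_tadj_eq_self hSt⟩
  -- A square root of the scalar is absorbed into `T = z U`; this keeps `Tᴴ T` scalar, equal to
  -- `|z|²`.
  obtain ⟨z, hz⟩ := IsAlgClosed.exists_eq_mul_self s
  have hz0 : z ≠ 0 := by
    rintro rfl
    rw [hAS, hs, hz] at hA
    simp at hA
  refine ⟨z • U, ‖z‖ ^ 2, by positivity, ?_, ?_⟩
  · rw [hAS, hs, hz, tadj_smul]
    simp [smul_smul]
  · rw [Matrix.conjTranspose_smul, Matrix.smul_mul, Matrix.mul_smul, hU, smul_smul]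
    congr 1
    rw [← Complex.normSq_eq_norm_sq, Complex.normSq_eq_conj_mul_self]
    rfl

/-- The self-adjoint matrices of rank two and square zero. -/
def nilpotentRankTwo (α : Type) [Fintype α] [DecidableEq α] [SymplecticIndex α] :
    Set (Matrix α α ℂ) :=
  {A | tadj A = A ∧ A.rank = 2 ∧ A * A = 0}

theorem mul_tadj_mem_nilpotentRankTwo {T : Matrix α (Fin 2) ℂ} {L : Matrix (Fin 2) α ℂ}
    (h : L * T = 1) (hT : tadj T * T = 0) : T * tadj T ∈ nilpotentRankTwo α := by
  refine ⟨by rw [tadj_mul, tadj_tadj], rank_mul_tadj h, ?_⟩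
  rw [Matrix.mul_assoc, ← Matrix.mul_assoc (tadj T), hT]
  simp

/-- The scalar matrix `T^♯ T = s` gives `A² = s A`; since `A² = 0` and `A ≠ 0`, `s` vanishes. -/
theorem exists_factorization_of_mem {A : Matrix α α ℂ} (hA : A ∈ nilpotentRankTwo α) :
    ∃ (T : Matrix α (Fin 2) ℂ) (c : ℝ), 0 < c ∧ A = T * tadj T ∧
      Tᴴ * T = (c : ℂ) • (1 : Matrix (Fin 2) (Fin 2) ℂ) ∧ tadj T * T = 0 := by
  obtain ⟨T, c, hc, hT, h⟩ := exists_factorization hA.2.1 hA.1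
  refine ⟨T, c, hc, hT, h, ?_⟩
  obtain ⟨s, hs⟩ : ∃ s : ℂ, tadj T * T = s • (1 : Matrix (Fin 2) (Fin 2) ℂ) :=
    ⟨_, tadj_mul_self T⟩
  have h2 : A * A = s • A := by
    rw [hT, Matrix.mul_assoc, ← Matrix.mul_assoc (tadj T), hs]
    simp
  have hA0 : A ≠ 0 := fun h0 => by simpa [h0] using hA.2.1
  rw [hA.2.2] at h2
  rw [hs, (smul_eq_zero.1 h2.symm).resolve_right hA0, zero_smul]

/-! ### The square-zero self-adjoint matrices of rank two as a complex submanifold -/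

theorem LinearMap.contDiff_of_finiteDimensional {𝕜 V W : Type} [RCLike 𝕜] [NormedAddCommGroup V]
    [NormedSpace 𝕜 V] [FiniteDimensional 𝕜 V] [NormedAddCommGroup W] [NormedSpace 𝕜 W]
    (f : V →ₗ[𝕜] W) : ContDiff 𝕜 ∞ f :=
  (LinearMap.toContinuousLinearMap f).contDiff

theorem LinearMap.contDiff_quadratic {𝕜 V W : Type} [RCLike 𝕜] [NormedAddCommGroup V]
    [NormedSpace 𝕜 V] [FiniteDimensional 𝕜 V] [NormedAddCommGroup W] [NormedSpace 𝕜 W]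
    (b : V →ₗ[𝕜] V →ₗ[𝕜] W) : ContDiff 𝕜 ∞ fun x => b x x :=
  contDiff_bilinear_self b.toContinuousBilinearMap

/-- The zero set of a quadratic map is a submanifold at its regular points. -/
theorem hasParam_of_quadratic_map {𝕜 V W : Type} [RCLike 𝕜] [NormedAddCommGroup V]
    [NormedSpace 𝕜 V] [FiniteDimensional 𝕜 V] [NormedAddCommGroup W] [NormedSpace 𝕜 W]
    [FiniteDimensional 𝕜 W] (f : V →ₗ[𝕜] W) (b : V →ₗ[𝕜] V →ₗ[𝕜] W) {d : ℕ} {x : V}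
    (hx : f x + b x x = 0) (hsurj : ∀ w, ∃ v, f v + (b x v + b v x) = w)
    (hd : Module.finrank 𝕜 V = d + Module.finrank 𝕜 W) :
    HasParam 𝕜 d {y | f y + b y y = 0} x := by
  refine hasParam_of_regular (F := fun y => f y + b y y) hx
    ((LinearMap.contDiff_of_finiteDimensional f).add
      (LinearMap.contDiff_quadratic b) |>.smoothNear x) (fun w => ?_) hd (by simp)
  obtain ⟨v, hv⟩ := hsurj w
  refine ⟨v, ?_⟩
  have h := (LinearMap.toContinuousLinearMap f).hasFDerivAt.add
    (hasFDerivAt_bilinear_self b.toContinuousBilinearMap x)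
  rw [show fderiv 𝕜 (fun y => f y + b y y) x = _ from h.fderiv]
  exact hv

/-- `T T^♯` does not change when `T` is multiplied on the right by a matrix of determinant one. A
slice is obtained by fixing `M₀` with `T₀^♯ M₀ = 1` and requiring `T^♯ M₀` to be a scalar `λ(T)`. On
the slice, with `T^♯ T = 0` imposed, `T ↦ λ(T)⁻¹ T T^♯` is inverse to `A ↦ A M₀`. The conditions
amount to four equations in `2 |α|` unknowns. -/
theorem hasParam_nilpotentRankTwo {d : ℕ} (hd : Fintype.card α * 2 = d + 4) {A₀ : Matrix α α ℂ}
    (hA₀ : A₀ ∈ nilpotentRankTwo α) : HasParam ℂ d (nilpotentRankTwo α) A₀ := by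
  obtain ⟨T₀, c, hc, hT₀, hT₀c, hT₀0⟩ := exists_factorization_of_mem hA₀
  have hc' : (c : ℂ) ≠ 0 := by exact_mod_cast hc.ne'
  obtain ⟨M₀, hM₀⟩ : ∃ M₀ : Matrix α (Fin 2) ℂ, tadj T₀ * M₀ = 1 :=
    ⟨tadj ((c : ℂ)⁻¹ • T₀ᴴ), by
      rw [← tadj_mul, Matrix.smul_mul, hT₀c, smul_smul, inv_mul_cancel₀ hc', one_smul, tadj_one]⟩
  have hM₀' : tadj M₀ * T₀ = 1 := by
    rw [← tadj_tadj T₀, ← tadj_mul, hM₀, tadj_one]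
  let lam : Matrix α (Fin 2) ℂ →ₗ[ℂ] ℂ :=
    { toFun := fun T => (1 / 2 : ℂ) * (tadj T * M₀).trace
      map_add' := fun S T => by
        simp only [tadj_add, Matrix.add_mul, Matrix.trace_add]; ring
      map_smul' := fun r T => by
        simp only [tadj_smul, Matrix.smul_mul, Matrix.trace_smul, smul_eq_mul, RingHom.id_apply]
        ring }
  have hlam : ∀ T, lam T = (1 / 2 : ℂ) * (tadj T * M₀).trace := fun _ => rfl
  let f : Matrix α (Fin 2) ℂ →ₗ[ℂ] Matrix (Fin 2) (Fin 2) ℂ :=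
    { toFun := fun T => tadj T * M₀ - lam T • (1 : Matrix (Fin 2) (Fin 2) ℂ)
      map_add' := fun S T => by
        simp only [tadj_add, Matrix.add_mul, map_add, add_smul]; abel
      map_smul' := fun r T => by
        simp only [tadj_smul, Matrix.smul_mul, map_smul, smul_sub, smul_smul, smul_eq_mul,
          RingHom.id_apply] }
  have hf : ∀ T, f T = tadj T * M₀ - lam T • (1 : Matrix (Fin 2) (Fin 2) ℂ) := fun _ => rfl
  let b : Matrix α (Fin 2) ℂ →ₗ[ℂ] Matrix α (Fin 2) ℂ →ₗ[ℂ] Matrix (Fin 2) (Fin 2) ℂ :=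
    LinearMap.mk₂ ℂ (fun S T => tadj S * T)
      (fun _ _ _ => by rw [tadj_add, Matrix.add_mul])
      (fun _ _ _ => by rw [tadj_smul, Matrix.smul_mul])
      (fun _ _ _ => Matrix.mul_add _ _ _) (fun _ _ _ => Matrix.mul_smul _ _ _)
  have hb : ∀ S T, b S T = tadj S * T := fun _ _ => rfl
  let g₂ : Matrix α (Fin 2) ℂ →ₗ[ℂ] Matrix α (Fin 2) ℂ →ₗ[ℂ] Matrix α α ℂ :=
    LinearMap.mk₂ ℂ (fun S T => S * tadj T)
      (fun _ _ _ => Matrix.add_mul _ _ _) (fun _ _ _ => Matrix.smul_mul _ _ _)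
      (fun _ _ _ => by rw [tadj_add, Matrix.mul_add])
      (fun _ _ _ => by rw [tadj_smul, Matrix.mul_smul])
  let r : Matrix α α ℂ →ₗ[ℂ] Matrix α (Fin 2) ℂ :=
    { toFun := fun A => A * M₀
      map_add' := fun _ _ => Matrix.add_mul _ _ _
      map_smul' := fun _ _ => Matrix.smul_mul _ _ _ }
  have hr : ∀ A, r A = A * M₀ := fun _ => rfl
  let g : Matrix α (Fin 2) ℂ → Matrix α α ℂ := fun T => (lam T)⁻¹ • g₂ T T
  have hg : ∀ T, g T = (lam T)⁻¹ • (T * tadj T) := fun _ => rfl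
  have hscalar : ∀ z : ℂ, ∀ T, tadj T * M₀ = z • (1 : Matrix (Fin 2) (Fin 2) ℂ) → lam T = z := by
    intro z T h
    rw [hlam, h, Matrix.trace_smul, Matrix.trace_one]
    simp
    ring
  have hlam₀ : lam T₀ = 1 := hscalar 1 T₀ (by rw [hM₀, one_smul])
  have hr₀ : r A₀ = T₀ := by rw [hr, hT₀, Matrix.mul_assoc, hM₀, Matrix.mul_one]
  have hg₀ : g T₀ = A₀ := by rw [hg, hlam₀, hT₀]; simp
  -- Two conditions in one matrix equation: `f T` is trace-free, whereas `b T T = T^♯ T` is scalar,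
  -- so taking the trace separates them.
  have hzero : ∀ T, f T + b T T = 0 ↔
      tadj T * M₀ = lam T • (1 : Matrix (Fin 2) (Fin 2) ℂ) ∧ tadj T * T = 0 := by
    intro T
    rw [hf, hb]
    constructor
    · intro h
      have ht := congrArg Matrix.trace h
      have hs := tadj_mul_self T
      rw [Matrix.trace_add, Matrix.trace_sub, Matrix.trace_smul, Matrix.trace_one, hlam, hs,
        Matrix.trace_smul, Matrix.trace_one] at ht
      simp at ht
      have h0 : tadj T * T = 0 := by
        rw [hs, show (tadj T * T) 0 0 = 0 by linear_combination (1 / 2 : ℂ) * ht, zero_smul]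
      rw [h0, add_zero, sub_eq_zero] at h
      exact ⟨h, h0⟩
    · rintro ⟨h1, h2⟩
      rw [h1, h2, sub_self, add_zero]
  have hN : HasParam ℂ d {T | f T + b T T = 0} T₀ := by
    refine hasParam_of_quadratic_map f b ((hzero T₀).2 ⟨?_, hT₀0⟩) (fun C => ?_) ?_
    · rw [hlam₀, hM₀, one_smul]
    -- The first summand solves `v^♯ M₀ = C`, giving the trace-free part of `C`. The correction does
    -- not change `v^♯ M₀`, and its pairings with `T₀` on the two sides add up to the missing scalar
    -- `tr C / 2`.
    · refine ⟨T₀ * tadj C + (C.trace / 4) • (M₀ - T₀ * tadj (tadj M₀ * M₀)), ?_⟩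
      have e1 : tadj (T₀ * tadj C + (C.trace / 4) • (M₀ - T₀ * tadj (tadj M₀ * M₀))) * M₀ = C := by
        rw [sub_eq_add_neg, ← neg_one_smul ℂ (T₀ * _), tadj_add, tadj_smul, tadj_add, tadj_smul,
          tadj_mul, tadj_mul, tadj_tadj, tadj_tadj, Matrix.add_mul, Matrix.smul_mul,
          Matrix.add_mul, Matrix.smul_mul, Matrix.mul_assoc, Matrix.mul_assoc _ (tadj T₀), hM₀]
        simp
      have e2 : tadj T₀ * (T₀ * tadj C + (C.trace / 4) • (M₀ - T₀ * tadj (tadj M₀ * M₀))) =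
          (C.trace / 4) • (1 : Matrix (Fin 2) (Fin 2) ℂ) := by
        rw [Matrix.mul_add, Matrix.mul_smul, Matrix.mul_sub, ← Matrix.mul_assoc,
          ← Matrix.mul_assoc, hT₀0, hM₀]
        simp
      have e3 : tadj (T₀ * tadj C + (C.trace / 4) • (M₀ - T₀ * tadj (tadj M₀ * M₀))) * T₀ =
          (C.trace / 4) • (1 : Matrix (Fin 2) (Fin 2) ℂ) := by
        rw [← tadj_tadj T₀, ← tadj_mul, tadj_tadj, e2, tadj_smul, tadj_one]
      rw [hf, hb, hb, hlam, e1, e2, e3, ← add_smul, sub_add, ← sub_smul,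
        show (1 / 2 * C.trace - (C.trace / 4 + C.trace / 4) : ℂ) = 0 by ring, zero_smul, sub_zero]
    · rw [Module.finrank_matrix, Module.finrank_matrix]
      simpa using hd
  have hlamne : ∀ᶠ T in 𝓝 T₀, lam T ≠ 0 := by
    have : ContinuousAt lam T₀ :=
      (LinearMap.contDiff_of_finiteDimensional lam).continuous.continuousAt
    exact this.eventually (isOpen_ne.mem_nhds (by rw [hlam₀]; exact one_ne_zero))
  have hgs : SmoothNear ℂ g T₀ := by
    filter_upwards [hlamne] with T hT
    exact ((LinearMap.contDiff_of_finiteDimensional lam).contDiffAt.inv hT).smul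
      (LinearMap.contDiff_quadratic g₂).contDiffAt
  have hrs := (LinearMap.contDiff_of_finiteDimensional r).smoothNear A₀
  refine HasParam.transport (N := {T | f T + b T T = 0}) r g (by rw [hr₀]; exact hN) hrs
    (by rw [hr₀]; exact hgs) (by rw [hr₀, hg₀]) ?_ ?_
  · have hcont := hrs.continuousAt
    rw [ContinuousAt, hr₀] at hcont
    filter_upwards [hcont.eventually hlamne] with A hA hAN
    obtain ⟨T, c', hc', hT, -, hT0⟩ := exists_factorization_of_mem hAN
    -- For any factorisation `A = T T^♯` one has `A M₀ = T G`, and `G^♯ G = G G^♯ = det G`. So `A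
    -- M₀` lies on the slice with `λ = det G`, whichever `T` was chosen.
    set G := tadj T * M₀ with hG
    have hrA : r A = T * G := by rw [hr, hT, Matrix.mul_assoc]
    have hdet : ∀ z : ℂ, G * tadj G = z • (1 : Matrix (Fin 2) (Fin 2) ℂ) ∧
        tadj G * G = z • (1 : Matrix (Fin 2) (Fin 2) ℂ) → lam (r A) = z := by
      intro z hz
      refine hscalar z _ ?_
      rw [hrA, tadj_mul, Matrix.mul_assoc, ← hG, hz.2]
    have hz : G * tadj G = G.det • (1 : Matrix (Fin 2) (Fin 2) ℂ) ∧
        tadj G * G = G.det • (1 : Matrix (Fin 2) (Fin 2) ℂ) := by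
      rw [tadj_fin_two, Matrix.mul_adjugate, Matrix.adjugate_mul]
      exact ⟨rfl, rfl⟩
    have hl := hdet _ hz
    refine ⟨(hzero _).2 ⟨?_, ?_⟩, ?_⟩
    · rw [hl, hrA, tadj_mul, Matrix.mul_assoc, ← hG, hz.2]
    · rw [hrA, tadj_mul, Matrix.mul_assoc, ← Matrix.mul_assoc (tadj T), hT0]
      simp
    · rw [hg, hl, hrA, tadj_mul, Matrix.mul_assoc, ← Matrix.mul_assoc G, hz.1, Matrix.smul_mul,
        Matrix.one_mul, Matrix.mul_smul, smul_smul, inv_mul_cancel₀ (hl ▸ hA), one_smul, hT]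
  · rw [hr₀]
    filter_upwards [hlamne] with T hT hTN
    obtain ⟨h1, h2⟩ := (hzero T).1 hTN
    have h3 : tadj M₀ * T = lam T • (1 : Matrix (Fin 2) (Fin 2) ℂ) := by
      rw [← tadj_tadj T, ← tadj_mul, tadj_tadj, h1, tadj_smul, tadj_one]
    refine ⟨?_, ?_⟩
    · have hL : ((lam T)⁻¹ • tadj M₀) * T = 1 := by
        rw [Matrix.smul_mul, h3, smul_smul, inv_mul_cancel₀ hT, one_smul]
      obtain ⟨k1, k2, k3⟩ := mul_tadj_mem_nilpotentRankTwo hL h2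
      rw [hg]
      refine ⟨by rw [tadj_smul, k1], ?_, by rw [Matrix.smul_mul, Matrix.mul_smul, k3]; simp⟩
      -- A square root of `λ(T)⁻¹` turns the rescaled product into `(zT)(zT)^♯`, to which the rank
      -- lemma applies.
      obtain ⟨z, hz⟩ := IsAlgClosed.exists_eq_mul_self (lam T)⁻¹
      have hz0 : z ≠ 0 := by
        rintro rfl
        simp at hz
        exact hT hz
      rw [show (lam T)⁻¹ • (T * tadj T) = (z • T) * tadj (z • T) by
        rw [tadj_smul, hz]; simp [smul_smul]]
      refine rank_mul_tadj (L := z⁻¹ • ((lam T)⁻¹ • tadj M₀)) ?_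
      rw [Matrix.smul_mul, Matrix.mul_smul, hL, smul_smul, inv_mul_cancel₀ hz0, one_smul]
    · rw [hr, hg, Matrix.smul_mul, Matrix.mul_assoc, h1, Matrix.mul_smul, smul_smul,
        inv_mul_cancel₀ hT, one_smul, Matrix.mul_one]

end TwistedAdjoint

/-! ### Rank one matrices over the quaternions -/

section Outer

variable {n : ℕ}

/-- The matrix `(a_i θ(b_j))`. -/
def outer (a b : HVec n) : HMat n := Matrix.of fun i j => a i * star (b j)

theorem hopf_eq_outer (p : HVec n) : hopf p = outer p p := rfl

theorem hopfDiff_eq_outer (p q : HVec n) : hopfDiff p q = outer p q + outer q p := rfl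

theorem outer_mul_outer (a b c d : HVec n) :
    outer a b * outer c d = outer (fun i => a i * hinner b c) d := by
  ext1 i j
  simp only [Matrix.mul_apply, outer, Matrix.of_apply, hinner, Finset.mul_sum, Finset.sum_mul,
    mul_assoc]

theorem outer_zero_left (b : HVec n) : outer (0 : HVec n) b = 0 := by
  ext1 i j
  simp [outer]

theorem outer_zero_right (b : HVec n) : outer b (0 : HVec n) = 0 := by
  ext1 i j
  simp [outer]

theorem outer_mul_outer_of_real {b c : HVec n} {r : ℝ} (h : hinner b c = r) (a d : HVec n) :
    outer a b * outer c d = r • outer a d := by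
  rw [outer_mul_outer, h]
  ext1 i j
  simp only [outer, Matrix.of_apply, Matrix.smul_apply, Quaternion.mul_coe_eq_smul,
    smul_mul_assoc]

theorem outer_smul_smul (r s : ℝ) (a b : HVec n) : outer (r • a) (s • b) = (r * s) • outer a b := by
  ext1 i j
  simp only [outer, Matrix.of_apply, Matrix.smul_apply, Pi.smul_apply, Quaternion.star_smul,
    smul_mul_smul_comm]

theorem conjTranspose_outer (a b : HVec n) : (outer a b)ᴴ = outer b a := by
  ext1 i j
  simp [outer]

theorem outer_mulVec (a b c : HVec n) : outer a b *ᵥ c = fun i => a i * hinner b c := by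
  funext i
  simp only [Matrix.mulVec, dotProduct, outer, Matrix.of_apply, hinner, Finset.mul_sum, mul_assoc]

theorem mul_outer (X : HMat n) (a b : HVec n) : X * outer a b = outer (X *ᵥ a) b := by
  ext1 i j
  simp only [Matrix.mul_apply, outer, Matrix.of_apply, Matrix.mulVec, dotProduct, Finset.sum_mul,
    mul_assoc]

theorem outer_mul (X : HMat n) (a b : HVec n) : outer a b * X = outer a (Xᴴ *ᵥ b) := by
  rw [← Matrix.conjTranspose_conjTranspose (outer a b * X), Matrix.conjTranspose_mul,
    conjTranspose_outer, mul_outer, conjTranspose_outer]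

theorem isHermitian_hopf (p : HVec n) : (hopf p).IsHermitian := conjTranspose_outer p p

theorem isHermitian_hopfDiff (p q : HVec n) : (hopfDiff p q).IsHermitian := by
  rw [Matrix.IsHermitian, hopfDiff_eq_outer, Matrix.conjTranspose_add, conjTranspose_outer,
    conjTranspose_outer]
  exact add_comm _ _

theorem hinner_comm_zero {p q : HVec n} (h : hinner p q = 0) : hinner q p = 0 := by
  rw [← hinner_star, h, star_zero]

theorem hopf_mul_self {p : HVec n} (hp : einner p p = 1) : hopf p * hopf p = hopf p := by
  rw [hopf_eq_outer, outer_mul_outer_of_real (r := 1) (by rw [hinner_self, hp]), one_smul]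

theorem hopfDiff_mulVec {p q : HVec n} (hp : einner p p = 1) (hpq : hinner p q = 0) :
    hopfDiff p q *ᵥ p = q := by
  rw [hopfDiff_eq_outer, Matrix.add_mulVec, outer_mulVec, outer_mulVec, hinner_self, hp,
    hinner_comm_zero hpq]
  funext i
  simp

theorem jordan_hopf_hopfDiff {p q : HVec n} (hp : einner p p = 1) (hpq : hinner p q = 0) :
    jordan (hopf p) (hopfDiff p q) = (1 / 2 : ℝ) • hopfDiff p q := by
  have h1 : hinner p p = ((1 : ℝ) : ℍ[ℝ]) := by rw [hinner_self, hp]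
  have h0 : hinner p q = ((0 : ℝ) : ℍ[ℝ]) := by rw [hpq]; rfl
  have h0' : hinner q p = ((0 : ℝ) : ℍ[ℝ]) := by rw [hinner_comm_zero hpq]; rfl
  rw [jordan, hopf_eq_outer, hopfDiff_eq_outer, mul_add, add_mul, outer_mul_outer_of_real h1,
    outer_mul_outer_of_real h0, outer_mul_outer_of_real h0', outer_mul_outer_of_real h1]
  simp

theorem hopfDiff_mul_self {p q : HVec n} (hp : einner p p = 1) (hpq : hinner p q = 0) :
    hopfDiff p q * hopfDiff p q = einner q q • hopf p + hopf q := by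
  have h1 : hinner p p = ((1 : ℝ) : ℍ[ℝ]) := by rw [hinner_self, hp]
  have h0 : hinner p q = ((0 : ℝ) : ℍ[ℝ]) := by rw [hpq]; rfl
  have h0' : hinner q p = ((0 : ℝ) : ℍ[ℝ]) := by rw [hinner_comm_zero hpq]; rfl
  rw [hopf_eq_outer, hopfDiff_eq_outer, mul_add, add_mul, add_mul, outer_mul_outer_of_real h1,
    outer_mul_outer_of_real h0, outer_mul_outer_of_real h0',
    outer_mul_outer_of_real (hinner_self q)]
  simp [hopf_eq_outer, add_comm]

/-- Put `q = Q p`. The Jordan equation, with `P = p p*` and `Q` Hermitian, reads `Q = q p* + p q*`;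
applying it to `p` gives `p (q, p)_ℍ = 0`, so `q` is horizontal. -/
theorem exists_of_mem_spaceEH {x : HMat n × HMat n} (hx : x.1 ∈ quatProj n)
    (hQ : x.2.IsHermitian) (hj : jordan x.1 x.2 = (1 / 2 : ℝ) • x.2) :
    ∃ p q : HVec n, einner p p = 1 ∧ hinner p q = 0 ∧ x = (hopf p, hopfDiff p q) := by
  obtain ⟨P, Q⟩ := x
  obtain ⟨p, hp, rfl : P = hopf p⟩ := hx
  replace hQ : Qᴴ = Q := hQ
  have hj' : hopf p * Q + Q * hopf p = Q := by
    have := congrArg (fun X : HMat n => (2 : ℝ) • X) hj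
    simpa [jordan, smul_smul] using this
  have e : Q = hopfDiff p (Q *ᵥ p) := by
    rw [hopfDiff_eq_outer]
    rw [hopf_eq_outer, outer_mul, mul_outer, hQ] at hj'
    exact hj'.symm
  refine ⟨p, Q *ᵥ p, hp, ?_, Prod.ext rfl e⟩
  have h1 : Q *ᵥ p = fun i => p i * hinner (Q *ᵥ p) p + (Q *ᵥ p) i := by
    conv_lhs => rw [e, hopfDiff_eq_outer, Matrix.add_mulVec, outer_mulVec, outer_mulVec,
      hinner_self, hp]
    funext i
    simp
  have h2 : ∀ i, p i * hinner (Q *ᵥ p) p = 0 := fun i => by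
    simpa using (congrFun h1 i).symm
  have h3 : hinner p p * hinner (Q *ᵥ p) p = 0 := by
    rw [hinner, Finset.sum_mul]
    exact Finset.sum_eq_zero fun i _ => by rw [mul_assoc, h2, mul_zero]
  rw [hinner_self, hp, Quaternion.coe_one, one_mul] at h3
  exact hinner_comm_zero h3

theorem mem_spaceEH_iff {x : HMat n × HMat n} : x ∈ spaceEH n ↔
    ∃ p q : HVec n, einner p p = 1 ∧ hinner p q = 0 ∧ q ≠ 0 ∧ x = (hopf p, hopfDiff p q) := by
  constructor
  · rintro ⟨h1, h2, h3, h4⟩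
    obtain ⟨p, q, hp, hpq, rfl⟩ := exists_of_mem_spaceEH h1 h2 h3
    refine ⟨p, q, hp, hpq, ?_, rfl⟩
    rintro rfl
    exact h4 (by simp [hopfDiff_eq_outer, outer_zero_left, outer_zero_right])
  · rintro ⟨p, q, hp, hpq, hq, rfl⟩
    refine ⟨⟨p, hp, rfl⟩, isHermitian_hopfDiff p q, jordan_hopf_hopfDiff hp hpq, fun h => hq ?_⟩
    rw [← hopfDiff_mulVec hp hpq, show hopfDiff p q = 0 from h, Matrix.zero_mulVec]

end Outer

/-! ### The trace form -/

section TraceForm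

variable {n : ℕ}

/-- Quaternions do not commute, so the trace itself is not cyclic; only its real part is. -/
theorem re_trace_mul_comm (X Y : HMat n) : (X * Y).trace.re = (Y * X).trace.re := by
  simp only [Matrix.trace, Matrix.diag, Matrix.mul_apply, re_sum]
  rw [Finset.sum_comm]
  refine Finset.sum_congr rfl fun i _ => Finset.sum_congr rfl fun j _ => ?_
  simp
  ring

theorem minner_eq (X Y : HMat n) : minner X Y = (X * Y).trace.re := by
  rw [minner, jordan, Matrix.trace_smul, Matrix.trace_add, Quaternion.re_smul, Quaternion.re_add,
    re_trace_mul_comm Y X, smul_eq_mul]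
  ring

theorem minner_comm (X Y : HMat n) : minner X Y = minner Y X := by
  rw [minner_eq, minner_eq, re_trace_mul_comm]

theorem minner_mul_left (X Y Z : HMat n) : minner (X * Y) Z = minner X (Y * Z) := by
  rw [minner_eq, minner_eq, Matrix.mul_assoc]

/-- The trace form as a continuous bilinear map. -/
def minnerL (n : ℕ) : HMat n →L[ℝ] HMat n →L[ℝ] ℝ :=
  (LinearMap.mk₂ ℝ minner
    (fun a b c => by
      simp only [minner_eq, Matrix.add_mul, Matrix.trace_add, Quaternion.re_add])
    (fun r a b => by
      simp only [minner_eq, Matrix.smul_mul, Matrix.trace_smul, Quaternion.re_smul, smul_eq_mul])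
    (fun a b c => by
      simp only [minner_eq, Matrix.mul_add, Matrix.trace_add, Quaternion.re_add])
    (fun r a b => by
      simp only [minner_eq, Matrix.mul_smul, Matrix.trace_smul, Quaternion.re_smul,
        smul_eq_mul])).toContinuousBilinearMap

theorem minner_smul_left (c : ℝ) (X Y : HMat n) : minner (c • X) Y = c * minner X Y := by
  simp only [minner_eq, Matrix.smul_mul, Matrix.trace_smul, Quaternion.re_smul, smul_eq_mul]

theorem minner_smul_right (c : ℝ) (X Y : HMat n) : minner X (c • Y) = c * minner X Y := by
  rw [minner_comm, minner_smul_left, minner_comm]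

theorem minner_add_left (X Y Z : HMat n) : minner (X + Y) Z = minner X Z + minner Y Z := by
  simp only [minner_eq, Matrix.add_mul, Matrix.trace_add, Quaternion.re_add]

theorem minner_add_right (X Y Z : HMat n) : minner X (Y + Z) = minner X Y + minner X Z := by
  rw [minner_comm, minner_add_left, minner_comm Y, minner_comm Z]

theorem minner_sub_left (X Y Z : HMat n) : minner (X - Y) Z = minner X Z - minner Y Z := by
  rw [sub_eq_add_neg, ← neg_one_smul ℝ Y, minner_add_left, minner_smul_left]
  ring

theorem minner_sub_right (X Y Z : HMat n) : minner X (Y - Z) = minner X Y - minner X Z := by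
  rw [minner_comm, minner_sub_left, minner_comm Y, minner_comm Z]

theorem minner_outer (a b c d : HVec n) :
    minner (outer a b) (outer c d) = (hinner d a * hinner b c).re := by
  rw [minner_eq, outer_mul_outer, Matrix.trace, show hinner d a = ∑ i, star (d i) * a i from rfl,
    Finset.sum_mul, re_sum, re_sum]
  refine Finset.sum_congr rfl fun i _ => ?_
  have hre : ∀ a b : ℍ[ℝ], (a * b).re = (b * a).re := by
    intro a b; simp; ring
  simp only [Matrix.diag, outer, Matrix.of_apply]
  rw [hre, mul_assoc]

/-- Hermitian symmetry of one factor turns the trace form into the Euclidean product of the entries.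
-/
theorem minner_eq_sum {X : HMat n} (hX : X.IsHermitian) (Y : HMat n) :
    minner X Y = ∑ i, ∑ j, (star (X i j) * Y i j).re := by
  have hX' : ∀ i j, star (X i j) = X j i := fun i j => congrFun (congrFun hX j) i
  rw [minner_eq, Matrix.trace, re_sum, Finset.sum_comm]
  refine Finset.sum_congr rfl fun i _ => ?_
  rw [Matrix.diag, Matrix.mul_apply, re_sum]
  exact Finset.sum_congr rfl fun j _ => by rw [hX']

/-! ### The trace form on images of horizontal vectors -/

section Horizontal

variable {p q : HVec n}

theorem minner_hopf_hopfDiff (hpq : hinner p q = 0) :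
    minner (hopf p) (hopfDiff p q) = 0 := by
  rw [hopf_eq_outer, hopfDiff_eq_outer, minner_add_right, minner_outer, minner_outer,
    hinner_comm_zero hpq, hpq]
  simp

theorem minner_hopfDiff_self (hp : einner p p = 1) (hpq : hinner p q = 0) :
    minner (hopfDiff p q) (hopfDiff p q) = 2 * einner q q := by
  rw [hopfDiff_eq_outer]
  simp only [minner_add_left, minner_add_right, minner_outer, hinner_comm_zero hpq, hpq,
    hinner_self, hp]
  simp
  ring

theorem minner_hopf_right_hopfDiff (hpq : hinner p q = 0) :
    minner (hopf q) (hopfDiff p q) = 0 := by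
  rw [hopf_eq_outer, hopfDiff_eq_outer, minner_add_right, minner_outer, minner_outer,
    hinner_comm_zero hpq, hpq]
  simp

/-- `Q²` is block diagonal for the splitting into the line of `p` and its complement, while `Q` is
off-diagonal; so the real trace of `Q³` vanishes. -/
theorem minner_sq_hopfDiff (hp : einner p p = 1) (hpq : hinner p q = 0) :
    minner (hopfDiff p q * hopfDiff p q) (hopfDiff p q) = 0 := by
  rw [hopfDiff_mul_self hp hpq, minner_add_left, minner_smul_left, minner_hopf_hopfDiff hpq,
    minner_hopf_right_hopfDiff hpq]
  simp

theorem mnorm_hopfDiff_sq (hp : einner p p = 1) (hpq : hinner p q = 0) :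
    mnorm (hopfDiff p q) ^ 2 = 2 * einner q q := by
  rw [mnorm, Real.sq_sqrt, minner_hopfDiff_self hp hpq]
  rw [minner_hopfDiff_self hp hpq]
  exact mul_nonneg zero_le_two (einner_self_nonneg q)

theorem mnorm_hopfDiff (hp : einner p p = 1) (hpq : hinner p q = 0) :
    mnorm (hopfDiff p q) = √2 * vnorm q := by
  rw [mnorm, minner_hopfDiff_self hp hpq, Real.sqrt_mul zero_le_two, vnorm]

theorem minner_real_part (hp : einner p p = 1) (hpq : hinner p q = 0) :
    minner (einner q q • hopf p - hopf q) (einner q q • hopf p - hopf q) =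
    2 * einner q q ^ 2 := by
  simp only [hopf_eq_outer, minner_sub_left, minner_sub_right, minner_smul_left,
    minner_smul_right, minner_outer, hinner_comm_zero hpq, hpq, hinner_self, hp]
  simp
  ring

end Horizontal

end TraceForm

/-! ### Tall matrices and the complexification of quaternionic matrices -/

section Complexification

variable {n : ℕ}

/-- The `(2n+2) × 2` matrix formed by a tuple. -/
def tall (B : CTuple n) : Matrix (Fin (n + 1) × Fin 2) (Fin 2) ℂ :=
  Matrix.of fun a k => B a.1 a.2 k

theorem exists_tall (T : Matrix (Fin (n + 1) × Fin 2) (Fin 2) ℂ) : ∃ a b : HVec n,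
    T = tall (complexifyVec n (a, b)) := by
  let B : CTuple n := fun i => Matrix.of fun a k => T (i, a) k
  refine ⟨(realPartsVec n B).1, (realPartsVec n B).2, ?_⟩
  rw [Prod.mk.eta, complexifyVec_realPartsVec]
  rfl

theorem tadj_tall (B : CTuple n) (k : Fin 2) (a : Fin (n + 1) × Fin 2) :
    tadj (tall B) k a = (B a.1).adjugate k a.2 := by
  obtain ⟨j, b⟩ := a
  rw [← tadj_fin_two, tadj, tadj, Matrix.neg_apply, Matrix.neg_apply, Matrix.mul_apply,
    Fintype.sum_prod_type, Finset.sum_eq_single j, Matrix.mul_apply]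
  · congr 1
    refine Finset.sum_congr rfl fun c _ => ?_
    congr 1
    exact if_pos rfl
  · intro i _ hi
    refine Finset.sum_eq_zero fun c _ => ?_
    rw [show symp (Fin (n + 1) × Fin 2) (i, c) (j, b) = 0 from if_neg hi, mul_zero]
  · simp

/-- Blockwise this is `∑ adj(B_i) B_i`. The quadric cone of the sphere is therefore the equation
`T^♯ T = 0`. -/
theorem tadj_tall_mul_tall (B : CTuple n) :
    tadj (tall B) * tall B = (∑ i, (B i).det) • (1 : Matrix (Fin 2) (Fin 2) ℂ) := by
  ext k l
  rw [Matrix.mul_apply, Fintype.sum_prod_type, Finset.sum_smul, Matrix.sum_apply]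
  refine Finset.sum_congr rfl fun i _ => ?_
  rw [← Matrix.adjugate_mul, Matrix.mul_apply]
  exact Finset.sum_congr rfl fun a _ => by rw [tadj_tall]; rfl

theorem tall_mul_tadj_tall_apply (B : CTuple n) (a b : Fin (n + 1) × Fin 2) :
    (tall B * tadj (tall B)) a b = (B a.1 * (B b.1).adjugate) a.2 b.2 := by
  rw [Matrix.mul_apply, Matrix.mul_apply]
  exact Finset.sum_congr rfl fun k _ => by rw [tadj_tall]; rfl

theorem adjugate_rho_add (a b : ℍ[ℝ]) :
    (rho a + Complex.I • rho b).adjugate = rho (star a) + Complex.I • rho (star b) := by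
  rw [adjugate_add_fin_two, adjugate_smul_fin_two, rho_star_eq_adjugate, rho_star_eq_adjugate]

theorem rho_sub (a b : ℍ[ℝ]) : rho (a - b) = rho a - rho b :=
  (AddMonoidHom.mk' rho rho_add).map_sub a b

theorem rho_sum {ι : Type*} (s : Finset ι) (f : ι → ℍ[ℝ]) :
    rho (∑ i ∈ s, f i) = ∑ i ∈ s, rho (f i) :=
  map_sum (AddMonoidHom.mk' rho rho_add) f s

theorem rho_coe (r : ℝ) : rho (r : ℍ[ℝ]) = (r : ℂ) • (1 : Matrix (Fin 2) (Fin 2) ℂ) := by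
  rw [← rho_one, ← rho_smul, ← Quaternion.coe_mul_eq_smul, mul_one]

theorem rho_add_mul_rho_add (a b c d : ℍ[ℝ]) :
    (rho a + Complex.I • rho b) * (rho c + Complex.I • rho d) =
      rho (a * c - b * d) + Complex.I • rho (a * d + b * c) := by
  have h : Complex.I • (Complex.I • (rho b * rho d)) = -(rho b * rho d) := by
    rw [smul_smul, Complex.I_mul_I, neg_one_smul]
  simp only [rho_sub, rho_add, rho_mul, add_mul, mul_add, Matrix.smul_mul, Matrix.mul_smul,
    smul_add, h]
  abel

theorem conjTranspose_tall_mul_tall (a b : HVec n) :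
    (tall (complexifyVec n (a, b)))ᴴ * tall (complexifyVec n (a, b)) =
      rho (hinner a a + hinner b b) + Complex.I • rho (hinner a b - hinner b a) := by
  have key : ∀ i, (complexifyVec n (a, b) i)ᴴ * complexifyVec n (a, b) i =
      rho (star (a i) * a i + star (b i) * b i) +
        Complex.I • rho (star (a i) * b i - star (b i) * a i) := by
    intro i
    have hI : star Complex.I = -Complex.I := Complex.conj_I
    have e : (complexifyVec n (a, b) i)ᴴ = rho (star (a i)) + Complex.I • rho (-star (b i)) := by
      rw [complexifyVec_apply, Matrix.conjTranspose_add, Matrix.conjTranspose_smul, ← rho_star,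
        ← rho_star, hI, ← zero_sub, ← zero_sub, rho_sub, sub_smul, smul_sub,
        show rho 0 = 0 from (AddMonoidHom.mk' rho rho_add).map_zero]
      simp
    rw [e, complexifyVec_apply, rho_add_mul_rho_add]
    congr 2
    · simp
    · congr 1
      simp [sub_eq_add_neg]
  have h : (tall (complexifyVec n (a, b)))ᴴ * tall (complexifyVec n (a, b)) =
      ∑ i, (complexifyVec n (a, b) i)ᴴ * complexifyVec n (a, b) i := by
    ext k l
    rw [Matrix.mul_apply, Fintype.sum_prod_type, Matrix.sum_apply]
    refine Finset.sum_congr rfl fun i _ => ?_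
    rw [Matrix.mul_apply]
    rfl
  rw [h, Finset.sum_congr rfl fun i _ => key i, Finset.sum_add_distrib, ← Finset.smul_sum,
    ← rho_sum, ← rho_sum, Finset.sum_add_distrib, Finset.sum_sub_distrib]
  rfl

/-- The complexification of `M(n+1, ℍ)` as `M(2n+2, ℂ)`. -/
def complexifyMat (n : ℕ) : HMat n × HMat n →L[ℝ] CMat n :=
  LinearMap.toContinuousLinearMap
    { toFun := fun x => rhoMat x.1 + Complex.I • rhoMat x.2
      map_add' := fun x y => by
        ext a b
        simp only [rhoMat, Prod.fst_add, Prod.snd_add, Matrix.add_apply, rho_add, Matrix.smul_apply,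
          Matrix.of_apply, smul_add]
        abel
      map_smul' := fun c x => by
        ext a b
        simp only [rhoMat, Prod.smul_fst, Prod.smul_snd, Matrix.add_apply, Matrix.smul_apply,
          Matrix.of_apply, rho_smul, RingHom.id_apply, smul_comm Complex.I (c : ℂ), ← smul_add]
        rfl }

theorem complexifyMat_eq (x : HMat n × HMat n) :
    complexifyMat n x = rhoMat x.1 + Complex.I • rhoMat x.2 := rfl

/-- Real and imaginary part of an element of the complexification of `M(n+1, ℍ)`. -/
def realPartsMat (n : ℕ) : CMat n →L[ℝ] HMat n × HMat n :=
  LinearMap.toContinuousLinearMap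
    { toFun := fun A => (Matrix.of fun i j => quatRe (Matrix.of fun a b => A (i, a) (j, b)),
        Matrix.of fun i j => quatIm (Matrix.of fun a b => A (i, a) (j, b)))
      map_add' := fun x y => by
        refine Prod.ext ?_ ?_
        · ext1 i j
          exact quatRe_add (Matrix.of fun a b => x (i, a) (j, b))
            (Matrix.of fun a b => y (i, a) (j, b))
        · ext1 i j
          exact quatIm_add (Matrix.of fun a b => x (i, a) (j, b))
            (Matrix.of fun a b => y (i, a) (j, b))
      map_smul' := fun c x => by
        refine Prod.ext ?_ ?_
        · ext1 i j
          exact quatRe_smul c (Matrix.of fun a b => x (i, a) (j, b))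
        · ext1 i j
          exact quatIm_smul c (Matrix.of fun a b => x (i, a) (j, b)) }

theorem realPartsMat_complexifyMat (x : HMat n × HMat n) :
    realPartsMat n (complexifyMat n x) = x := by
  refine Prod.ext ?_ ?_
  · ext1 i j
    exact quatRe_rho_add (x.1 i j) (x.2 i j)
  · ext1 i j
    exact quatIm_rho_add (x.1 i j) (x.2 i j)

theorem I_smul_complexifyMat (x : HMat n × HMat n) :
    Complex.I • complexifyMat n x = complexifyMat n (-x.2, x.1) := by
  ext a b
  exact congrFun (congrFun (I_smul_rho_add (x.1 a.1 b.1) (x.2 a.1 b.1)) a.2) b.2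

/-- The Hopf map `p p*` extended to the complexification: expand `(a + √-1 b)(a* + √-1 b*)`. -/
theorem tall_mul_tadj_tall (a b : HVec n) :
    tall (complexifyVec n (a, b)) * tadj (tall (complexifyVec n (a, b))) =
      complexifyMat n (hopf a - hopf b, hopfDiff a b) := by
  ext ⟨i, k⟩ ⟨j, l⟩
  rw [tall_mul_tadj_tall_apply, complexifyVec_apply, complexifyVec_apply, adjugate_rho_add,
    rho_add_mul_rho_add]
  rfl

theorem rhoMat_mul (X Y : HMat n) : rhoMat (X * Y) = rhoMat X * rhoMat Y := by
  ext ⟨i, a⟩ ⟨j, b⟩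
  rw [Matrix.mul_apply, Fintype.sum_prod_type]
  simp only [rhoMat, Matrix.of_apply, Matrix.mul_apply, rho_sum, rho_mul, Matrix.sum_apply]

theorem tauH_eq (x : HMat n × HMat n) : tauH x = complexifyMat n
    (mnorm x.2 ^ 2 • x.1 - x.2 * x.2, (mnorm x.2 * (√2)⁻¹) • x.2) := by
  have hsub : ∀ X Y : HMat n, rhoMat (X - Y) = rhoMat X - rhoMat Y := fun X Y => by
    ext a b
    exact congrFun (congrFun (rho_sub (X a.1 b.1) (Y a.1 b.1)) a.2) b.2
  have hsmul : ∀ (c : ℝ) (X : HMat n), rhoMat (c • X) = (c : ℂ) • rhoMat X := fun c X => by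
    ext a b
    exact congrFun (congrFun (rho_smul c (X a.1 b.1)) a.2) b.2
  rw [complexifyMat_eq, hsub, hsmul, hsmul, rhoMat_mul, smul_smul, tauH]
  congr 2
  push_cast
  ring

theorem tauH_hopf {p q : HVec n} (hp : einner p p = 1) (hpq : hinner p q = 0) :
    tauH (hopf p, hopfDiff p q) =
      complexifyMat n (einner q q • hopf p - hopf q, vnorm q • hopfDiff p q) := by
  rw [tauH_eq]
  simp only [mnorm_hopfDiff hp hpq, hopfDiff_mul_self hp hpq]
  have h2 : √2 * √2 = (2 : ℝ) := Real.mul_self_sqrt zero_le_two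
  have h2' : √2 ≠ (0 : ℝ) := by positivity
  congr 2
  · rw [mul_pow, vnorm_sq, Real.sq_sqrt zero_le_two, two_mul, add_smul]
    abel
  · congr 1
    field_simp

/-- The link between the two embeddings. It holds because `Q² = ‖q‖² p p* + q q*` and `‖Q‖² =
2‖q‖²`, so the real part of `τ_ℍ` is `‖q‖² p p* - q q*`. -/
theorem tauH_hopf_eq_tall {p q : HVec n} (hp : einner p p = 1) (hpq : hinner p q = 0) :
    tauH (hopf p, hopfDiff p q) = tall (complexifyVec n (vnorm q • p, q)) *
      tadj (tall (complexifyVec n (vnorm q • p, q))) := by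
  rw [tauH_hopf hp hpq, tall_mul_tadj_tall]
  have h1 : hopf (vnorm q • p) = einner q q • hopf p := by
    rw [hopf_eq_outer, outer_smul_smul, ← sq, vnorm_sq, hopf_eq_outer]
  have h2 : hopfDiff (vnorm q • p) q = vnorm q • hopfDiff p q := by
    have e1 := outer_smul_smul (vnorm q) 1 p q
    have e2 := outer_smul_smul 1 (vnorm q) q p
    rw [one_smul, mul_one] at e1
    rw [one_smul, one_mul] at e2
    rw [hopfDiff_eq_outer, e1, e2, hopfDiff_eq_outer, smul_add]
  rw [h1, h2]

theorem spaceEHTilde_eq : spaceEHTilde n = nilpotentRankTwo (Fin (n + 1) × Fin 2) := by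
  ext A
  exact and_congr (tadj_eq_self_iff A).symm Iff.rfl

theorem hinner_smul_left (c : ℝ) (h k : HVec n) : hinner (c • h) k = c • hinner h k := by
  simp only [hinner, Pi.smul_apply, Quaternion.star_smul, smul_mul_assoc, Finset.smul_sum]

theorem hinner_smul_right (c : ℝ) (h k : HVec n) : hinner h (c • k) = c • hinner h k := by
  simp only [hinner, Pi.smul_apply, mul_smul_comm, Finset.smul_sum]

theorem tauH_mem {x : HMat n × HMat n} (hx : x ∈ spaceEH n) : tauH x ∈ spaceEHTilde n := by
  obtain ⟨p, q, hp, hpq, hq, rfl⟩ := mem_spaceEH_iff.1 hx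
  rw [spaceEHTilde_eq, tauH_hopf_eq_tall hp hpq]
  have hpq' : einner p q = 0 := by rw [einner_eq_re, hpq]; rfl
  have hpos := einner_self_pos hq
  -- For horizontal `q` the two columns of `T` are orthogonal of equal length, `Tᴴ T = 2‖q‖²`, which
  -- provides the left inverse.
  refine mul_tadj_mem_nilpotentRankTwo
    (L := (((2 * einner q q : ℝ) : ℂ))⁻¹ • (tall (complexifyVec n (vnorm q • p, q)))ᴴ) ?_ ?_
  · have hc : ((2 * einner q q : ℝ) : ℂ) ≠ 0 := by exact_mod_cast (by positivity)
    have e1 : hinner (vnorm q • p) (vnorm q • p) + hinner q q = ((2 * einner q q : ℝ) : ℍ[ℝ]) := by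
      rw [hinner_self, hinner_self, einner_smul_left, einner_smul_right, hp, mul_one, ← sq,
        vnorm_sq, two_mul, Quaternion.coe_add]
    have e2 : hinner (vnorm q • p) q - hinner q (vnorm q • p) = ((0 : ℝ) : ℍ[ℝ]) := by
      rw [hinner_smul_left, hinner_smul_right, hpq, hinner_comm_zero hpq]
      simp
    rw [Matrix.smul_mul, conjTranspose_tall_mul_tall, e1, e2, rho_coe, rho_coe]
    simp only [Complex.ofReal_zero, zero_smul, smul_zero, add_zero]
    rw [smul_smul, inv_mul_cancel₀ hc, one_smul]
  · rw [tadj_tall_mul_tall, sum_det_complexifyVec_eq_zero.2, zero_smul]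
    simp only [einner_smul_left, einner_smul_right, hp, hpq', mul_zero, mul_one, ← sq, vnorm_sq,
      and_self]

/-- Factor `A = T T^♯` with `Tᴴ T = c` and write `T` as `a + √-1 b`. Then `(a, b)_ℍ = (b, a)_ℍ` is
real, and `T^♯ T = 0` makes its real part zero and `a`, `b` of equal length. So `p = a / ‖b‖` and `q
= b` form a horizontal pair. -/
theorem exists_tauH_eq {A : CMat n} (hA : A ∈ spaceEHTilde n) : ∃ x ∈ spaceEH n, tauH x = A := by
  rw [spaceEHTilde_eq] at hA
  obtain ⟨T, c, hc, hT, hTc, hT0⟩ := exists_factorization_of_mem hA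
  obtain ⟨a, b, rfl⟩ := exists_tall T
  have h0 : ∑ i, (complexifyVec n (a, b) i).det = 0 := by
    rw [tadj_tall_mul_tall] at hT0
    simpa using congrFun (congrFun hT0 0) 0
  obtain ⟨hab, hab0⟩ := sum_det_complexifyVec_eq_zero.1 h0
  rw [conjTranspose_tall_mul_tall] at hTc
  have hc' : (c : ℂ) • (1 : Matrix (Fin 2) (Fin 2) ℂ) =
      rho (c : ℍ[ℝ]) + Complex.I • rho ((0 : ℝ) : ℍ[ℝ]) := by
    rw [rho_coe, rho_coe]; simp
  rw [hc'] at hTc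
  have h1 := congrArg quatRe hTc
  have h2 := congrArg quatIm hTc
  rw [quatRe_rho_add, quatRe_rho_add, hinner_self, hinner_self, ← Quaternion.coe_add,
    Quaternion.coe_inj] at h1
  rw [quatIm_rho_add, quatIm_rho_add, Quaternion.coe_zero, sub_eq_zero, ← hinner_star b a,
    hinner_star b a] at h2
  have h3 : hinner a b = 0 := by
    have h4 : star (hinner a b) = hinner a b := by rw [hinner_star, h2]
    rw [Quaternion.star_eq_self.1 h4, ← einner_eq_re, hab0, Quaternion.coe_zero]
  have hb : b ≠ 0 := by
    rintro rfl
    rw [hab, einner_self_eq_zero.2 rfl] at h1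
    linarith
  have hpos := vnorm_pos hb
  have hp : einner ((vnorm b)⁻¹ • a) ((vnorm b)⁻¹ • a) = 1 := by
    rw [einner_smul_left, einner_smul_right, hab, ← vnorm_sq]
    field_simp
  have hpq : hinner ((vnorm b)⁻¹ • a) b = 0 := by rw [hinner_smul_left, h3, smul_zero]
  refine ⟨_, mem_spaceEH_iff.2 ⟨(vnorm b)⁻¹ • a, b, hp, hpq, hb, rfl⟩, ?_⟩
  rw [tauH_hopf_eq_tall hp hpq, smul_smul, mul_inv_cancel₀ hpos.ne', one_smul, hT]

end Complexification

/-! ### The punctured cotangent bundle of the quaternion projective space -/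

section ProjectiveSpace

variable {n : ℕ}

/-- Matrix multiplication as a continuous bilinear map. -/
def mulL (n : ℕ) : HMat n →L[ℝ] HMat n →L[ℝ] HMat n :=
  (LinearMap.mk₂ ℝ (fun X Y : HMat n => X * Y)
    (fun _ _ _ => Matrix.add_mul _ _ _) (fun _ _ _ => Matrix.smul_mul _ _ _)
    (fun _ _ _ => Matrix.mul_add _ _ _)
    (fun _ _ _ => Matrix.mul_smul _ _ _)).toContinuousBilinearMap

/-- The bilinear map `(a, b) ↦ (a_i θ(b_j))`. -/
def outerL (n : ℕ) : HVec n →L[ℝ] HVec n →L[ℝ] HMat n :=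
  (LinearMap.mk₂ ℝ (outer : HVec n → HVec n → HMat n)
    (fun _ _ _ => by ext1 i j; exact add_mul _ _ _)
    (fun r a b => by ext1 i j; exact smul_mul_assoc r (a i) (star (b j)))
    (fun a b c => by ext1 i j; simp [outer, mul_add])
    (fun r a b => by ext1 i j; simp [outer])).toContinuousBilinearMap

/-- The linear map `X ↦ X^* - X`. -/
def skewL (n : ℕ) : HMat n →L[ℝ] HMat n :=
  LinearMap.toContinuousLinearMap
    { toFun := fun X => Xᴴ - X
      map_add' := fun X Y => by
        rw [Matrix.conjTranspose_add]; abel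
      map_smul' := fun c X => by
        ext1 i j
        simp [Matrix.conjTranspose_apply, smul_sub] }

theorem hopf_mem {p : HVec n} (hp : einner p p = 1) : hopf p ∈ quatProj n := ⟨p, hp, rfl⟩

/-- The Hopf image of a great circle arc is a curve with this velocity. -/
theorem hopfDiff_mem_tangentSpaceAt {p q : HVec n} (hp : einner p p = 1) (hpq : einner p q = 0) :
    hopfDiff p q ∈ tangentSpaceAt (quatProj n) (hopf p) := by
  have hd := (hasFDerivAt_bilinear_self (outerL n) p)
  rw [← sphereArc_zero p q] at hd
  have h := hd.comp_hasDerivAt 0 (hasDerivAt_sphereArc p q)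
  refine Submodule.subset_span ⟨fun t => hopf (sphereArc p q t), ?_,
    Filter.Eventually.of_forall fun t => hopf_mem (einner_sphereArc hp hpq t), ?_, ?_⟩
  · exact ((contDiff_bilinear_self (outerL n)).comp (contDiff_sphereArc p q)).contDiffAt
  · exact congrArg hopf (sphereArc_zero p q)
  · rw [sphereArc_zero] at h
    exact h.deriv

/-- Differentiate the two identities `P* = P` and `P² = P` satisfied by the projections `p p*`. -/
theorem tangentSpaceAt_quatProj {P Q : HMat n} (hQ : Q ∈ tangentSpaceAt (quatProj n) P) :
    Q.IsHermitian ∧ P * Q + Q * P = Q := by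
  constructor
  · have h := fderiv_eq_zero_of_constant (skewL n).hasFDerivAt (c := 0) (M := quatProj n) ?_ hQ
    · exact sub_eq_zero.1 h
    · rintro y ⟨p, hp, rfl⟩
      exact sub_eq_zero.2 (isHermitian_hopf p)
  · have h := fderiv_eq_zero_of_constant ((hasFDerivAt_bilinear_self (mulL n) P).sub
      (hasFDerivAt_id P)) (c := 0) (M := quatProj n) ?_ hQ
    · exact sub_eq_zero.1 h
    · rintro y ⟨p, hp, rfl⟩
      exact sub_eq_zero.2 (hopf_mul_self hp)

theorem spaceEH_eq : spaceEH n = puncturedTangentBundle (quatProj n) := by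
  ext x
  constructor
  · intro hx
    obtain ⟨p, q, hp, hpq, hq, rfl⟩ := mem_spaceEH_iff.1 hx
    refine ⟨hx.1, hopfDiff_mem_tangentSpaceAt hp ?_, hx.2.2.2⟩
    rw [einner_eq_re, hpq]
    rfl
  · rintro ⟨h1, h2, h3⟩
    obtain ⟨h4, h5⟩ := tangentSpaceAt_quatProj h2
    exact ⟨h1, h4, by rw [jordan, h5], h3⟩

/-- The trace form is indefinite on all quaternionic matrices, so positivity has to come from the
horizontal representative. -/
theorem minner_pos_of_mem {x : HMat n × HMat n} (hx : x ∈ spaceEH n) : 0 < minner x.2 x.2 := by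
  obtain ⟨p, q, hp, hpq, hq, rfl⟩ := mem_spaceEH_iff.1 hx
  rw [minner_hopfDiff_self hp hpq]
  have := einner_self_pos hq
  positivity

theorem contDiffAt_mnorm {Q : HMat n} (hQ : minner Q Q ≠ 0) : ContDiffAt ℝ ∞ mnorm Q :=
  (contDiff_bilinear_self (minnerL n)).contDiffAt.sqrt hQ

theorem hasFDerivAt_mnorm {Q : HMat n} (hQ : 0 < minner Q Q) :
    HasFDerivAt mnorm ((mnorm Q)⁻¹ • minnerL n Q) Q := by
  have h := (hasFDerivAt_bilinear_self (minnerL n) Q).sqrt hQ.ne'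
  refine h.congr_fderiv ?_
  ext v
  change 1 / (2 * √(minner Q Q)) * (minner Q v + minner v Q) = (√(minner Q Q))⁻¹ * minner Q v
  rw [minner_comm v]
  ring

theorem continuous_minner_self : Continuous fun Q : HMat n => minner Q Q :=
  (contDiff_bilinear_self (minnerL n)).continuous

theorem contDiffAt_tauH {x : HMat n × HMat n} (hx : minner x.2 x.2 ≠ 0) :
    ContDiffAt ℝ ∞ tauH x := by
  have h1 : ContDiffAt ℝ ∞ (fun y : HMat n × HMat n => mnorm y.2) x :=
    ContDiffAt.comp (g := mnorm) (f := Prod.snd) x (contDiffAt_mnorm hx) contDiffAt_snd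
  have h2 : ContDiffAt ℝ ∞ (fun y : HMat n × HMat n => y.2 * y.2) x :=
    ContDiffAt.comp (g := fun X : HMat n => X * X) (f := Prod.snd) x
      (contDiff_bilinear_self (mulL n)).contDiffAt contDiffAt_snd
  have h3 := (complexifyMat n).contDiff.contDiffAt.comp x
    ((((h1.pow 2).smul contDiffAt_fst).sub h2).prodMk
      ((h1.mul (contDiffAt_const (c := (√2)⁻¹))).smul contDiffAt_snd))
  exact h3.congr_of_eventuallyEq (Filter.Eventually.of_forall tauH_eq)

theorem smoothNear_tauH {x : HMat n × HMat n} (hx : x ∈ spaceEH n) : SmoothNear ℝ tauH x := by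
  have hc : Continuous fun y : HMat n × HMat n => minner y.2 y.2 :=
    continuous_minner_self.comp continuous_snd
  filter_upwards [hc.continuousAt.eventually (isOpen_ne.mem_nhds (minner_pos_of_mem hx).ne')]
    with y hy
  exact contDiffAt_tauH hy

theorem fderiv_tauH {x : HMat n × HMat n} (hx : 0 < minner x.2 x.2) (v : HMat n × HMat n) :
    fderiv ℝ tauH x v = complexifyMat n
      (mnorm x.2 ^ 2 • v.1 + (2 * minner x.2 v.2) • x.1 - (x.2 * v.2 + v.2 * x.2),
        (mnorm x.2 * (√2)⁻¹) • v.2 + ((mnorm x.2)⁻¹ * minner x.2 v.2 * (√2)⁻¹) • x.2) := by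
  have h1 : HasFDerivAt (fun y : HMat n × HMat n => mnorm y.2) _ x :=
    (hasFDerivAt_mnorm hx).comp x hasFDerivAt_snd
  have h2 : HasFDerivAt (fun y : HMat n × HMat n => y.2 * y.2) _ x :=
    (hasFDerivAt_bilinear_self (mulL n) x.2).comp x hasFDerivAt_snd
  have h3 := (complexifyMat n).hasFDerivAt.comp x
    ((((h1.pow 2).smul hasFDerivAt_fst).sub h2).prodMk
      ((h1.mul_const (√2)⁻¹).smul hasFDerivAt_snd))
  have h4 : HasFDerivAt tauH _ x :=
    h3.congr_of_eventuallyEq (Filter.Eventually.of_forall tauH_eq)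
  have hm : mnorm x.2 ≠ 0 := (Real.sqrt_pos.2 hx).ne'
  have e1 : 2 * minner x.2 v.2 =
      ((2 : ℕ) • mnorm x.2 ^ (2 - 1)) * ((mnorm x.2)⁻¹ * minner x.2 v.2) := by
    simp
    field_simp
  have e2 : (mnorm x.2)⁻¹ * minner x.2 v.2 * (√2)⁻¹ =
      (√2)⁻¹ * ((mnorm x.2)⁻¹ * minner x.2 v.2) := by ring
  rw [h4.fderiv, e1, e2]
  rfl

/-- The inverse of `τ_ℍ`. -/
def sigmaH (A : CMat n) : HMat n × HMat n :=
  let X := (realPartsMat n A).1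
  let Y := (realPartsMat n A).2
  -- At a point of the image `Y = ‖Q‖ Q / √2`, so `t = ‖Q‖`. Then `Q = √2 t⁻¹ Y`, and `P` is solved
  -- from `X = t² P - Q²`.
  let t := √(√2 * mnorm Y)
  ((t ^ 2)⁻¹ • (X + (√2 * t⁻¹) ^ 2 • (Y * Y)), (√2 * t⁻¹) • Y)

theorem mnorm_smul {c : ℝ} (hc : 0 ≤ c) (Q : HMat n) : mnorm (c • Q) = c * mnorm Q := by
  rw [mnorm, minner_smul_left, minner_smul_right, ← mul_assoc, Real.sqrt_mul (by positivity),
    Real.sqrt_mul_self hc, mnorm]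

theorem sigmaH_tauH {x : HMat n × HMat n} (hx : 0 < minner x.2 x.2) : sigmaH (tauH x) = x := by
  have hm : 0 < mnorm x.2 := Real.sqrt_pos.2 hx
  have h2 : √2 * √2 = (2 : ℝ) := Real.mul_self_sqrt zero_le_two
  have h2' : (0 : ℝ) < √2 := by positivity
  have ht : √(√2 * (mnorm x.2 * (√2)⁻¹ * mnorm x.2)) = mnorm x.2 := by
    rw [show √2 * (mnorm x.2 * (√2)⁻¹ * mnorm x.2) = mnorm x.2 * mnorm x.2 by field_simp]
    exact Real.sqrt_mul_self hm.le
  have hs : √2 * (mnorm x.2)⁻¹ * (mnorm x.2 * (√2)⁻¹) = 1 := by field_simp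
  have hr : mnorm ((mnorm x.2 * (√2)⁻¹) • x.2) = mnorm x.2 * (√2)⁻¹ * mnorm x.2 :=
    mnorm_smul (by positivity) x.2
  rw [tauH_eq, sigmaH, realPartsMat_complexifyMat]
  simp only [hr, ht, Matrix.smul_mul, Matrix.mul_smul, smul_smul, hs, one_smul]
  refine Prod.ext ?_ rfl
  simp only
  rw [show (√2 * (mnorm x.2)⁻¹) ^ 2 * (mnorm x.2 * (√2)⁻¹ * (mnorm x.2 * (√2)⁻¹)) = 1 by
    field_simp, one_smul, sub_add_cancel, smul_smul, inv_mul_cancel₀ (by positivity), one_smul]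

theorem smoothNear_sigmaH {A : CMat n} (hA : A ∈ spaceEHTilde n) : SmoothNear ℝ sigmaH A := by
  obtain ⟨x, hx, rfl⟩ := exists_tauH_eq hA
  have hpos := minner_pos_of_mem hx
  have hm : 0 < mnorm x.2 := Real.sqrt_pos.2 hpos
  have h0 : minner (realPartsMat n (tauH x)).2 (realPartsMat n (tauH x)).2 ≠ 0 := by
    rw [tauH_eq, realPartsMat_complexifyMat]
    simp only [minner_smul_left, minner_smul_right]
    positivity
  have hc : Continuous fun A : CMat n => minner (realPartsMat n A).2 (realPartsMat n A).2 :=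
    continuous_minner_self.comp (continuous_snd.comp (realPartsMat n).continuous)
  have hc0 : Continuous fun A : CMat n => mnorm (realPartsMat n A).2 := hc.sqrt
  have hm0 : 0 < mnorm (realPartsMat n (tauH x)).2 := by
    refine Real.sqrt_pos.2 ?_
    rw [tauH_eq, realPartsMat_complexifyMat]
    simp only [minner_smul_left, minner_smul_right]
    positivity
  filter_upwards [hc.continuousAt.eventually (isOpen_ne.mem_nhds h0),
    hc0.continuousAt.eventually (isOpen_lt continuous_const continuous_id |>.mem_nhds hm0)]
    with A hA hA'
  have hre : ContDiffAt ℝ ∞ (fun A : CMat n => (realPartsMat n A).1) A :=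
    contDiffAt_fst.comp A (realPartsMat n).contDiff.contDiffAt
  have him : ContDiffAt ℝ ∞ (fun A : CMat n => (realPartsMat n A).2) A :=
    contDiffAt_snd.comp A (realPartsMat n).contDiff.contDiffAt
  have hn : ContDiffAt ℝ ∞ (fun A : CMat n => mnorm (realPartsMat n A).2) A :=
    ContDiffAt.comp (g := mnorm) A (contDiffAt_mnorm hA) him
  have hmm : ContDiffAt ℝ ∞ (fun A : CMat n => (realPartsMat n A).2 * (realPartsMat n A).2) A :=
    ContDiffAt.comp (g := fun X : HMat n => X * X) A
      (contDiff_bilinear_self (mulL n)).contDiffAt him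
  have hpos' : 0 < √2 * mnorm (realPartsMat n A).2 := mul_pos (by positivity) hA'
  have ht : ContDiffAt ℝ ∞ (fun A : CMat n => √(√2 * mnorm (realPartsMat n A).2)) A :=
    (contDiffAt_const.mul hn).sqrt hpos'.ne'
  have ht0 := (Real.sqrt_pos.2 hpos').ne'
  have hk := contDiffAt_const (c := √2).mul (ht.inv ht0)
  exact (((ht.pow 2).inv (pow_ne_zero 2 ht0)).smul (hre.add ((hk.pow 2).smul hmm))).prodMk
    (hk.smul him)

end ProjectiveSpace

/-! ### The canonical one-form of the projective space as a pull-back -/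

section ProjectiveForm

variable {n : ℕ}

/-- All matrix entries, as complex coordinates. -/
def coordH (n : ℕ) :
    CMat n →ₗ[ℂ] ((Fin (n + 1) × Fin 2) × (Fin (n + 1) × Fin 2) → ℂ) where
  toFun A k := A k.1 k.2
  map_add' _ _ := rfl
  map_smul' _ _ := rfl

theorem coordH_injective : Function.Injective (coordH n) := fun A B h => by
  ext a b
  exact congrFun h (a, b)

theorem coordMetric_complexifyMat {x : HMat n × HMat n} (h1 : x.1.IsHermitian)
    (h2 : x.2.IsHermitian) (y : HMat n × HMat n) :
    coordMetric (coordH n) (complexifyMat n x) (complexifyMat n y) =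
      2 * (minner x.1 y.1 + minner x.2 y.2) := by
  rw [coordMetric_apply, minner_eq_sum h1, minner_eq_sum h2, Fintype.sum_prod_type,
    Fintype.sum_prod_type, ← Finset.sum_add_distrib, Finset.mul_sum]
  refine Finset.sum_congr rfl fun i _ => ?_
  rw [← Finset.sum_add_distrib, Finset.mul_sum]
  simp only [Fintype.sum_prod_type]
  rw [Finset.sum_comm]
  refine Finset.sum_congr rfl fun j _ => ?_
  rw [← hermitian_rho_add]
  rfl

theorem potentialH_eq :
    (potentialH : CMat n → ℂ) = fun A => (quadPow (coordMetric (coordH n)) (1 / 4) A : ℂ) := by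
  funext A
  have h0 : 0 ≤ ∑ i, ∑ j, ‖A i j‖ ^ 2 :=
    Finset.sum_nonneg fun _ _ => Finset.sum_nonneg fun _ _ => by positivity
  rw [potentialH, quadPow, coordMetric_self, frob, Real.sqrt_eq_rpow, Real.sqrt_eq_rpow,
    ← Real.rpow_mul h0, show (1 / 2 : ℝ) * (1 / 2) = 1 / 4 by norm_num]
  simp only [Fintype.sum_prod_type]
  rfl

/-- The canonical one-form of a bilinear metric as a field of linear forms. -/
def metricForm {V : Type} [NormedAddCommGroup V] [NormedSpace ℝ V] (B : V →L[ℝ] V →L[ℝ] ℝ)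
    (x : V × V) : V × V →L[ℝ] ℝ :=
  (B x.2).comp (ContinuousLinearMap.fst ℝ V V)

theorem contDiff_metricForm {V : Type} [NormedAddCommGroup V] [NormedSpace ℝ V]
    (B : V →L[ℝ] V →L[ℝ] ℝ) : ContDiff ℝ ∞ (metricForm B) :=
  (B.contDiff.comp contDiff_snd).clm_comp contDiff_const

theorem canonicalOneForm_eq {V : Type} [NormedAddCommGroup V] [NormedSpace ℝ V]
    {B : V →L[ℝ] V →L[ℝ] ℝ} {flat : V → V → V →L[ℝ] ℝ} (h : ∀ p q, flat p q = B q) :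
    canonicalOneForm flat = oneForm (metricForm B) := by
  funext x
  rw [canonicalOneForm, fderiv_fst, h]
  rfl

theorem canonicalOneForm_projFlat : canonicalOneForm (projFlat (n := n)) =
    oneForm (metricForm ((1 / 2 : ℝ) • minnerL n)) :=
  canonicalOneForm_eq fun _ _ => rfl

theorem minner_facts {x : HMat n × HMat n} (hx : x ∈ spaceEH n) :
    minner x.1 x.2 = 0 ∧ minner (x.2 * x.2) x.2 = 0 := by
  obtain ⟨p, q, hp, hpq, hq, rfl⟩ := mem_spaceEH_iff.1 hx
  exact ⟨minner_hopf_hopfDiff hpq, minner_sq_hopfDiff hp hpq⟩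

/-- Derivatives of the constraints `tr (P ∘ Q) = 0` and `Re tr Q³ = 0`, which hold along `E_ℍ`. -/
theorem minner_tangent {x v : HMat n × HMat n} (hv : v ∈ tangentSpaceAt (spaceEH n) x) :
    minner x.1 v.2 = -minner x.2 v.1 ∧ minner (x.2 * x.2) v.2 = 0 := by
  constructor
  · have hg : HasFDerivAt (fun y : HMat n × HMat n => minnerL n y.1 y.2) _ x :=
      ((minnerL n).hasFDerivAt.comp x hasFDerivAt_fst).clm_apply hasFDerivAt_snd
    have h := fderiv_eq_zero_of_constant hg (c := 0) (fun y hy => (minner_facts hy).1) hv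
    have h' : minner x.1 v.2 + minner v.1 x.2 = 0 := h
    rw [minner_comm x.2]
    linarith
  · have hm : HasFDerivAt (fun y : HMat n × HMat n => mulL n y.2 y.2) _ x :=
      (hasFDerivAt_bilinear_self (mulL n) x.2).comp x hasFDerivAt_snd
    have hg : HasFDerivAt (fun y : HMat n × HMat n => minnerL n (mulL n y.2 y.2) y.2) _ x :=
      ((minnerL n).hasFDerivAt.comp x hm).clm_apply hasFDerivAt_snd
    have h := fderiv_eq_zero_of_constant hg (c := 0) (fun y hy => (minner_facts hy).2) hv
    have h' : minner (x.2 * x.2) v.2 + minner (x.2 * v.2 + v.2 * x.2) x.2 = 0 := h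
    rw [minner_add_left, minner_mul_left v.2, minner_comm v.2, minner_mul_left x.2 v.2,
      minner_comm x.2, minner_mul_left v.2, minner_comm v.2] at h'
    linarith

/-- The real and imaginary parts of `τ_ℍ` both have squared norm `2‖q‖⁴`; hence `√‖τ_ℍ‖ = 2^(1/4)
‖Q‖`. -/
theorem coordMetric_tauH_self {x : HMat n × HMat n} (hx : x ∈ spaceEH n) :
    coordMetric (coordH n) (tauH x) (tauH x) = 2 * mnorm x.2 ^ 4 := by
  obtain ⟨p, q, hp, hpq, hq, rfl⟩ := mem_spaceEH_iff.1 hx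
  have h1 : (einner q q • hopf p - hopf q).IsHermitian := by
    rw [Matrix.IsHermitian, Matrix.conjTranspose_sub, isHermitian_hopf q]
    congr 1
    ext1 i j
    simp [hopf]
  have h2 : (vnorm q • hopfDiff p q).IsHermitian := by
    ext1 i j
    simp [hopfDiff, add_comm]
  rw [tauH_hopf hp hpq, coordMetric_complexifyMat h1 h2]
  simp only [minner_real_part hp hpq, minner_smul_left, minner_smul_right,
    minner_hopfDiff_self hp hpq]
  rw [show mnorm (hopfDiff p q) ^ 4 = (mnorm (hopfDiff p q) ^ 2) ^ 2 by ring,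
    mnorm_hopfDiff_sq hp hpq, ← vnorm_sq]
  ring

/-- This fixes the constant `2^(-3/4)`: at exponent `1/4` the gradient of the potential contributes
another `2^(-3/4) r⁻³`, cancelling the `2√2 r³` of the pairing in `projForm_eq`. -/
theorem rpow_const_identity {r : ℝ} (hr : 0 < r) :
    (2 : ℝ) ^ (-(3 / 4) : ℝ) * (2 * r ^ 4) ^ ((1 : ℝ) / 4 - 1) = (2 * √2 * r ^ 3)⁻¹ := by
  have h2 : (0 : ℝ) < 2 := two_pos
  rw [Real.mul_rpow h2.le (by positivity), ← Real.rpow_natCast r 4, ← Real.rpow_mul hr.le,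
    ← mul_assoc, ← Real.rpow_add h2, mul_inv, Real.sqrt_eq_rpow, ← Real.rpow_natCast r 3,
    ← Real.rpow_neg hr.le]
  congr 1
  · rw [show (2 : ℝ) * 2 ^ (1 / 2 : ℝ) = 2 ^ (3 / 2 : ℝ) by
      rw [← Real.rpow_one_add' h2.le (by norm_num)]; norm_num, ← Real.rpow_neg h2.le]
    norm_num
  · norm_num

theorem projForm_eq {x : HMat n × HMat n} (hx : x ∈ spaceEH n)
    {v : HMat n × HMat n} (hv : v ∈ tangentSpaceAt (spaceEH n) x) :
    metricForm ((1 / 2 : ℝ) • minnerL n) x v = twistedDifferential ((2 : ℝ) ^ (-(3 / 4) : ℝ))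
      (quadPow (coordMetric (coordH n)) (1 / 4)) (tauH x) (fderiv ℝ tauH x v) := by
  have hpos := minner_pos_of_mem hx
  have hm : 0 < mnorm x.2 := Real.sqrt_pos.2 hpos
  have hsq : minner x.2 x.2 = mnorm x.2 ^ 2 := (Real.sq_sqrt hpos.le).symm
  obtain ⟨hPQ, hQQQ⟩ := minner_facts hx
  obtain ⟨hort, hcub⟩ := minner_tangent hv
  have hself := coordMetric_tauH_self hx
  have hne : tauH x ≠ 0 := fun h => by
    rw [h, map_zero] at hself
    have : 0 < 2 * mnorm x.2 ^ 4 := by positivity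
    simp at hself
    exact hm.ne' hself
  have hQh : x.2ᴴ = x.2 := hx.2.1
  have hPh : x.1ᴴ = x.1 := by
    obtain ⟨p, hp, h⟩ := hx.1
    rw [h]
    exact isHermitian_hopf p
  have hX : (mnorm x.2 ^ 2 • x.1 - x.2 * x.2).IsHermitian := by
    rw [Matrix.IsHermitian, Matrix.conjTranspose_sub, Matrix.conjTranspose_mul, hQh]
    congr 1
    ext1 i j
    have h : star (x.1 j i) = x.1 i j := congrFun (congrFun hPh i) j
    simp [h]
  have hY : ((mnorm x.2 * (√2)⁻¹) • x.2).IsHermitian := by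
    ext1 i j
    have h : star (x.2 j i) = x.2 i j := congrFun (congrFun hQh i) j
    simp [h]
  have e2 : minner x.2 (x.2 * v.2 + v.2 * x.2) = 0 := by
    rw [minner_add_right, ← minner_mul_left, ← minner_mul_left, minner_comm (x.2 * v.2),
      ← minner_mul_left, hcub, add_zero]
  -- The constraints and their derivatives remove every term except `⟨P, v.2⟩ = -⟨Q, v.1⟩` and `⟨Q,
  -- v.1⟩`, which contribute equally.
  have key : coordMetric (coordH n) (tauH x) (Complex.I • fderiv ℝ tauH x v) =
      2 * √2 * mnorm x.2 ^ 3 * minner x.2 v.1 := by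
    rw [fderiv_tauH hpos, I_smul_complexifyMat, tauH_eq, coordMetric_complexifyMat hX hY]
    have hneg : ∀ X Y : HMat n, minner X (-Y) = -minner X Y := fun X Y => by
      rw [← neg_one_smul ℝ Y, minner_smul_right, neg_one_mul]
    simp only [hneg, minner_sub_left, minner_sub_right, minner_add_right, minner_smul_left,
      minner_smul_right, hPQ, hQQQ, hort, hcub, minner_comm x.2 x.1]
    rw [minner_add_right] at e2
    have h2 : √2 * √2 = (2 : ℝ) := Real.mul_self_sqrt zero_le_two
    have h2' : (√2 : ℝ) ≠ 0 := by positivity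
    have h3 : (√2 : ℝ)⁻¹ = √2 / 2 := by field_simp; linarith
    rw [h3]
    linear_combination (-(mnorm x.2 * √2)) * e2
  rw [twistedDifferential,
    (hasFDerivAt_quadPow (isHermitianMetric_coordMetric coordH_injective) _ hne).fderiv]
  simp only [smul_apply, ContinuousLinearMap.comp_apply, mulI_apply, hself, smul_eq_mul]
  rw [key]
  have hc := rpow_const_identity hm
  have e : metricForm ((1 / 2 : ℝ) • minnerL n) x v = 1 / 2 * minner x.2 v.1 := rfl
  rw [e]
  have h4 : (2 * √2 * mnorm x.2 ^ 3)⁻¹ * (2 * √2 * mnorm x.2 ^ 3) = 1 :=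
    inv_mul_cancel₀ (by positivity)
  rw [← hc] at h4
  linear_combination (-(1 / 2) * minner x.2 v.1) * h4

theorem finrank_count : Fintype.card (Fin (n + 1) × Fin 2) * 2 = 4 * n + 4 := by
  simp
  ring

theorem potentialData_spaceEH :
    PotentialData (4 * n) (spaceEH n) (spaceEHTilde n) tauH sigmaH
      (metricForm ((1 / 2 : ℝ) • minnerL n)) (coordMetric (coordH n)) (1 / 4)
      ((2 : ℝ) ^ (-(3 / 4) : ℝ)) where
  param y hy := by
    rw [spaceEHTilde_eq] at hy ⊢
    exact hasParam_nilpotentRankTwo finrank_count hy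
  ne_zero y hy h := by simpa [h] using hy.2.1
  smooth _ hx := smoothNear_tauH hx
  smooth_inv _ hy := smoothNear_sigmaH hy
  mapsTo _ hx := tauH_mem hx
  mapsTo_inv y hy := by
    obtain ⟨x, hx, rfl⟩ := exists_tauH_eq hy
    rw [sigmaH_tauH (minner_pos_of_mem hx)]
    exact hx
  invOn := by
    refine ⟨fun x hx => sigmaH_tauH (minner_pos_of_mem hx), fun y hy => ?_⟩
    obtain ⟨x, hx, rfl⟩ := exists_tauH_eq hy
    rw [sigmaH_tauH (minner_pos_of_mem hx)]
  metric := isHermitianMetric_coordMetric coordH_injective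
  exponent_pos := by norm_num
  exponent_le := by norm_num
  const_pos := by positivity
  smooth_form := contDiff_metricForm _
  form_eq _ hx _ hv := projForm_eq hx hv

end ProjectiveForm

end

end HopfKaehler

theorem mainTheorem5 (n : ℕ) :
    -- the punctured cotangent bundle of the sphere
    (EqOnSubmanifold (puncturedTangentBundle (hsphere n))
        (complexify (canonicalOneForm sphereFlat))
        (pullback tauS fun B =>
          ((2 : ℂ)⁻¹ * Complex.I) • (del potentialS B - delbar potentialS B)) ∧
      EqOnSubmanifold (puncturedTangentBundle (hsphere n))
        (complexify (canonicalSymplecticForm sphereFlat))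
        (pullback tauS fun B => Complex.I • delbarDel potentialS B) ∧
      IsKaehlerVia (4 * n + 3) (puncturedTangentBundle (hsphere n)) (detCone n) tauS
        (canonicalSymplecticForm sphereFlat)) ∧
    -- its open subset of vectors not tangent to the Hopf fibration
    (spaceES n ⊆ puncturedTangentBundle (hsphere n) ∧
      EqOnSubmanifold (spaceES n)
        (complexify (canonicalOneForm sphereFlat))
        (pullback tauS fun B =>
          ((2 : ℂ)⁻¹ * Complex.I) • (del potentialS B - delbar potentialS B)) ∧
      EqOnSubmanifold (spaceES n)
        (complexify (canonicalSymplecticForm sphereFlat))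
        (pullback tauS fun B => Complex.I • delbarDel potentialS B) ∧
      IsKaehlerVia (4 * n + 3) (spaceES n) (spaceESTilde n) tauS
        (canonicalSymplecticForm sphereFlat)) ∧
    -- the punctured cotangent bundle of the quaternion projective space
    (spaceEH n = puncturedTangentBundle (quatProj n) ∧
      EqOnSubmanifold (spaceEH n)
        (complexify (canonicalOneForm projFlat))
        (pullback tauH fun A =>
          ((((2 : ℝ) ^ (-(3 / 4) : ℝ) : ℝ) : ℂ) * Complex.I) •
            (del potentialH A - delbar potentialH A)) ∧
      EqOnSubmanifold (spaceEH n)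
        (complexify (canonicalSymplecticForm projFlat))
        (pullback tauH fun A =>
          ((((2 : ℝ) ^ (1 / 4 : ℝ) : ℝ) : ℂ) * Complex.I) • delbarDel potentialH A) ∧
      IsKaehlerVia (4 * n) (spaceEH n) (spaceEHTilde n) tauH
        (canonicalSymplecticForm projFlat)) := by
  have hH : canonicalSymplecticForm (projFlat (n := n)) =
      extDeriv (oneForm (metricForm ((1 / 2 : ℝ) • minnerL n))) := by
    funext x
    rw [← canonicalOneForm_projFlat]
    rfl
  -- The coefficient of `∂̄∂` is twice that of `∂ - ∂̄`; here `2 · 2^(-3/4) = 2^(1/4)`, and for the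
  -- sphere `2 · 1/2 = 1`.
  have hH2 : (2 : ℝ) ^ (1 / 4 : ℝ) = 2 * (2 : ℝ) ^ (-(3 / 4) : ℝ) := by
    rw [← Real.rpow_one_add' zero_le_two (by norm_num)]
    norm_num
  have hS1 : (2 : ℂ)⁻¹ * Complex.I = ((1 / 2 : ℝ) : ℂ) * Complex.I := by push_cast; ring
  have hS2 : Complex.I = ((2 * (1 / 2) : ℝ) : ℂ) * Complex.I := by push_cast; ring
  have hS : canonicalSymplecticForm (sphereFlat (n := n)) = extDeriv (oneForm (sphereForm n)) := by
    funext x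
    rw [← canonicalOneForm_sphereFlat]
    rfl
  rw [hS, canonicalOneForm_sphereFlat, potentialS_eq, hS1]
  refine ⟨⟨potentialData_sphere.eqOn_oneForm, ?_, potentialData_sphere.isKaehlerVia⟩,
    ⟨spaceES_subset, potentialData_spaceES.eqOn_oneForm, ?_, potentialData_spaceES.isKaehlerVia⟩,
    ⟨spaceEH_eq, ?_, ?_, ?_⟩⟩
  · have h := potentialData_sphere (n := n).eqOn_twoForm
    rwa [← hS2] at h
  · have h := potentialData_spaceES (n := n).eqOn_twoForm
    rwa [← hS2] at h
  · rw [canonicalOneForm_projFlat, potentialH_eq]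
    exact potentialData_spaceEH.eqOn_oneForm
  · have h := potentialData_spaceEH (n := n).eqOn_twoForm
    rwa [← hH2, ← hH, ← potentialH_eq] at h
  · rw [hH]
    exact potentialData_spaceEH.isKaehlerVia
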